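/- **Model.** Words are over $\{0,1\}$, and $|w|$ is the length of $w$. Test particles of mass $m$ are shot with velocity $u>0$ at a particle of unknown mass $\mu\in(0,1)$ at rest at the origin. After the elastic collision a test particle has velocity $v=\frac{m-\mu}{m+\mu}u$ and needs time $1/|v|$ to reach one of the flags at $\pm1$ (it never does so if $m=\mu$). The collider has fixed precision $\varepsilon>0$: when mass $x$ is requested, the mass $m$ of the test particle is uniformly distributed on $[x-\varepsilon,x+\varepsilon]$, independently of all other shots (if $m\le 0$ there is no particle to be seen). An *error-prone analogue-digital collider machine* is a multitape Turing machine with a query tape, a shooting state and three answer states, connected to such a collider, with a schedule $T:\mathbb N\to\mathbb N$. In the shooting state with the word $z=z_1\dots z_n$ on the query tape, where $z=1$ or $z$ begins with $0$, the mass $\sum_i 2^{-i+1}z_i$ is requested and shot; the machine waits $T(|z|)$ time steps and resumes in the answer state "lesser" if the test particle has reached $-1$ by time $T(|z|)$, "greater" if it has reached $+1$ by then, and "time out" otherwise (also if $z$ is not of the required form). Each query adds its whole waiting time to the running time. The protocol is *exponential* if $a^n=O(T(n))$ and $T(n)=O(b^n)$ for some $a,b>1$. $T$ is *time constructible* if some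 deterministic Turing machine halts on every input of length $n$ after exactly $T(n)$ steps. The machine *decides* $A\subseteq\{0,1\}^*$ *in polynomial time* if there are $\gamma<\frac12$ and a polynomial $p$ such that, on every input $w$, every computation (for every sequence of results of experiments) halts within $p(|w|)$ time steps and the probability of not giving the correct verdict on $w$ is smaller than $\gamma$. A *prefix function* is a map $f:\mathbb N\to\{0,1\}^*$ with $f(n)$ a prefix of $f(n+1)$ for all $n$; $f\in\log*$ if moreover $|f(n)|=O(\log n)$, meaning $|f(n)|\le a\lfloor\log_2 n\rfloor+b$ for some $a,b\in\mathbb N$, with $\log_2 0:=0$. $BPP//\log*$ is the class of sets $A$ for which there are a probabilistic Turing machine $\mathcal M$ clocked in polynomial time, a prefix function $f\in\log*$ and a constant $0<\gamma<\frac12$ such that, for all $n$ and all $w$ with $|w|\le n$, $\mathcal M$ rejects $\langle w,f(n)\rangle$ with probability at most $\gamma$ if $w\in A$ and accepts it with probability at most $\gamma$ if $w\notin A$. Here $\langle x,y\rangle$ duplicates the bits of $x$ and $y$ and separates them by $01$. **Theorem.** Let $\varepsilon>0$ and $u>0$. 1. For every $A\in BPP//\log*$ there are an unknown mass $\mu\in(0,1)$,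 a time constructible exponential schedule $T$ and an error-prone analogue-digital collider machine with precision $\varepsilon$, velocity $u$, mass $\mu$ and schedule $T$ that decides $A$ in polynomial time. 2. Let $0<\delta<\frac12$ and let $f\in\log*$ be a prefix function. Then there are $\mu\in(0,1)$, a time constructible exponential schedule $T$ and such a machine which, on every input of length $n$, halts in every computation within a number of time steps polynomial in $n$, and writes $f(2^{\lceil\log_2 n\rceil})$ (read as $f(1)$ for $n=0$) with a probability of error of at most $\delta$. If moreover $|f(n)|=\lfloor a\log_2 n+b\rfloor$ for all $n$, for some $a,b\in\mathbb N$ (with $|f(0)|=b$), then there are also $\mu$, $T$ and a machine as above that writes $f(n)$ itself, in the same sense. -/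

import Mathlib

open MeasureTheory ProbabilityTheory Filter
open scoped ENNReal Asymptotics

namespace Collider

/-! ### Multitape Turing machines -/

/-- Tape symbols: the blank, the two bits, and finitely many auxiliary symbols. -/
inductive Sym (S : Type) where
  | blank : Sym S
  | bit : Bool → Sym S
  | extra : S → Sym S

/-- The bit a symbol stands for, if it is a bit. -/
def Sym.toBit {S : Type} : Sym S → Option Bool
  | .bit b => some b
  | _ => none

/-- Head movements. -/
inductive Move where
  | left
  | stay
  | right

/-- The displacement of the head. -/
def Move.shift : Move → ℤ
  | .left => -1
  | .stay => 0
  | .right => 1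

/-- A multitape Turing machine whose transition may also depend on an external symbol in `C`.
For `C = Unit` this is a deterministic machine, for `C = Bool` with a fair coin tossed at every
step it is a probabilistic machine. A state `q` with `halt q = some b` is a halting state,
accepting for `b = true` and rejecting for `b = false`. -/
structure TM (C : Type) where
  /-- states -/
  State : Type
  /-- names of the tapes -/
  Tape : Type
  /-- auxiliary tape symbols -/
  Extra : Type
  finite_state : Finite State
  finite_tape : Finite Tape
  finite_extra : Finite Extra
  /-- initial state -/
  start : State
  /-- the tape that holds the input word -/
  input : Tape
  /-- the tape on which an output word is left -/
  output : Tape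
  /-- halting states and their verdict -/
  halt : State → Option Bool
  /-- from the state, the scanned symbols and the external symbol: the new state and, on each
  tape, the symbol written and the movement of the head -/
  trans : State → (Tape → Sym Extra) → C → State × (Tape → Sym Extra × Move)

/-- A configuration: the state, the contents of the (two-way infinite) tapes, the head positions. -/
structure TM.Cfg {C : Type} (M : TM C) where
  /-- current state -/
  state : M.State
  /-- contents of the cells -/
  cells : M.Tape → ℤ → Sym M.Extra
  /-- head positions -/
  head : M.Tape → ℤ

/-- The tape with the word `w` in the cells `0, …, |w| - 1` and blanks elsewhere. -/
def tapeOfWord {S : Type} (w : List Bool) (i : ℤ) : Sym S :=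
  if 0 ≤ i then (w[i.toNat]?).elim Sym.blank Sym.bit else Sym.blank

open Classical in
/-- The word on a tape: the maximal run of bits starting in cell `0`. (A tape with infinitely many
bits, which no computation produces, is given the empty word.) -/
noncomputable def wordOfTape {S : Type} (t : ℤ → Sym S) : List Bool :=
  if h : ∃ n : ℕ, (t (n : ℤ)).toBit = none then
    (List.range (Nat.find h)).filterMap fun i : ℕ => (t (i : ℤ)).toBit
  else []

namespace TM

variable {C : Type} (M : TM C)

open Classical in
/-- Initial configuration on input `w`. -/
noncomputable def init (w : List Bool) : M.Cfg where
  state := M.start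
  cells := fun k => if k = M.input then tapeOfWord w else fun _ => Sym.blank
  head := fun _ => 0

/-- The machine has halted. -/
def Halted (c : M.Cfg) : Prop := (M.halt c.state).isSome

/-- One application of the transition function. -/
def move (c : M.Cfg) (a : C) : M.Cfg :=
  let r := M.trans c.state (fun k => c.cells k (c.head k)) a
  { state := r.1
    cells := fun k => Function.update (c.cells k) (c.head k) (r.2 k).1
    head := fun k => c.head k + (r.2 k).2.shift }

open Classical in
/-- One step; a halted configuration does not change any more. -/
noncomputable def next (c : M.Cfg) (a : C) : M.Cfg := if M.Halted c then c else M.move c a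

/-- The computation on input `w` along a sequence of external symbols. -/
noncomputable def run (w : List Bool) (r : ℕ → C) : ℕ → M.Cfg
  | 0 => M.init w
  | n + 1 => M.next (run w r n) (r n)

end TM

/-- The law of a Markov chain with transition law `κ`, started in `x`, after `n` steps. -/
noncomputable def evolve {α : Type} (κ : α → PMF α) (x : α) : ℕ → PMF α
  | 0 => PMF.pure x
  | n + 1 => (evolve κ x n).bind κ

/-- `T` is time constructible: some deterministic machine halts on every input of length `n` after
exactly `T n` steps. -/
def TimeConstructible (T : ℕ → ℕ) : Prop :=
  ∃ M : TM Unit, ∀ w : List Bool,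
    M.Halted (M.run w (fun _ => ()) (T w.length)) ∧
      ∀ t < T w.length, ¬ M.Halted (M.run w (fun _ => ()) t)

/-- `T` grows exponentially: it lies between two exponential functions, up to constants. -/
def IsExponential (T : ℕ → ℕ) : Prop :=
  ∃ a b : ℝ, 1 < a ∧ 1 < b ∧
    (fun n : ℕ => a ^ n) =O[atTop] (fun n : ℕ => (T n : ℝ)) ∧
    (fun n : ℕ => (T n : ℝ)) =O[atTop] (fun n : ℕ => b ^ n)

/-! ### Probabilistic machines and `BPP//log*` -/

/-- A probabilistic Turing machine is clocked by `p` if each of its computations on an input `x`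
halts within `p(|x|)` steps. -/
def Clocked (M : TM Bool) (p : Polynomial ℕ) : Prop :=
  ∀ (x : List Bool) (r : ℕ → Bool), ∃ t ≤ p.eval x.length, M.Halted (M.run x r t)

/-- The probability that a probabilistic machine halts on input `x` with verdict `b`
(`true` for acceptance, `false` for rejection), with a fair coin tossed at every step. -/
noncomputable def verdictProb (M : TM Bool) (x : List Bool) (b : Bool) : ℝ≥0∞ :=
  ⨆ t : ℕ, (evolve (fun c => (PMF.uniformOfFintype Bool).map (M.next c)) (M.init x) t).toOuterMeasure
    {c | M.halt c.state = some b}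

/-- The pairing of two words: duplicate the bits, separate by `01`. -/
def pair (x y : List Bool) : List Bool :=
  (x.flatMap fun b => [b, b]) ++ [false, true] ++ (y.flatMap fun b => [b, b])

/-- `f` is a prefix function: `f n` is a prefix of `f (n + 1)`. -/
def IsPrefixFunction (f : ℕ → List Bool) : Prop := ∀ n, f n <+: f (n + 1)

/-- `f` is an advice function of logarithmic size. -/
def IsLogAdvice (f : ℕ → List Bool) : Prop :=
  ∃ a b : ℕ, ∀ n, (f n).length ≤ a * Nat.log 2 n + b

/-- `f` has length exactly `⌊a log₂ n + b⌋` for some natural numbers `a`, `b` (here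
`⌊a log₂ n⌋ = ⌊log₂ (n ^ a)⌋`, and the length at `n = 0` is `b`). -/
def HasExactLogLength (f : ℕ → List Bool) : Prop :=
  ∃ a b : ℕ, ∀ n, (f n).length = Nat.log 2 (n ^ a) + b

/-- The class `BPP//log*`. -/
def BPPLogStar : Set (Language Bool) :=
  {A | ∃ (M : TM Bool) (p : Polynomial ℕ) (f : ℕ → List Bool) (γ : ℝ),
    Clocked M p ∧ IsPrefixFunction f ∧ IsLogAdvice f ∧ 0 < γ ∧ γ < 1 / 2 ∧
    ∀ (n : ℕ) (w : List Bool), w.length ≤ n →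
      (w ∈ A → verdictProb M (pair w (f n)) false ≤ ENNReal.ofReal γ) ∧
      (w ∉ A → verdictProb M (pair w (f n)) true ≤ ENNReal.ofReal γ)}

/-! ### The collider experiment -/

/-- Velocity of the test particle after an elastic collision: a test particle of mass `m` and
velocity `u` hits a particle of mass `μ` at rest. -/
noncomputable def velTest (m μ u : ℝ) : ℝ := (m - μ) / (m + μ) * u

/-- Velocity of the other particle after the collision. -/
noncomputable def velTarget (m μ u : ℝ) : ℝ := 2 * m / (m + μ) * u

/-- The two velocities conserve momentum and kinetic energy. -/
theorem conservation {m μ : ℝ} (u : ℝ) (hm : 0 < m) (hμ : 0 < μ) :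
    m * u = m * velTest m μ u + μ * velTarget m μ u ∧
      1 / 2 * m * u ^ 2 = 1 / 2 * m * velTest m μ u ^ 2 + 1 / 2 * μ * velTarget m μ u ^ 2 := by
  have h : m + μ ≠ 0 := (add_pos hm hμ).ne'
  unfold velTest velTarget
  constructor <;> field_simp <;> ring

/-- The results of an experiment: the test mass is lesser than the unknown mass (the test particle
is seen at the flag `-1`), greater (it is seen at the flag `+1`), or time out. -/
inductive Outcome where
  | lesser
  | greater
  | timeOut
  deriving DecidableEq

instance : Fintype Outcome :=
  ⟨{Outcome.lesser, Outcome.greater, Outcome.timeOut}, by rintro (_ | _ | _) <;> simp⟩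

instance : MeasurableSpace Outcome := ⊤

instance : DiscreteMeasurableSpace Outcome := ⟨fun _ => trivial⟩

open Classical in
/-- The result of one shot with actual test mass `m`, velocity `u`, unknown mass `μ` at the origin,
and time limit `τ` (counted from the collision). The test particle needs time `1 / |v|` to reach
the flag at distance `1`. A test particle of non-positive mass does not exist, and so it is never
seen. -/
noncomputable def shot (μ u τ m : ℝ) : Outcome :=
  if 0 < m ∧ velTest m μ u < 0 ∧ 1 / |velTest m μ u| ≤ τ then Outcome.lesser
  else if 0 < m ∧ 0 < velTest m μ u ∧ 1 / |velTest m μ u| ≤ τ then Outcome.greater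
  else Outcome.timeOut

theorem measurable_shot (μ u τ : ℝ) : Measurable (shot μ u τ) := by
  have hv : Measurable fun m : ℝ => velTest m μ u := by
    unfold velTest; fun_prop
  have ha : Measurable fun m : ℝ => 1 / |velTest m μ u| :=
    measurable_const.div (measurable_norm.comp hv)
  unfold shot
  refine Measurable.ite ?_ measurable_const (Measurable.ite ?_ measurable_const measurable_const)
  · exact (measurableSet_lt measurable_const measurable_id).inter
      ((measurableSet_lt hv measurable_const).inter (measurableSet_le ha measurable_const))
  · exact (measurableSet_lt measurable_const measurable_id).inter
      ((measurableSet_lt measurable_const hv).inter (measurableSet_le ha measurable_const))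

/-- A collider with fixed precision: the error margin `precision` of the test mass, the unknown
mass in `(0, 1)`, and the velocity of the test particles. Lengths are measured in distances to a
flag and time in machine steps. -/
structure Apparatus where
  /-- fixed precision -/
  precision : ℝ
  /-- unknown mass -/
  mass : ℝ
  /-- initial velocity of the test particles -/
  speed : ℝ
  precision_pos : 0 < precision
  mass_pos : 0 < mass
  mass_lt_one : mass < 1
  speed_pos : 0 < speed

/-- Query words are `1` and the words that begin with `0`. -/
def IsQuery (z : List Bool) : Prop := z = [true] ∨ ∃ s, z = false :: s

/-- The dyadic rational `∑ 2 ^ (-i + 1) zᵢ` denoted by the word `z₁ … zₙ`. -/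
noncomputable def dyadic (z : List Bool) : ℝ :=
  ∑ i : Fin z.length, if z[i] then (2 : ℝ)⁻¹ ^ (i : ℕ) else 0

theorem isProbabilityMeasure_uniform {ε : ℝ} (hε : 0 < ε) (x : ℝ) :
    IsProbabilityMeasure (cond (volume : Measure ℝ) (Set.Icc (x - ε) (x + ε))) := by
  apply cond_isProbabilityMeasure_of_finite
  · rw [Real.volume_Icc]
    simp only [ne_eq, ENNReal.ofReal_eq_zero, not_le]
    linarith
  · rw [Real.volume_Icc]
    exact ENNReal.ofReal_ne_top

open Classical in
/-- The law of the result of the query `z` with time limit `τ`: the mass of the test particle is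
uniformly distributed within `precision` of the requested mass. A word that is not a query word
fires nothing and times out. -/
noncomputable def Apparatus.outcomeLaw (E : Apparatus) (τ : ℕ) (z : List Bool) : PMF Outcome :=
  if IsQuery z then
    haveI := isProbabilityMeasure_uniform E.precision_pos (dyadic z)
    haveI : IsProbabilityMeasure
        ((cond (volume : Measure ℝ)
          (Set.Icc (dyadic z - E.precision) (dyadic z + E.precision))).map
            (shot E.mass E.speed τ)) :=
      Measure.isProbabilityMeasure_map (measurable_shot _ _ _).aemeasurable
    ((cond (volume : Measure ℝ)
      (Set.Icc (dyadic z - E.precision) (dyadic z + E.precision))).map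
        (shot E.mass E.speed τ)).toPMF
  else PMF.pure Outcome.timeOut

/-! ### Analogue-digital collider machines -/

/-- A deterministic Turing machine connected to the collider: it has a query tape, a shooting
state, and the states (lesser, greater, time out) in which it resumes after an experiment. -/
structure Machine extends TM Unit where
  /-- the query tape -/
  query : Tape
  /-- the shooting state -/
  shoot : State
  /-- the states in which the computation is resumed -/
  answer : Outcome → State

namespace Machine

variable (M : Machine)

/-- The machine is in the shooting state (and has not halted). -/
def Shooting (c : M.toTM.Cfg) : Prop := ¬ M.toTM.Halted c ∧ c.state = M.shoot

/-- The word on the query tape. -/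
noncomputable def queryWord (c : M.toTM.Cfg) : List Bool := wordOfTape (c.cells M.query)

/-- The word on the output tape. -/
noncomputable def outputWord (c : M.toTM.Cfg) : List Bool := wordOfTape (c.cells M.output)

/-- Resume after an experiment with result `o`. -/
def resume (c : M.toTM.Cfg) (o : Outcome) : M.toTM.Cfg := { c with state := M.answer o }

open Classical in
/-- One transition; `o` is the result of the experiment if one is made. -/
noncomputable def next (c : M.toTM.Cfg) (o : Outcome) : M.toTM.Cfg :=
  if M.Shooting c then M.resume c o else M.toTM.next c ()

/-- The computation on input `w` along a sequence of results of experiments. -/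
noncomputable def run (w : List Bool) (o : ℕ → Outcome) : ℕ → M.toTM.Cfg
  | 0 => M.toTM.init w
  | n + 1 => M.next (run w o n) (o n)

open Classical in
/-- The number of time steps that a transition takes: one, and with a query `z` moreover the whole
waiting time `T |z|`. -/
noncomputable def cost (T : ℕ → ℕ) (c : M.toTM.Cfg) : ℕ :=
  if M.Shooting c then T (M.queryWord c).length + 1 else 1

/-- With schedule `T`, every computation on `w` halts within `B` time steps. -/
def HaltsWithin (T : ℕ → ℕ) (w : List Bool) (B : ℕ) : Prop :=
  ∀ o : ℕ → Outcome, ∃ n : ℕ, M.toTM.Halted (M.run w o n) ∧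
    ∑ i ∈ Finset.range n, M.cost T (M.run w o i) ≤ B

open Classical in
/-- The law of the next configuration. Each experiment uses a fresh, independent test mass. -/
noncomputable def nextLaw (E : Apparatus) (T : ℕ → ℕ) (c : M.toTM.Cfg) : PMF M.toTM.Cfg :=
  if M.Shooting c then
    (E.outcomeLaw (T (M.queryWord c).length) (M.queryWord c)).map (M.resume c)
  else PMF.pure (M.toTM.next c ())

/-- The probability that the machine on input `w` halts in a configuration that satisfies `P`. -/
noncomputable def haltProb (E : Apparatus) (T : ℕ → ℕ) (w : List Bool)
    (P : M.toTM.Cfg → Prop) : ℝ≥0∞ :=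
  ⨆ n : ℕ, (evolve (M.nextLaw E T) (M.toTM.init w) n).toOuterMeasure
    {c | M.toTM.Halted c ∧ P c}

/-- The error probability on input `w`, when halting in a configuration that satisfies `P` is the
correct result. -/
noncomputable def errorProb (E : Apparatus) (T : ℕ → ℕ) (w : List Bool)
    (P : M.toTM.Cfg → Prop) : ℝ≥0∞ := 1 - M.haltProb E T w P

/-- The machine with apparatus `E` and schedule `T` decides `A` in polynomial time: all
computations halt in polynomial time, and the error probability is below some `γ < 1 / 2`. -/
def DecidesInPolyTime (E : Apparatus) (T : ℕ → ℕ) (A : Language Bool) : Prop :=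
  ∃ (γ : ℝ) (p : Polynomial ℕ), γ < 1 / 2 ∧ ∀ w : List Bool,
    M.HaltsWithin T w (p.eval w.length) ∧
      M.errorProb E T w (fun c =>
        (w ∈ A ∧ M.halt c.state = some true) ∨ (w ∉ A ∧ M.halt c.state = some false))
        < ENNReal.ofReal γ

/-- The machine with apparatus `E` and schedule `T` obtains `g n` from each input of length `n`, in
time polynomial in `n` and with error probability at most `δ`. -/
def ObtainsInPolyTime (E : Apparatus) (T : ℕ → ℕ) (g : ℕ → List Bool) (δ : ℝ) : Prop :=
  ∃ p : Polynomial ℕ, ∀ w : List Bool,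
    M.HaltsWithin T w (p.eval w.length) ∧
      M.errorProb E T w (fun c => M.outputWord c = g w.length) ≤ ENNReal.ofReal δ

end Machine

end Collider

/-!
The machines request the mass `0` in every experiment. The actual test mass `m` is then uniformly
distributed around `0`, and the result is "lesser" if and only if `0 < m ≤ r μ`, where `μ` is the
unknown mass and the constant `r > 0` depends on the velocity and on the time limit
(`outcomeLaw_lesser`). Since `μ` is arbitrary, the collider is a coin whose bias `q` may be any
sufficiently small positive real number (`exists_apparatus`, `exists_coin`).

The advice is coded in the base `5` digits of the bias: a chain of words `F 0, F 1, …` of linearly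
growing length is cut into blocks, the letters and the ends of the blocks become the digits `1`, `2`
and `3`, and `q = θ / 5 ^ h` where `θ` has these digits. As the digits `0` and `4` do not occur, `θ`
keeps a distance from the ends of each interval of numbers with the same first digits. Hence the
first `L` digits can be read off the number of successes among about `5 ^ (s + h)` tosses, if `s`
exceeds `2 L` by a constant; the probability of error is bounded by Chebyshev's inequality, in the
form of a quadratic potential (`tr_sampleProg`, `decode_of_abs_lt`, `exists_advice`). For an input of
length `n` the words with `j = O(log n)` are needed, so that `s = O(log n)` and the number of tosses
is polynomial.

Tosses are counted and time is measured by an odometer (`tick`), which traverses the complete 5-ary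
tree of a given depth in a depth-first manner, one edge in each step. The marks on its cells show
which subtree is being visited; so they spell, up to a small margin, the base `5` digits of the
fraction of the traversal that has been completed (`digits_tick`). No conversion between bases is
needed, and the same device shows that the schedule is time constructible
(`timeConstructible_sched`).

Machines are written as structured programs `Prog` whose steps read one coin each. The judgement
`Tr P p Φ s t δ` says that `P` terminates within `t` steps on all sequences of coins and that the
numbers which `Φ` attaches to the final stores have mean at most `δ`; it is compositional, and
`toMachine_spec` turns it into bounds for the running time and the error probability of a collider
machine that runs `P`.

The second part of the theorem follows with `F j = f (2 ^ j)`, and with the truncations of these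
words when the length of `f n` is known. For the first part, the decoded advice is written next to
the input and the probabilistic machine is simulated, where fair bits are extracted from pairs of
tosses of the biased coin by von Neumann's method. The odometer that clocks the simulation has
logarithmic depth, chosen so large that all the fair bits needed are found except with small
probability (`simErr_le`).
-/

namespace Collider

/-! ### Tapes and structured programs with coins -/

/-- A tape together with the position of its head. -/
@[ext]
structure Tp (S : Type) where
  /-- contents of the cells -/
  cells : ℤ → Sym S
  /-- head position -/
  head : ℤ

namespace Tp

variable {S : Type}

/-- The scanned symbol. -/
def read (t : Tp S) : Sym S := t.cells t.head

/-- Write a symbol and move the head. -/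
def act (t : Tp S) (a : Sym S × Move) : Tp S :=
  ⟨Function.update t.cells t.head a.1, t.head + a.2.shift⟩

/-- Move the head without writing. -/
def go (t : Tp S) (m : Move) : Tp S := ⟨t.cells, t.head + m.shift⟩

@[simp] lemma act_read (t : Tp S) (m : Move) : t.act (t.read, m) = t.go m := by
  simp [act, read, go]

@[simp] lemma go_stay (t : Tp S) : t.go .stay = t := by
  simp [go, Move.shift]

/-- The blank tape. -/
def blank : Tp S := ⟨fun _ => .blank, 0⟩

end Tp

/-- A store: one tape for each name. -/
abbrev Store (K S : Type) := K → Tp S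

/-- The scanned symbols. -/
abbrev Store.scan {K S : Type} (s : Store K S) : K → Sym S := fun k => (s k).read

/-- Write and move on all tapes. -/
abbrev Store.act {K S : Type} (s : Store K S) (a : K → Sym S × Move) : Store K S :=
  fun k => (s k).act (a k)

/-- A program is a finite transition system that acts on the tapes and reads one coin at each step;
the next state `none` is the exit. -/
structure Prog (K S : Type) where
  /-- control states -/
  Q : Type
  finite_state : Finite Q
  /-- where the program is entered -/
  entry : Q
  /-- from the control state, the scanned symbols and the coin: the next control state and the
  actions on the tapes -/
  trans : Q → (K → Sym S) → Bool → Option Q × (K → Sym S × Move)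

/-- `Ev P p Φ q s t δ`: started in control state `q` on the store `s`, the program `P` leaves within
`t` steps whatever the coins are, and `Φ s' δ'` holds for each possible final store `s'`, where the
numbers `δ'` have weighted average at most `δ`, when the coins show `true` with probability `p`.
If `Φ s' δ'` says that `s'` is correct or `1 ≤ δ'`, then `δ` bounds the probability of error. -/
inductive Ev {K S : Type} (P : Prog K S) (p : ℝ) (Φ : Store K S → ℝ → Prop) :
    Option P.Q → Store K S → ℕ → ℝ → Prop
  | done {s : Store K S} {t : ℕ} {δ : ℝ} : Φ s δ → Ev P p Φ none s t δ
  | step {q : P.Q} {s : Store K S} {t : ℕ} {δ : ℝ} (d : Bool → ℝ) :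
      (∀ c, Ev P p Φ (P.trans q s.scan c).1 (s.act (P.trans q s.scan c).2) t (d c)) →
      p * d true + (1 - p) * d false ≤ δ → Ev P p Φ (some q) s (t + 1) δ

/-- `Ev` from the entry. -/
abbrev Tr {K S : Type} (P : Prog K S) (p : ℝ) (Φ : Store K S → ℝ → Prop) (s : Store K S) (t : ℕ)
    (δ : ℝ) : Prop := Ev P p Φ (some P.entry) s t δ

/-- Whatever the coins are, `P` transforms the store `s` into `s'` within `t` steps. -/
def DTr {K S : Type} (P : Prog K S) (s : Store K S) (t : ℕ) (s' : Store K S) : Prop :=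
  ∀ (p : ℝ) (Φ : Store K S → ℝ → Prop) (δ : ℝ), Φ s' δ → Tr P p Φ s t δ

section Rules

variable {K S : Type} {p : ℝ} {Φ Ψ : Store K S → ℝ → Prop}

lemma Ev.mono_time {P : Prog K S} {o : Option P.Q} {s : Store K S} {t : ℕ} {δ : ℝ}
    (h : Ev P p Φ o s t δ) : ∀ {t' : ℕ}, t ≤ t' → Ev P p Φ o s t' δ := by
  induction h with
  | done h => intro t' _; exact .done h
  | step d _ hd ih =>
    intro t' ht
    obtain ⟨t', rfl⟩ : ∃ r, t' = r + 1 := ⟨t' - 1, by omega⟩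
    exact .step d (fun c => ih c (by omega)) hd

lemma DTr.mono_time {P : Prog K S} {s s' : Store K S} {t t' : ℕ} (h : DTr P s t s')
    (ht : t ≤ t') : DTr P s t' s' := fun p Φ δ hΦ => Ev.mono_time (h p Φ δ hΦ) ht

/-- A single step that does not depend on a control state. -/
def Prog.atom (f : (K → Sym S) → Bool → K → Sym S × Move) : Prog K S where
  Q := Unit
  finite_state := inferInstance
  entry := ()
  trans := fun _ σ c => (none, f σ c)

lemma Tr.atom {f : (K → Sym S) → Bool → K → Sym S × Move} {s : Store K S} {δ : ℝ} (d : Bool → ℝ)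
    (h : ∀ c, Φ (s.act (f s.scan c)) (d c)) (hd : p * d true + (1 - p) * d false ≤ δ) :
    Tr (Prog.atom f) p Φ s 1 δ :=
  .step d (fun c => .done (h c)) hd

lemma DTr.atom {f : (K → Sym S) → Bool → K → Sym S × Move} {s s' : Store K S}
    (h : ∀ c, s.act (f s.scan c) = s') : DTr (Prog.atom f) s 1 s' := fun p Φ δ hΦ =>
  Tr.atom (fun _ => δ) (fun c => by rw [h c]; exact hΦ) (by linarith)

/-- Sequential composition. -/
def Prog.seq (P R : Prog K S) : Prog K S where
  Q := P.Q ⊕ R.Q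
  finite_state := by
    have := P.finite_state
    have := R.finite_state
    infer_instance
  entry := .inl P.entry
  trans := fun q σ c => match q with
    | .inl q =>
      (some ((P.trans q σ c).1.elim (.inr R.entry) .inl), (P.trans q σ c).2)
    | .inr q => ((R.trans q σ c).1.map .inr, (R.trans q σ c).2)

lemma Ev.seq_right {P R : Prog K S} {o : Option R.Q} {s : Store K S} {t : ℕ} {δ : ℝ}
    (h : Ev R p Φ o s t δ) : Ev (P.seq R) p Φ (o.map .inr) s t δ := by
  induction h with
  | done h => exact .done h
  | step d _ hd ih => exact .step d ih hd

lemma Ev.seq {P R : Prog K S} {o : Option P.Q} {s : Store K S} {t t' : ℕ} {δ : ℝ}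
    (h : Ev P p Φ o s t δ) (hR : ∀ s d, Φ s d → Tr R p Ψ s t' d) :
    Ev (P.seq R) p Ψ (some (o.elim (.inr R.entry) .inl)) s (t + t') δ := by
  induction h with
  | done h => exact (Ev.seq_right (hR _ _ h)).mono_time (by omega)
  | @step q s t δ d _ hd ih =>
    rw [show t + 1 + t' = t + t' + 1 by omega]
    exact .step d ih hd

lemma Tr.seq {P R : Prog K S} {s : Store K S} {t t' : ℕ} {δ : ℝ}
    (h : Tr P p Φ s t δ) (hR : ∀ s d, Φ s d → Tr R p Ψ s t' d) :
    Tr (P.seq R) p Ψ s (t + t') δ := Ev.seq h hR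

lemma DTr.seq {P R : Prog K S} {s s' s'' : Store K S} {t t' : ℕ} (h : DTr P s t s')
    (h' : DTr R s' t' s'') : DTr (P.seq R) s (t + t') s'' := fun p Φ δ hΦ =>
  Tr.seq (h p (fun r d => r = s' ∧ d = δ) δ ⟨rfl, rfl⟩)
    (by rintro r d ⟨rfl, rfl⟩; exact h' p Φ d hΦ)

lemma DTr.seqTr {P R : Prog K S} {s s' : Store K S} {t t' : ℕ} {δ : ℝ} (h : DTr P s t s')
    (h' : Tr R p Φ s' t' δ) : Tr (P.seq R) p Φ s (t + t') δ :=
  Tr.seq (h p (fun r d => r = s' ∧ d = δ) δ ⟨rfl, rfl⟩)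
    (by rintro r d ⟨rfl, rfl⟩; exact h')

/-- Repeat `P` as long as the scanned symbols pass the test. -/
def Prog.loop (b : (K → Sym S) → Bool) (P : Prog K S) : Prog K S where
  Q := Option P.Q
  finite_state := by
    have := P.finite_state
    infer_instance
  entry := none
  trans := fun q σ c => match q with
    | none => (if b σ then some (some P.entry) else none, fun k => (σ k, .stay))
    | some q => (some (P.trans q σ c).1, (P.trans q σ c).2)

lemma Store.act_stay (s : Store K S) : s.act (fun k => (s.scan k, Move.stay)) = s := by
  ext1 k; simp [Store.act, Store.scan]

lemma Tr.loop_exit {b : (K → Sym S) → Bool} {P : Prog K S} {s : Store K S} {t : ℕ} {δ : ℝ}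
    (hb : b s.scan = false) (h : Φ s δ) : Tr (P.loop b) p Φ s (t + 1) δ := by
  refine .step (fun _ => δ) (fun c => ?_) (by linarith)
  simp only [Prog.loop, hb, Store.act_stay]
  exact .done h

lemma Ev.loop {b : (K → Sym S) → Bool} {P : Prog K S} {o : Option P.Q} {s : Store K S}
    {t t' : ℕ} {δ : ℝ} (h : Ev P p Φ o s t δ) (hR : ∀ s d, Φ s d → Tr (P.loop b) p Ψ s t' d) :
    Ev (P.loop b) p Ψ (some o) s (t + t') δ := by
  induction h with
  | done h => exact (hR _ _ h).mono_time (by omega)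
  | @step q s t δ d _ hd ih =>
    rw [show t + 1 + t' = t + t' + 1 by omega]
    exact .step d ih hd

lemma Tr.loop_step {b : (K → Sym S) → Bool} {P : Prog K S} {s : Store K S}
    {t t' : ℕ} {δ : ℝ} (hb : b s.scan = true) (h : Tr P p Φ s t δ)
    (hR : ∀ s d, Φ s d → Tr (P.loop b) p Ψ s t' d) :
    Tr (P.loop b) p Ψ s (t + t' + 1) δ := by
  refine .step (fun _ => δ) (fun c => ?_) (by linarith)
  simp only [Prog.loop, hb, Store.act_stay]
  exact Ev.loop h hR

lemma DTr.loop_exit {b : (K → Sym S) → Bool} {P : Prog K S} {s : Store K S}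
    (hb : b s.scan = false) : DTr (P.loop b) s 1 s := fun _ _ _ hΦ =>
  Tr.loop_exit (t := 0) hb hΦ

lemma DTr.loop_step {b : (K → Sym S) → Bool} {P : Prog K S} {s s' s'' : Store K S} {t t' : ℕ}
    (hb : b s.scan = true) (h : DTr P s t s') (h' : DTr (P.loop b) s' t' s'') :
    DTr (P.loop b) s (t + t' + 1) s'' := fun p Φ δ hΦ =>
  Tr.loop_step hb (h p (fun r d => r = s' ∧ d = δ) δ ⟨rfl, rfl⟩)
    (by rintro r d ⟨rfl, rfl⟩; exact h' p Φ d hΦ)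

/-- A loop whose body runs through a sequence of stores, each iteration within `τ` steps. -/
lemma DTr.loop_iterate {b : (K → Sym S) → Bool} {P : Prog K S} {τ : ℕ} :
    ∀ {n : ℕ} (σ : ℕ → Store K S), (∀ i < n, b (σ i).scan = true) →
      (∀ i < n, DTr P (σ i) τ (σ (i + 1))) → b (σ n).scan = false →
      DTr (P.loop b) (σ 0) (n * (τ + 1) + 1) (σ n)
  | 0, σ, _, _, h => by simpa using DTr.loop_exit h
  | n + 1, σ, h1, h2, h => by
    have := DTr.loop_iterate (n := n) (fun i => σ (i + 1)) (fun i hi => h1 _ (by omega))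
      (fun i hi => h2 _ (by omega)) h
    exact (DTr.loop_step (h1 0 (by omega)) (h2 0 (by omega)) this).mono_time (by ring_nf; omega)

end Rules

section Odometer

/-! ### The odometer -/

/-- Auxiliary symbols: the end marker and the marks of an odometer. -/
inductive Aux where
  | lend
  | dig (i : Fin 6)

instance : Finite Aux := by
  refine Finite.of_surjective (fun o : Option (Fin 6) => o.elim Aux.lend Aux.dig) ?_
  rintro (_ | i)
  · exact ⟨none, rfl⟩
  · exact ⟨some i, rfl⟩

variable {S : Type}

/-- The end marker. -/
def lend : Sym (S ⊕ Aux) := .extra (.inr .lend)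

/-- The marks of an odometer. -/
def dig (i : Fin 6) : Sym (S ⊕ Aux) := .extra (.inr (.dig i))

/-- The action of an odometer, which traverses the complete 5-ary tree whose depth is the number of
marked cells: the mark `i` of a cell says that `i` of the subtrees below have been entered.
A bit counts as the mark `0`, a blank cell is a leaf, and the end marker stops the traversal. -/
def tick : Sym (S ⊕ Aux) → Sym (S ⊕ Aux) × Move
  | .extra (.inr .lend) => (lend, .stay)
  | .extra (.inr (.dig i)) => if i = 5 then (dig 0, .left) else (dig (i + 1), .right)
  | .extra (.inl x) => (.extra (.inl x), .left)
  | .blank => (.blank, .left)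
  | .bit _ => (dig 1, .right)

/-- One step of the odometer. -/
def Tp.tick (t : Tp (S ⊕ Aux)) : Tp (S ⊕ Aux) := t.act (Collider.tick t.read)

/-- The number of steps in which an odometer traverses the tree of depth `k`. -/
def odo : ℕ → ℕ
  | 0 => 1
  | k + 1 => 5 * odo k + 6

lemma two_mul_odo (k : ℕ) : 2 * odo k + 3 = 5 ^ (k + 1) := by
  induction k with
  | zero => rfl
  | succ k ih => rw [pow_succ, ← ih, odo]; ring

/-- A mark that says that nothing below has been visited. -/
def Fresh (x : Sym (S ⊕ Aux)) : Prop := x = dig 0 ∨ ∃ b, x = .bit b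

lemma tick_fresh {x : Sym (S ⊕ Aux)} (h : Fresh x) : tick x = (dig 1, .right) := by
  obtain rfl | ⟨b, rfl⟩ := h <;> rfl

/-- The cells `p, …, p + k - 1` with the mark `0`, the others as in `c`. -/
def reset (c : ℤ → Sym (S ⊕ Aux)) (p : ℤ) (k : ℕ) (i : ℤ) : Sym (S ⊕ Aux) :=
  if p ≤ i ∧ i < p + k then dig 0 else c i

/-- The cells `p, …, p + k - 1` are unvisited and followed by a blank. -/
def Ready (c : ℤ → Sym (S ⊕ Aux)) (p : ℤ) (k : ℕ) : Prop :=
  (∀ i, p ≤ i → i < p + k → Fresh (c i)) ∧ c (p + k) = .blank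

lemma Ready.reset {c : ℤ → Sym (S ⊕ Aux)} {p : ℤ} {k : ℕ} (h : Ready c p k) :
    Ready (reset c p k) p k := by
  refine ⟨fun i h1 h2 => ?_, ?_⟩
  · simp [Collider.reset, h1, h2, Fresh]
  · simpa [Collider.reset] using h.2

lemma reset_reset (c : ℤ → Sym (S ⊕ Aux)) (p : ℤ) (k : ℕ) :
    reset (reset c p k) p k = reset c p k := by
  funext i; unfold reset; split_ifs <;> rfl

lemma Ready.update {c : ℤ → Sym (S ⊕ Aux)} {p : ℤ} {k : ℕ} (h : Ready c p (k + 1))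
    (x : Sym (S ⊕ Aux)) : Ready (Function.update c p x) (p + 1) k := by
  refine ⟨fun i h1 h2 => ?_, ?_⟩
  · rw [Function.update_of_ne (by omega)]
    exact h.1 i (by omega) (by push_cast; omega)
  · rw [Function.update_of_ne (by omega)]
    have := h.2
    push_cast at this
    rw [← this]; congr 1; ring

lemma reset_update (c : ℤ → Sym (S ⊕ Aux)) (p : ℤ) (k : ℕ) (x : Sym (S ⊕ Aux)) :
    reset (Function.update c p x) (p + 1) k = Function.update (reset c p (k + 1)) p x := by
  funext i
  unfold reset
  rcases eq_or_ne i p with rfl | hi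
  · simp
  · simp only [Function.update_of_ne hi, Nat.cast_add, Nat.cast_one]
    congr 1
    apply propext
    constructor <;> rintro ⟨_, _⟩ <;> constructor <;> omega

lemma tick_mark {e : ℤ → Sym (S ⊕ Aux)} {p : ℤ} (i : Fin 6) (h : e p = dig i) (hi : i ≠ 5) :
    Tp.tick ⟨e, p⟩ = ⟨Function.update e p (dig (i + 1)), p + 1⟩ := by
  simp [Tp.tick, Tp.act, Tp.read, tick, h, dig, hi, Move.shift]

lemma tick_last {e : ℤ → Sym (S ⊕ Aux)} {p : ℤ} (h : e p = dig 5) :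
    Tp.tick ⟨e, p⟩ = ⟨Function.update e p (dig 0), p - 1⟩ := by
  simp [Tp.tick, Tp.act, Tp.read, tick, h, dig, Move.shift, sub_eq_add_neg]

/-- The subtrees of the first cell are entered every `odo k + 1` steps. -/
lemma tick_visit {k : ℕ} (full : ∀ (c : ℤ → Sym (S ⊕ Aux)) (p : ℤ), Ready c p k →
      Tp.tick^[odo k] ⟨c, p⟩ = ⟨reset c p k, p - 1⟩)
    {c : ℤ → Sym (S ⊕ Aux)} {p : ℤ} (h : Ready c p (k + 1)) (d : ℕ) (hd : d < 5) :
    ∃ e, Tp.tick^[d * (odo k + 1) + 1] ⟨c, p⟩ =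
        ⟨Function.update e p (dig ⟨d + 1, by omega⟩), p + 1⟩ ∧
      Ready e p (k + 1) ∧ reset e p (k + 1) = reset c p (k + 1) := by
  induction d with
  | zero =>
    refine ⟨c, ?_, h, rfl⟩
    simp [Tp.tick, Tp.act, Tp.read, tick_fresh (h.1 p le_rfl (by push_cast; omega)), Move.shift]
  | succ d ih =>
    obtain ⟨e, he, hr, hc⟩ := ih (by omega)
    refine ⟨reset c p (k + 1), ?_, h.reset, reset_reset _ _ _⟩
    rw [show (d + 1) * (odo k + 1) + 1 = 1 + odo k + (d * (odo k + 1) + 1) by ring,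
      Function.iterate_add_apply, he, Function.iterate_add_apply, full _ _ (hr.update _),
      Function.iterate_one, reset_update, add_sub_cancel_right, hc,
      tick_mark ⟨d + 1, by omega⟩ (by simp) (by simp [Fin.ext_iff]; omega), Function.update_idem]
    congr 3
    simp only [Fin.ext_iff, Fin.val_add]
    simp
    omega

/-- The full traversal ends with all marks `0` and the head to the left of the marked cells. -/
lemma tick_full (k : ℕ) : ∀ (c : ℤ → Sym (S ⊕ Aux)) (p : ℤ), Ready c p k →
    Tp.tick^[odo k] ⟨c, p⟩ = ⟨reset c p k, p - 1⟩ := by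
  induction k with
  | zero =>
    intro c p h
    have h2 : c p = .blank := by simpa using h.2
    have h3 : reset c p 0 = c := by
      funext i; unfold reset; rw [if_neg]; rintro ⟨_, _⟩; simp at *; omega
    simp only [odo, Function.iterate_one, Tp.tick, Tp.act, Tp.read, h2, tick, Move.shift, h3,
      sub_eq_add_neg]
    rw [← h2, Function.update_eq_self]
  | succ k ih =>
    intro c p h
    obtain ⟨e, he, hr, hc⟩ := tick_visit ih h 4 (by omega)
    rw [show odo (k + 1) = 1 + odo k + (4 * (odo k + 1) + 1) by rw [odo]; ring,
      Function.iterate_add_apply, he, Function.iterate_add_apply, ih _ _ (hr.update _),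
      Function.iterate_one, reset_update, add_sub_cancel_right, tick_last (by simp), hc,
      Function.update_idem]
    congr 1
    rw [Function.update_eq_self_iff]
    simp [reset]

/-- A step of the traversal, located in a subtree of the first cell. -/
lemma odo_split {k x : ℕ} (h1 : 0 < x) (h2 : x < odo (k + 1)) :
    ∃ d < 5, ∃ y ≤ odo k, x = y + (d * (odo k + 1) + 1) := by
  rw [odo] at h2
  refine ⟨(x - 1) / (odo k + 1), ?_, (x - 1) % (odo k + 1), ?_, ?_⟩
  · rw [Nat.div_lt_iff_lt_mul (by omega)]; omega
  · have := Nat.mod_lt (x - 1) (show 0 < odo k + 1 by omega); omega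
  · have := Nat.mod_add_div (x - 1) (odo k + 1); rw [mul_comm] at this; omega

/-- Before the traversal is complete, the head does not leave the marked cells to the left. -/
lemma le_head_tick (k : ℕ) : ∀ (c : ℤ → Sym (S ⊕ Aux)) (p : ℤ), Ready c p k →
    ∀ x < odo k, p ≤ (Tp.tick^[x] ⟨c, p⟩).head := by
  induction k with
  | zero =>
    intro c p _ x hx
    obtain rfl : x = 0 := by simp [odo] at hx; omega
    simp
  | succ k ih =>
    intro c p h x hx
    obtain rfl | h0 := Nat.eq_zero_or_pos x
    · simp
    obtain ⟨d, hd, y, hy, rfl⟩ := odo_split h0 hx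
    obtain ⟨e, he, hr, -⟩ := tick_visit (tick_full k) h d hd
    rw [Function.iterate_add_apply, he]
    obtain hy | rfl := hy.lt_or_eq
    · linarith [ih _ _ (hr.update (dig ⟨d + 1, by omega⟩)) y hy]
    · rw [tick_full k _ _ (hr.update _)]; simp

/-- The cells to the left of the marked ones do not change. -/
lemma cells_tick_of_lt {k : ℕ} {c : ℤ → Sym (S ⊕ Aux)} {p : ℤ} (h : Ready c p k) {x : ℕ}
    (hx : x ≤ odo k) {i : ℤ} (hi : i < p) : (Tp.tick^[x] ⟨c, p⟩).cells i = c i := by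
  induction x with
  | zero => rfl
  | succ x ih =>
    have := le_head_tick k c p h x (by omega)
    rw [Function.iterate_succ_apply', Tp.tick, Tp.act, ← ih (by omega)]
    exact Function.update_of_ne (by omega) _ _

/-- The number with the base `5` digits `D 0, …, D (L - 1)`, the leading one first. -/
def digitsVal (D : ℕ → ℕ) : ℕ → ℕ
  | 0 => 0
  | L + 1 => D 0 * 5 ^ L + digitsVal (fun i => D (i + 1)) L

lemma digitsVal_lt (L : ℕ) : ∀ (D : ℕ → ℕ), (∀ i < L, D i < 5) → digitsVal D L < 5 ^ L := by
  induction L with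
  | zero => intro D _; simp [digitsVal]
  | succ L ih =>
    intro D hD
    have h1 := ih (fun i => D (i + 1)) fun i hi => hD _ (by omega)
    have h2 := hD 0 (by omega)
    rw [digitsVal, pow_succ]
    nlinarith [Nat.mul_le_mul_right (5 ^ L) (show D 0 ≤ 4 by omega)]

/-- The marks show how much of the traversal has been done: if the fraction `2 x / 5 ^ (k + 1)` lies
well inside the interval of the numbers whose first base `5` digits are `D 0, …, D (L - 1)`, then
the first `L` marks spell these digits. -/
lemma digits_tick (L : ℕ) : ∀ (k : ℕ) (c : ℤ → Sym (S ⊕ Aux)) (p : ℤ) (D : ℕ → ℕ)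
    (hD : ∀ i, D i < 5) (x : ℕ), Ready c p k → L ≤ k →
    digitsVal D L * 5 ^ (k + 1 - L) + 2 * L ≤ 2 * x →
    2 * x + 2 * L + 3 ≤ (digitsVal D L + 1) * 5 ^ (k + 1 - L) →
    ∀ i < L, (Tp.tick^[x] ⟨c, p⟩).cells (p + i) =
      dig ⟨D i + 1, Nat.succ_lt_succ (hD i)⟩ := by
  induction L with
  | zero => intro _ _ _ _ _ _ _ _ _ _ i hi; omega
  | succ L ih =>
    intro k c p D hD x h hL h1 h2
    obtain ⟨k, rfl⟩ : ∃ r, k = r + 1 := ⟨k - 1, by omega⟩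
    rw [show k + 1 + 1 - (L + 1) = k + 1 - L by omega] at h1 h2
    have hpow : 5 ^ L * 5 ^ (k + 1 - L) = 2 * odo k + 3 := by
      rw [two_mul_odo, ← pow_add]; congr 1; omega
    have hd := hD 0
    have hlt := digitsVal_lt L (fun i => D (i + 1)) (fun i _ => hD _)
    set N := digitsVal (fun i => D (i + 1)) L with hN
    have e1 : digitsVal D (L + 1) * 5 ^ (k + 1 - L) =
        D 0 * (2 * odo k + 3) + N * 5 ^ (k + 1 - L) := by
      rw [← hpow, digitsVal]; ring
    have e2 : (N + 1) * 5 ^ (k + 1 - L) ≤ 2 * odo k + 3 := by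
      rw [← hpow]; exact Nat.mul_le_mul_right _ hlt
    rw [add_mul] at h2 e2
    rw [e1] at h1 h2
    -- The subtree with the number `D 0` has been entered, and `y` steps have been made in it.
    obtain ⟨y, hy⟩ : ∃ y, x = y + (D 0 * (odo k + 1) + 1) := by
      refine ⟨x - (D 0 * (odo k + 1) + 1), ?_⟩
      have : D 0 * (2 * odo k + 3) = 2 * (D 0 * (odo k + 1)) + D 0 := by ring
      omega
    have e3 : D 0 * (2 * odo k + 3) = 2 * (D 0 * (odo k + 1)) + D 0 := by ring
    have hy1 : N * 5 ^ (k + 1 - L) + 2 * L ≤ 2 * y := by omega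
    have hy2 : 2 * y + 2 * L + 3 ≤ (N + 1) * 5 ^ (k + 1 - L) := by rw [add_mul]; omega
    obtain ⟨e, he, hr, -⟩ := tick_visit (tick_full k) h (D 0) hd
    intro i hi
    rw [hy, Function.iterate_add_apply, he]
    cases i with
    | zero =>
      rw [cells_tick_of_lt (hr.update _) (by omega) (by simp)]
      simp
    | succ i =>
      have := ih k _ (p + 1) (fun i => D (i + 1)) (fun i => hD _) y
        (hr.update (dig ⟨D 0 + 1, by omega⟩)) (by omega) hy1 hy2 i (by omega)
      rw [← this]
      congr 1
      push_cast; ring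

lemma lend_of_tick_eq {x : Sym (S ⊕ Aux)} (h : (tick x).1 = lend) : x = lend := by
  obtain _ | _ | _ | _ | i := x
  · simp [tick, lend] at h
  · simp [tick, lend, dig] at h
  · simp [tick, lend] at h
  · rfl
  · simp only [tick] at h
    split_ifs at h <;> simp [lend, dig] at h

/-- An odometer writes no end marker. -/
lemma lend_of_cells_tick {t : Tp (S ⊕ Aux)} {x : ℕ} {i : ℤ}
    (h : (Tp.tick^[x] t).cells i = lend) : t.cells i = lend := by
  induction x with
  | zero => exact h
  | succ x ih =>
    rw [Function.iterate_succ_apply', Tp.tick, Tp.act] at h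
    dsimp only at h
    rcases eq_or_ne i (Tp.tick^[x] t).head with rfl | hi
    · rw [Function.update_self] at h
      exact ih (lend_of_tick_eq h)
    · rw [Function.update_of_ne hi] at h
      exact ih h

/-- Before the traversal is complete, the end marker is not scanned. -/
lemma read_tick_ne_lend {k : ℕ} {c : ℤ → Sym (S ⊕ Aux)} {p : ℤ} (h : Ready c p k)
    (hc : ∀ i, p ≤ i → c i ≠ lend) {x : ℕ} (hx : x < odo k) :
    (Tp.tick^[x] ⟨c, p⟩).read ≠ lend := fun h' =>
  hc _ (le_head_tick k c p h x hx) (lend_of_cells_tick (t := ⟨c, p⟩) h')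

/-! ### An exponential schedule -/

/-- Recognizes the end marker. -/
def isLend : Sym (S ⊕ Aux) → Bool
  | .extra (.inr .lend) => true
  | _ => false

lemma isLend_iff {x : Sym (S ⊕ Aux)} : isLend x = true ↔ x = lend := by
  obtain _ | _ | _ | _ | i := x <;> simp [isLend, lend]

/-- The schedule: an odometer on `n` cells, after `K + 3` further steps. -/
def sched (K n : ℕ) : ℕ := K + 3 + odo n

/-- The transitions of `schedTM`, with the states numbered. -/
def schedStep (K q : ℕ) (x : Sym (Empty ⊕ Aux)) : ℕ × (Sym (Empty ⊕ Aux) × Move) :=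
  if q < K then (q + 1, (x, .stay))
  else if q = K then (K + 1, (x, .left))
  else if q = K + 1 then (K + 2, (lend, .right))
  else if isLend x then (K + 3, (x, .stay))
  else (q, tick x)

/-- A machine that idles `K` steps, puts an end marker to the left of the input, runs an odometer on
the cells of the input and then halts. -/
def schedTM (K : ℕ) : TM Unit where
  State := Fin (K + 4)
  Tape := Unit
  Extra := Empty ⊕ Aux
  finite_state := inferInstance
  finite_tape := inferInstance
  finite_extra := inferInstance
  start := 0
  input := ()
  output := ()
  halt := fun q => if q.val = K + 3 then some true else none
  trans := fun q σ _ =>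
    (Fin.ofNat _ (schedStep K q.val (σ ())).1, fun _ => (schedStep K q.val (σ ())).2)

/-- A configuration of `schedTM` with state number `q` and tape `t`. -/
def schedCfg (K q : ℕ) (t : Tp (Empty ⊕ Aux)) : (schedTM K).Cfg where
  state := Fin.ofNat (K + 4) q
  cells := fun _ => t.cells
  head := fun _ => t.head

lemma halted_schedCfg {K q : ℕ} {t : Tp (Empty ⊕ Aux)} (hq : q < K + 4) :
    (schedTM K).Halted (schedCfg K q t) ↔ q = K + 3 := by
  simp [TM.Halted, schedTM, schedCfg, Nat.mod_eq_of_lt hq]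

lemma next_schedCfg {K q : ℕ} {t : Tp (Empty ⊕ Aux)} (hq : q < K + 3) :
    (schedTM K).next (schedCfg K q t) () =
      schedCfg K (schedStep K q t.read).1 (t.act (schedStep K q t.read).2) := by
  have hv : (Fin.ofNat (K + 4) q).val = q := by
    rw [Fin.val_ofNat]; exact Nat.mod_eq_of_lt (by omega)
  rw [TM.next, if_neg (by rw [halted_schedCfg (by omega)]; omega)]
  change schedCfg K (schedStep K (Fin.ofNat (K + 4) q).val t.read).1
    (t.act (schedStep K (Fin.ofNat (K + 4) q).val t.read).2) = _
  rw [hv]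

lemma run_schedTM_idle (K : ℕ) (w : List Bool) {i : ℕ} (hi : i ≤ K) :
    (schedTM K).run w (fun _ => ()) i = schedCfg K i ⟨tapeOfWord w, 0⟩ := by
  induction i with
  | zero =>
    simp [TM.run, TM.init, schedCfg, schedTM]
  | succ i ih =>
    rw [TM.run, ih (by omega), next_schedCfg (by omega), schedStep, if_pos (by omega),
      Tp.act_read, Tp.go_stay]

/-- The tape of `schedTM` when the odometer starts. -/
def schedTape (w : List Bool) : ℤ → Sym (Empty ⊕ Aux) :=
  Function.update (tapeOfWord w) (-1) lend

lemma tapeOfWord_of_lt {w : List Bool} {i : ℤ} (h0 : 0 ≤ i) (h1 : i < w.length) :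
    ∃ b, (tapeOfWord w i : Sym S) = .bit b := by
  lift i to ℕ using h0
  simp only [Nat.cast_lt] at h1
  exact ⟨w[i], by simp [tapeOfWord, h1]⟩

lemma tapeOfWord_of_le {w : List Bool} {i : ℤ} (h1 : w.length ≤ i) :
    (tapeOfWord w i : Sym S) = .blank := by
  lift i to ℕ using by omega
  simp only [Nat.cast_le] at h1
  simp [tapeOfWord, h1]

lemma tapeOfWord_of_neg {w : List Bool} {i : ℤ} (h : i < 0) :
    (tapeOfWord w i : Sym S) = .blank := by
  simp [tapeOfWord, h]

lemma ready_schedTape (w : List Bool) : Ready (schedTape w) 0 w.length := by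
  refine ⟨fun i h1 h2 => ?_, ?_⟩
  · rw [schedTape, Function.update_of_ne (by omega)]
    exact .inr (tapeOfWord_of_lt h1 (by omega))
  · rw [schedTape, Function.update_of_ne (by omega)]
    exact tapeOfWord_of_le (by omega)

lemma schedTape_ne_lend (w : List Bool) {i : ℤ} (hi : 0 ≤ i) : schedTape w i ≠ lend := by
  rw [schedTape, Function.update_of_ne (by omega)]
  rcases lt_or_ge i w.length with h | h
  · obtain ⟨b, hb⟩ := tapeOfWord_of_lt (S := Empty ⊕ Aux) hi h
    simp [hb, lend]
  · simp [tapeOfWord_of_le h, lend]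

lemma run_schedTM_odo (K : ℕ) (w : List Bool) {x : ℕ} (hx : x ≤ odo w.length) :
    (schedTM K).run w (fun _ => ()) (K + 2 + x) =
      schedCfg K (K + 2) (Tp.tick^[x] ⟨schedTape w, 0⟩) := by
  induction x with
  | zero =>
    have h1 : (schedTM K).run w (fun _ => ()) (K + 1) =
        schedCfg K (K + 1) (Tp.go ⟨tapeOfWord w, 0⟩ .left) := by
      rw [TM.run, run_schedTM_idle K w le_rfl, next_schedCfg (by omega), schedStep,
        if_neg (by omega), if_pos rfl, Tp.act_read]
    rw [add_zero, TM.run, h1, next_schedCfg (by omega), schedStep, if_neg (by omega),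
      if_neg (by omega), if_pos rfl]
    simp [Tp.go, Tp.act, Move.shift, schedTape]
  | succ x ih =>
    rw [← add_assoc, TM.run, ih (by omega), next_schedCfg (by omega), schedStep, if_neg (by omega),
      if_neg (by omega), if_neg (by omega),
      if_neg (mt isLend_iff.1 (read_tick_ne_lend (k := w.length) (ready_schedTape w)
        (fun i hi => schedTape_ne_lend w hi) (by omega))), Function.iterate_succ_apply']
    rfl

theorem timeConstructible_sched (K : ℕ) : TimeConstructible (sched K) := by
  refine ⟨schedTM K, fun w => ⟨?_, fun t ht => ?_⟩⟩
  · have h := run_schedTM_odo K w le_rfl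
    rw [sched, show K + 3 + odo w.length = K + 2 + odo w.length + 1 by ring, TM.run, h,
      next_schedCfg (by omega), schedStep, if_neg (by omega), if_neg (by omega),
      if_neg (by omega), if_pos, halted_schedCfg (by omega)]
    rw [tick_full _ _ _ (ready_schedTape w), isLend_iff]
    simp [Tp.read, reset, schedTape]
  · rw [sched] at ht
    rcases le_or_gt t K with h | h
    · rw [run_schedTM_idle K w h, halted_schedCfg (by omega)]; omega
    rcases eq_or_ne t (K + 1) with rfl | h'
    · rw [TM.run, run_schedTM_idle K w le_rfl, next_schedCfg (by omega), schedStep,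
        if_neg (by omega), if_pos rfl, halted_schedCfg (by omega)]; omega
    · obtain ⟨x, rfl⟩ : ∃ x, t = K + 2 + x := ⟨t - (K + 2), by omega⟩
      rw [run_schedTM_odo K w (by omega), halted_schedCfg (by omega)]; omega

theorem isExponential_sched (K : ℕ) : IsExponential (sched K) := by
  refine ⟨5, 5, by norm_num, by norm_num, ?_, ?_⟩
  · refine Asymptotics.IsBigO.of_bound 1 (.of_forall fun n => ?_)
    have h : 5 ^ n ≤ sched K n := by
      have := two_mul_odo n
      rw [pow_succ] at this
      rw [sched]
      omega
    rw [Real.norm_of_nonneg (by positivity), Real.norm_of_nonneg (by positivity), one_mul]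
    exact_mod_cast h
  · refine Asymptotics.IsBigO.of_bound (K + 6) (.of_forall fun n => ?_)
    have h : sched K n ≤ (K + 6) * 5 ^ n := by
      have := two_mul_odo n
      have h1 : 1 ≤ 5 ^ n := Nat.one_le_pow _ _ (by norm_num)
      rw [pow_succ] at this
      rw [sched]
      nlinarith
    rw [Real.norm_of_nonneg (by positivity), Real.norm_of_nonneg (by positivity)]
    exact_mod_cast h

end Odometer

/-! ### Programs run by collider machines -/

section Compile

variable {K S Q : Type}

/-- Regard a symbol as one of a larger alphabet. -/
def Sym.up : Sym S → Sym (S ⊕ Q)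
  | .blank => .blank
  | .bit b => .bit b
  | .extra x => .extra (.inl x)

/-- The inverse of `Sym.up`; symbols outside its range are sent to the blank. -/
def Sym.down : Sym (S ⊕ Q) → Sym S
  | .blank => .blank
  | .bit b => .bit b
  | .extra (.inl x) => .extra x
  | .extra (.inr _) => .blank

@[simp] lemma Sym.down_up (x : Sym S) : (x.up : Sym (S ⊕ Q)).down = x := by
  cases x <;> rfl

lemma up_tapeOfWord (w : List Bool) (i : ℤ) :
    ((tapeOfWord w i : Sym S).up : Sym (S ⊕ Q)) = tapeOfWord w i := by
  unfold tapeOfWord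
  split_ifs
  · cases w[i.toNat]? <;> rfl
  · rfl

lemma wordOfTape_eq {t : ℤ → Sym S} {w : List Bool}
    (h1 : ∀ i (hi : i < w.length), t (i : ℤ) = .bit w[i])
    (h2 : (t (w.length : ℤ)).toBit = none) : wordOfTape t = w := by
  classical
  have h : ∃ n : ℕ, (t (n : ℤ)).toBit = none := ⟨_, h2⟩
  have hf : Nat.find h = w.length := by
    rw [Nat.find_eq_iff]
    refine ⟨h2, fun i hi => ?_⟩
    simp [h1 i hi, Sym.toBit]
  rw [wordOfTape, dif_pos h, hf]
  have : ∀ i ∈ List.range w.length, (t (i : ℤ)).toBit = w[i]? := by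
    intro i hi
    rw [List.mem_range] at hi
    simp [h1 i hi, Sym.toBit, hi]
  rw [List.filterMap_congr this]
  apply List.ext_getElem?
  clear h hf this h1 h2
  induction w using List.reverseRecOn with
  | nil => simp
  | append_singleton l a ih =>
    intro i
    have : List.filterMap (fun i => (l ++ [a])[i]?) (List.range l.length) =
        List.filterMap (fun i => l[i]?) (List.range l.length) := by
      apply List.filterMap_congr
      intro i hi
      rw [List.mem_range] at hi
      simp [List.getElem?_append_left hi]
    rw [List.length_append, List.length_singleton, List.range_succ, List.filterMap_append, this,
      List.ext_getElem? ih]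
    simp

/-- States of the machine that runs a program: before and during an experiment, after an experiment
with the result `o`, after the end of the program, and halted with a verdict. -/
inductive MState where
  | start
  | shoot
  | ans (o : Outcome)
  | done
  | fin (b : Bool)

instance : Finite MState := by
  refine Finite.of_surjective (fun o : Fin 3 ⊕ Outcome ⊕ Bool => match o with
    | .inl 0 => MState.start
    | .inl 1 => MState.shoot
    | .inl 2 => MState.done
    | .inr (.inl o) => MState.ans o
    | .inr (.inr b) => MState.fin b) ?_
  rintro (_ | _ | o | _ | b)
  · exact ⟨.inl 0, rfl⟩
  · exact ⟨.inl 1, rfl⟩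
  · exact ⟨.inr (.inl o), rfl⟩
  · exact ⟨.inl 2, rfl⟩
  · exact ⟨.inr (.inr b), rfl⟩

instance Sym.decidableEqBit (x : Sym S) (b : Bool) : Decidable (x = .bit b) :=
  decidable_of_iff (x.toBit = some b) (by cases x <;> simp [Sym.toBit])

/-- The machine that runs the program `P`. It makes an experiment for each coin, which shows `true`
if the result is "lesser", always with the query word `0`. The control state of the program is kept
on a control tape (named `inr false`) while the experiment is made; the query tape is `inr true`.
When the program has been left, the verdict is read off the tape `v`. -/
def toMachine [Finite K] [Finite S] (P : Prog K S) (kin kout v : K) : Machine where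
  State := MState
  Tape := K ⊕ Bool
  Extra := S ⊕ P.Q
  finite_state := inferInstance
  finite_tape := inferInstance
  finite_extra := by
    have := P.finite_state
    infer_instance
  start := .start
  input := .inl kin
  output := .inl kout
  halt := fun q => match q with
    | .fin b => some b
    | _ => none
  trans := fun q σ _ => match q with
    | .start => (.shoot, Sum.elim (fun k => ((σ (.inl k)).down.up, .stay))
        (fun b => (bif b then .bit false else .extra (.inr P.entry), .stay)))
    | .ans o => match σ (.inr false) with
      | .extra (.inr q) =>
        let r := P.trans q (fun k => (σ (.inl k)).down) (decide (o = .lesser))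
        (r.1.elim .done fun _ => .shoot, Sum.elim (fun k => ((r.2 k).1.up, (r.2 k).2))
          (fun b => (bif b then σ (.inr true) else
            r.1.elim (σ (.inr false)) fun q => .extra (.inr q), .stay)))
      | _ => (.done, fun k => (σ k, .stay))
    | .done => (.fin (decide ((σ (.inl v)).down = .bit true)),
        Sum.elim (fun k => ((σ (.inl k)).down.up, .stay))
          (fun b => (bif b then σ (.inr true) else σ (.inr false), .stay)))
    | q => (q, fun k => (σ k, .stay))
  query := .inr true
  shoot := .shoot
  answer := .ans

variable [Finite K] [Finite S] {P : Prog K S} {kin kout v : K}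

/-- The configuration of `toMachine P` with state `st` and store `s` that has the symbols `x`
and `y` in the cell `0` of the query tape and of the control tape. -/
def mcfg (P : Prog K S) (kin kout v : K) (st : MState) (x y : Sym (S ⊕ P.Q)) (s : Store K S) :
    (toMachine P kin kout v).toTM.Cfg where
  state := st
  cells := Sum.elim (fun k i => ((s k).cells i).up)
    (fun b => Function.update (fun _ => .blank) 0 (bif b then x else y))
  head := Sum.elim (fun k => (s k).head) (fun _ => 0)

/-- The store of a machine that starts on the input `w`. -/
def initStore [DecidableEq K] (kin : K) (w : List Bool) : Store K S := fun k =>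
  if k = kin then ⟨tapeOfWord w, 0⟩ else Tp.blank

lemma init_toMachine [DecidableEq K] (w : List Bool) :
    (toMachine P kin kout v).toTM.init w =
      mcfg P kin kout v .start .blank .blank (initStore kin w) := by
  unfold TM.init mcfg
  congr 1
  · funext k i
    rcases k with k | b
    · by_cases hk : k = kin
      · subst hk; simp [toMachine, initStore, up_tapeOfWord]
      · simp [toMachine, initStore, hk, Tp.blank, Sym.up]
    · simp [toMachine]
  · funext k
    rcases k with k | b
    · simp only [initStore, Sum.elim_inl]; split_ifs <;> rfl
    · rfl

lemma not_halted_mcfg {st : MState} {x y : Sym (S ⊕ P.Q)} {s : Store K S}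
    (h : ∀ b, st ≠ .fin b) : ¬ (toMachine P kin kout v).toTM.Halted
      (mcfg P kin kout v st x y s) := by
  cases st <;> simp [TM.Halted, toMachine, mcfg] at h ⊢

lemma TM.Cfg.ext_iff {C : Type} {M : TM C} {c d : M.Cfg} :
    c = d ↔ c.state = d.state ∧ c.cells = d.cells ∧ c.head = d.head := by
  cases c; cases d; simp

lemma TM.move_eq {C : Type} {M : TM C} {c : M.Cfg} {a : C}
    {r : M.State × (M.Tape → Sym M.Extra × Move)}
    (h : M.trans c.state (fun k => c.cells k (c.head k)) a = r) : M.move c a =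
      { state := r.1
        cells := fun k => Function.update (c.cells k) (c.head k) (r.2 k).1
        head := fun k => c.head k + (r.2 k).2.shift } := by
  subst h; rfl

lemma move_mcfg {st st' : MState} {x y x' y' : Sym (S ⊕ P.Q)} {s : Store K S}
    {A : K → Sym S × Move}
    (h : (toMachine P kin kout v).trans st
      (Sum.elim (fun k => (s.scan k).up) (fun b => bif b then x else y)) () =
        (st', Sum.elim (fun k => ((A k).1.up, (A k).2))
          (fun b => (bif b then x' else y', .stay)))) :
    (toMachine P kin kout v).toTM.move (mcfg P kin kout v st x y s) () =
      mcfg P kin kout v st' x' y' (s.act A) := by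
  have hσ : (fun k => (mcfg P kin kout v st x y s).cells k
      ((mcfg P kin kout v st x y s).head k)) =
      Sum.elim (fun k => (s.scan k).up) (fun b => bif b then x else y) := by
    funext k
    rcases k with k | b
    · rfl
    · change Function.update (fun _ : ℤ => (Sym.blank : Sym (S ⊕ P.Q))) 0 (bif b then x else y) 0 =
        bif b then x else y
      exact Function.update_self ..
  rw [TM.move_eq ((congrArg (fun σ => (toMachine P kin kout v).trans st σ ()) hσ).trans h)]
  refine TM.Cfg.ext_iff.2 ⟨rfl, ?_, ?_⟩
  · funext k i
    rcases k with k | b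
    · change Function.update (fun i => ((s k).cells i).up) (s k).head (A k).1.up i =
        (Function.update (s k).cells (s k).head (A k).1 i).up
      simp only [Function.update_apply]
      split_ifs <;> rfl
    · change Function.update (Function.update (fun _ : ℤ => (Sym.blank : Sym (S ⊕ P.Q))) 0
        (bif b then x else y)) 0 (bif b then x' else y') i =
        Function.update (fun _ : ℤ => (Sym.blank : Sym (S ⊕ P.Q))) 0 (bif b then x' else y') i
      rw [Function.update_idem]
  · funext k
    rcases k with k | b
    · rfl
    · rfl

lemma next_start (s : Store K S) :
    (toMachine P kin kout v).toTM.next (mcfg P kin kout v .start .blank .blank s) () =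
      mcfg P kin kout v .shoot (.bit false) (.extra (.inr P.entry)) s := by
  rw [TM.next, if_neg (not_halted_mcfg (by simp))]
  refine (move_mcfg (A := fun k => (s.scan k, .stay)) ?_).trans (by rw [Store.act_stay])
  simp [toMachine]

lemma next_done (s : Store K S) (x y : Sym (S ⊕ P.Q)) :
    (toMachine P kin kout v).toTM.next (mcfg P kin kout v .done x y s) () =
      mcfg P kin kout v (.fin (decide (s.scan v = .bit true))) x y s := by
  rw [TM.next, if_neg (not_halted_mcfg (by simp))]
  refine (move_mcfg (A := fun k => (s.scan k, .stay)) ?_).trans (by rw [Store.act_stay])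
  simp [toMachine]

/-- The configuration of the machine when the program is in control state `o`. -/
def embed (P : Prog K S) (kin kout v : K) (o : Option P.Q) (y : Sym (S ⊕ P.Q)) (s : Store K S) :
    (toMachine P kin kout v).toTM.Cfg :=
  mcfg P kin kout v (o.elim .done fun _ => .shoot) (.bit false)
    (o.elim y fun q => .extra (.inr q)) s

lemma next_ans (s : Store K S) (o : Outcome) (q : P.Q) :
    (toMachine P kin kout v).toTM.next
        (mcfg P kin kout v (.ans o) (.bit false) (.extra (.inr q)) s) () =
      embed P kin kout v (P.trans q s.scan (decide (o = .lesser))).1 (.extra (.inr q))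
        (s.act (P.trans q s.scan (decide (o = .lesser))).2) := by
  rw [TM.next, if_neg (not_halted_mcfg (by simp))]
  apply move_mcfg
  simp [toMachine]

lemma shooting_mcfg {x y : Sym (S ⊕ P.Q)} {s : Store K S} :
    (toMachine P kin kout v).Shooting (mcfg P kin kout v .shoot x y s) :=
  ⟨not_halted_mcfg (by simp), rfl⟩

lemma not_shooting_mcfg {st : MState} {x y : Sym (S ⊕ P.Q)} {s : Store K S} (h : st ≠ .shoot) :
    ¬ (toMachine P kin kout v).Shooting (mcfg P kin kout v st x y s) := fun h' => h h'.2

lemma queryWord_shoot {y : Sym (S ⊕ P.Q)} {s : Store K S} :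
    (toMachine P kin kout v).queryWord (mcfg P kin kout v .shoot (.bit false) y s) = [false] := by
  apply wordOfTape_eq
  · intro i hi
    obtain rfl : i = 0 := by simpa using hi
    rfl
  · rfl

end Compile

/-! ### Running time and error probability of compiled programs -/

lemma evolve_succ {α : Type} (κ : α → PMF α) (x : α) (n : ℕ) :
    evolve κ x (n + 1) = (κ x).bind fun y => evolve κ y n := by
  induction n with
  | zero => simp [evolve]
  | succ n ih =>
    rw [evolve, ih, PMF.bind_bind]
    rfl

namespace Machine

variable (M : Machine)

/-- The computation that starts in a given configuration. -/
noncomputable def runFrom (c : M.toTM.Cfg) (o : ℕ → Outcome) : ℕ → M.toTM.Cfg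
  | 0 => c
  | n + 1 => M.next (runFrom c o n) (o n)

lemma runFrom_init (w : List Bool) (o : ℕ → Outcome) (n : ℕ) :
    M.runFrom (M.toTM.init w) o n = M.run w o n := by
  induction n with
  | zero => rfl
  | succ n ih => rw [runFrom, ih, run]

lemma runFrom_succ (c : M.toTM.Cfg) (o : ℕ → Outcome) (n : ℕ) :
    M.runFrom c o (n + 1) = M.runFrom (M.next c (o 0)) (fun i => o (i + 1)) n := by
  induction n with
  | zero => rfl
  | succ n ih => rw [runFrom, ih, runFrom]

/-- Every computation from `c` halts within `B` time steps. -/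
def HaltsFrom (T : ℕ → ℕ) (c : M.toTM.Cfg) (B : ℕ) : Prop :=
  ∀ o : ℕ → Outcome, ∃ n : ℕ, M.toTM.Halted (M.runFrom c o n) ∧
    ∑ i ∈ Finset.range n, M.cost T (M.runFrom c o i) ≤ B

variable {M} {T : ℕ → ℕ} {c : M.toTM.Cfg} {B : ℕ}

lemma HaltsFrom.of_halted (h : M.toTM.Halted c) : M.HaltsFrom T c B :=
  fun _ => ⟨0, h, by simp⟩

lemma HaltsFrom.step (h : ∀ o, M.HaltsFrom T (M.next c o) B) :
    M.HaltsFrom T c (M.cost T c + B) := fun o => by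
  obtain ⟨n, h1, h2⟩ := h (o 0) fun i => o (i + 1)
  refine ⟨n + 1, by rwa [runFrom_succ], ?_⟩
  rw [Finset.sum_range_succ', add_comm]
  simp only [runFrom_succ]
  exact Nat.add_le_add_left h2 _

lemma HaltsFrom.mono {B' : ℕ} (h : M.HaltsFrom T c B) (hB : B ≤ B') : M.HaltsFrom T c B' :=
  fun o => by
    obtain ⟨n, h1, h2⟩ := h o
    exact ⟨n, h1, h2.trans hB⟩

/-- The probability that `M`, started in `c`, has halted correctly after `n` transitions. -/
noncomputable def good (M : Machine) (E : Apparatus) (T : ℕ → ℕ) (R : M.toTM.Cfg → Prop)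
    (c : M.toTM.Cfg) (n : ℕ) : ℝ≥0∞ :=
  (evolve (M.nextLaw E T) c n).toOuterMeasure {c | M.toTM.Halted c ∧ R c}

variable {E : Apparatus} {R : M.toTM.Cfg → Prop}

lemma nextLaw_of_halted (h : M.toTM.Halted c) : M.nextLaw E T c = PMF.pure c := by
  rw [nextLaw, if_neg fun h' => h'.1 h, TM.next, if_pos h]

lemma good_of_halted (h : M.toTM.Halted c) (hR : R c) (n : ℕ) : M.good E T R c n = 1 := by
  have : evolve (M.nextLaw E T) c n = PMF.pure c := by
    induction n with
    | zero => rfl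
    | succ n ih => rw [evolve, ih, PMF.pure_bind, nextLaw_of_halted h]
  rw [good, this, PMF.toOuterMeasure_pure_apply, if_pos ⟨h, hR⟩]

lemma good_of_not_shooting (h : ¬ M.Shooting c) (n : ℕ) :
    M.good E T R c (n + 1) = M.good E T R (M.toTM.next c ()) n := by
  rw [good, evolve_succ, nextLaw, if_neg h, PMF.pure_bind, good]

lemma good_of_shooting (h : M.Shooting c) (n : ℕ) :
    M.good E T R c (n + 1) = ∑ o, E.outcomeLaw (T (M.queryWord c).length) (M.queryWord c) o *
      M.good E T R (M.resume c o) n := by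
  rw [good, evolve_succ, nextLaw, if_pos h, PMF.bind_map, PMF.toOuterMeasure_bind_apply,
    tsum_fintype]
  rfl

lemma next_of_shooting (h : M.Shooting c) (o : Outcome) : M.next c o = M.resume c o := by
  rw [next, if_pos h]

lemma next_of_not_shooting (h : ¬ M.Shooting c) (o : Outcome) : M.next c o = M.toTM.next c () := by
  rw [next, if_neg h]

end Machine

open Machine

section

variable {K S : Type} [Finite K] [Finite S] {P : Prog K S} {kin kout v : K}
  {E : Apparatus} {T : ℕ → ℕ} {p : ℝ} {Φ : Store K S → ℝ → Prop}

lemma embed_none (y : Sym (S ⊕ P.Q)) (s : Store K S) : embed P kin kout v none y s =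
    mcfg P kin kout v .done (.bit false) y s := rfl

lemma embed_some (q : P.Q) (y : Sym (S ⊕ P.Q)) (s : Store K S) :
    embed P kin kout v (some q) y s =
      mcfg P kin kout v .shoot (.bit false) (.extra (.inr q)) s := rfl

lemma halted_fin {b : Bool} {x y : Sym (S ⊕ P.Q)} {s : Store K S} :
    (toMachine P kin kout v).toTM.Halted (mcfg P kin kout v (.fin b) x y s) := rfl

lemma haltsFrom_embed {o : Option P.Q} {s : Store K S} {t : ℕ} {δ : ℝ} (h : Ev P p Φ o s t δ) :
    ∀ y, (toMachine P kin kout v).HaltsFrom T (embed P kin kout v o y s)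
      ((T 1 + 2) * t + 1) := by
  classical
  induction h with
  | @done s t δ _ =>
    intro y
    rw [embed_none]
    refine (HaltsFrom.step (B := 0) fun o => ?_).mono ?_
    · rw [next_of_not_shooting (not_shooting_mcfg (by simp))]
      rw [next_done]
      exact HaltsFrom.of_halted halted_fin
    · rw [cost, if_neg (not_shooting_mcfg (by simp))]
      omega
  | @step q s t δ d _ _ ih =>
    intro y
    rw [embed_some]
    have hc : cost _ T (mcfg P kin kout v .shoot (.bit false) (.extra (.inr q)) s) = T 1 + 1 := by
      rw [cost, if_pos shooting_mcfg, queryWord_shoot]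
      rfl
    refine (HaltsFrom.step (B := (T 1 + 2) * t + 1 + 1) fun o => ?_).mono
      (by rw [hc]; ring_nf; omega)
    rw [next_of_shooting shooting_mcfg]
    change (toMachine P kin kout v).HaltsFrom T
      (mcfg P kin kout v (.ans o) (.bit false) (.extra (.inr q)) s) _
    refine (HaltsFrom.step (B := (T 1 + 2) * t + 1) fun o' => ?_).mono
      (by rw [cost, if_neg (not_shooting_mcfg (by simp))]; omega)
    rw [next_of_not_shooting (not_shooting_mcfg (by simp)), next_ans]
    exact ih _ _

/-- A bound for the probability of error of a program is one for the machine that runs it. -/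
lemma one_le_good {R : (toMachine P kin kout v).toTM.Cfg → Prop} {G : Store K S → Prop}
    (hE : E.outcomeLaw (T 1) [false] .lesser = ENNReal.ofReal p) (hp0 : 0 ≤ p) (hp1 : p ≤ 1)
    (hR : ∀ s x y, G s → R (mcfg P kin kout v (.fin (decide (s.scan v = .bit true))) x y s))
    {o : Option P.Q} {s : Store K S} {t : ℕ} {δ : ℝ}
    (h : Ev P p (fun s d => (G s ∧ 0 ≤ d) ∨ 1 ≤ d) o s t δ) :
    0 ≤ δ ∧ ∀ y, 1 ≤ (toMachine P kin kout v).good E T R (embed P kin kout v o y s) (2 * t + 1) +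
      ENNReal.ofReal δ := by
  induction h with
  | @done s t δ h =>
    obtain ⟨hG, h0⟩ | h1 := h
    · refine ⟨h0, fun y => ?_⟩
      rw [embed_none, good_of_not_shooting (not_shooting_mcfg (by simp)), next_done,
        good_of_halted halted_fin (hR _ _ _ hG)]
      exact le_self_add
    · refine ⟨by linarith, fun y => ?_⟩
      exact (by simpa using h1 : 1 ≤ ENNReal.ofReal δ).trans le_add_self
  | @step q s t δ d _ hd ih =>
    have h0 := fun c => (ih c).1
    have hδ : 0 ≤ p * d true + (1 - p) * d false :=
      add_nonneg (mul_nonneg hp0 (h0 _)) (mul_nonneg (by linarith) (h0 _))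
    refine ⟨hδ.trans hd, fun y => ?_⟩
    rw [embed_some]
    have key : ∀ o : Outcome, 1 ≤ (toMachine P kin kout v).good E T R
        ((toMachine P kin kout v).resume
          (mcfg P kin kout v .shoot (.bit false) (.extra (.inr q)) s) o) (2 * t + 2) +
        ENNReal.ofReal (d (decide (o = .lesser))) := by
      intro o
      change 1 ≤ good _ E T R (mcfg P kin kout v (.ans o) (.bit false) (.extra (.inr q)) s)
        (2 * t + 1 + 1) + _
      rw [good_of_not_shooting (not_shooting_mcfg (by simp)), next_ans]
      exact (ih _).2 _
    rw [show 2 * (t + 1) + 1 = 2 * t + 2 + 1 by ring, good_of_shooting shooting_mcfg,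
      queryWord_shoot, List.length_singleton]
    set L := E.outcomeLaw (T 1) [false] with hL
    have hsum : ∑ o, L o = 1 := by
      rw [← L.tsum_coe, tsum_fintype]
    have hu : (Finset.univ : Finset Outcome) = {.lesser, .greater, .timeOut} := rfl
    have h3 : L .greater + L .timeOut = ENNReal.ofReal (1 - p) := by
      rw [hu, Finset.sum_insert (by decide), Finset.sum_pair (by decide), hE] at hsum
      rw [ENNReal.ofReal_sub _ hp0, ENNReal.ofReal_one, ← hsum]
      exact (ENNReal.add_sub_cancel_left ENNReal.ofReal_ne_top).symm
    have hd' : ∑ o, L o * ENNReal.ofReal (d (decide (o = .lesser))) ≤ ENNReal.ofReal δ := by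
      rw [hu, Finset.sum_insert (by decide), Finset.sum_pair (by decide), hE]
      simp only [decide_true, reduceCtorEq, decide_false]
      rw [← add_mul, h3, ← ENNReal.ofReal_mul hp0, ← ENNReal.ofReal_mul (by linarith),
        ← ENNReal.ofReal_add (mul_nonneg hp0 (h0 _)) (mul_nonneg (by linarith) (h0 _))]
      exact ENNReal.ofReal_le_ofReal hd
    refine le_trans ?_ (add_le_add_right hd' _)
    rw [← Finset.sum_add_distrib, ← hsum]
    refine Finset.sum_le_sum fun o _ => ?_
    rw [← mul_add]
    exact le_mul_of_one_le_right' (key o)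

/-- Time and error bounds for a program carry over to the machine that runs it. -/
theorem toMachine_spec [DecidableEq K] {R : (toMachine P kin kout v).toTM.Cfg → Prop}
    {G : Store K S → Prop}
    (hE : E.outcomeLaw (T 1) [false] .lesser = ENNReal.ofReal p) (hp0 : 0 ≤ p) (hp1 : p ≤ 1)
    (hR : ∀ s x y, G s → R (mcfg P kin kout v (.fin (decide (s.scan v = .bit true))) x y s))
    {w : List Bool} {t : ℕ} {δ : ℝ}
    (h : Tr P p (fun s d => (G s ∧ 0 ≤ d) ∨ 1 ≤ d) (initStore kin w) t δ) :
    (toMachine P kin kout v).HaltsWithin T w ((T 1 + 2) * t + 2) ∧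
      (toMachine P kin kout v).errorProb E T w R ≤ ENNReal.ofReal δ := by
  constructor
  · have h1 : (toMachine P kin kout v).HaltsFrom T ((toMachine P kin kout v).toTM.init w)
        ((T 1 + 2) * t + 2) := by
      rw [init_toMachine]
      refine (HaltsFrom.step (B := (T 1 + 2) * t + 1) fun o => ?_).mono
        (by rw [cost, if_neg (not_shooting_mcfg (by simp))]; omega)
      rw [next_of_not_shooting (not_shooting_mcfg (by simp)), next_start]
      exact haltsFrom_embed h .blank
    intro o
    simpa only [runFrom_init] using h1 o
  · have h1 := (one_le_good hE hp0 hp1 hR h).2 .blank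
    rw [errorProb, tsub_le_iff_left]
    refine h1.trans (add_le_add_left ?_ _)
    refine le_trans (le_of_eq ?_) (le_iSup _ (2 * t + 1 + 1))
    change _ = good _ E T R _ _
    rw [init_toMachine, good_of_not_shooting (not_shooting_mcfg (by simp)), next_start]
    rfl

end

/-! ### The bias of the coin -/

lemma dyadic_zero : dyadic [false] = 0 := by
  simp [dyadic]

/-- The probability of the result "lesser" when the mass `0` is requested. Half of the time the
test mass is not positive, and then no particle is seen. -/
lemma outcomeLaw_lesser (E : Apparatus) {τ : ℕ} (hτ : 1 < E.speed * τ)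
    (hr : E.mass * ((E.speed * τ - 1) / (E.speed * τ + 1)) ≤ E.precision) :
    E.outcomeLaw τ [false] .lesser = ENNReal.ofReal
      (E.mass * ((E.speed * τ - 1) / (E.speed * τ + 1)) / (2 * E.precision)) := by
  have hq : IsQuery [false] := .inr ⟨[], rfl⟩
  have hε := E.precision_pos
  have hμ := E.mass_pos
  have hu := E.speed_pos
  have hτ0 : (0 : ℝ) < τ := by
    by_contra h
    have : (τ : ℝ) = 0 := le_antisymm (not_lt.1 h) (Nat.cast_nonneg _)
    rw [this] at hτ; linarith
  -- A lighter test particle moves back, and the lighter it is, the faster; `lo` is the largest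
  -- mass with which it reaches the flag in time.
  set lo := E.mass * ((E.speed * τ - 1) / (E.speed * τ + 1)) with hlo
  have hlo0 : 0 < lo := by
    apply mul_pos hμ; apply div_pos <;> linarith
  have hset : shot E.mass E.speed τ ⁻¹' {.lesser} = Set.Ioc 0 lo := by
    ext m
    rw [Set.mem_preimage, Set.mem_singleton_iff, Set.mem_Ioc]
    have : shot E.mass E.speed τ m = .lesser ↔
        0 < m ∧ velTest m E.mass E.speed < 0 ∧ 1 / |velTest m E.mass E.speed| ≤ τ := by
      unfold shot; split_ifs with h1 h2 <;> tauto
    rw [this]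
    refine and_congr_right fun hm => ?_
    have hs : 0 < m + E.mass := by linarith
    have hv : velTest m E.mass E.speed * (m + E.mass) = (m - E.mass) * E.speed := by
      unfold velTest; field_simp
    have hlo' : lo * (E.speed * τ + 1) = E.mass * (E.speed * τ - 1) := by
      rw [hlo]; field_simp
    set V := velTest m E.mass E.speed with hV
    constructor
    · rintro ⟨h1, h2⟩
      rw [abs_of_neg h1, div_le_iff₀ (by linarith)] at h2
      by_contra h3
      push Not at h3
      have h4 : lo * (E.speed * τ + 1) < m * (E.speed * τ + 1) :=
        mul_lt_mul_of_pos_right h3 (by linarith)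
      have h5 : 1 * (m + E.mass) ≤ τ * -V * (m + E.mass) := mul_le_mul_of_nonneg_right h2 hs.le
      have h6 : τ * -V * (m + E.mass) = - τ * ((m - E.mass) * E.speed) := by rw [← hv]; ring
      nlinarith
    · intro h
      have h4 : m * (E.speed * τ + 1) ≤ lo * (E.speed * τ + 1) :=
        mul_le_mul_of_nonneg_right h (by linarith)
      have h5 : 1 * (m + E.mass) ≤ τ * -V * (m + E.mass) := by
        have h6 : τ * -V * (m + E.mass) = - τ * ((m - E.mass) * E.speed) := by rw [← hv]; ring
        nlinarith
      have h7 : 1 ≤ τ * -V := le_of_mul_le_mul_right h5 hs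
      have h8 : V < 0 := by
        by_contra h8
        push Not at h8
        nlinarith
      exact ⟨h8, by rw [abs_of_neg h8, div_le_iff₀ (by linarith)]; exact h7⟩
  rw [Apparatus.outcomeLaw, if_pos hq]
  simp only [Measure.toPMF_apply]
  rw [Measure.map_apply (measurable_shot _ _ _) (measurableSet_singleton _), hset, dyadic_zero,
    cond_apply measurableSet_Icc]
  have hI : Set.Icc (0 - E.precision) (0 + E.precision) ∩ Set.Ioc 0 lo = Set.Ioc 0 lo := by
    apply Set.inter_eq_right.2
    intro m hm
    exact ⟨by linarith [hm.1], by linarith [hm.2]⟩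
  rw [hI, Real.volume_Icc, Real.volume_Ioc, sub_zero, ENNReal.ofReal_div_of_pos (by linarith),
    ENNReal.div_eq_inv_mul]
  congr 3
  ring

/-- The unknown mass can be chosen so that the result "lesser" has any given small probability. -/
lemma exists_apparatus {ε u : ℝ} (hε : 0 < ε) (hu : 0 < u) {τ : ℕ} (hτ : 1 < u * τ) :
    ∃ η > 0, ∀ q, 0 < q → q ≤ η → ∃ E : Apparatus, E.precision = ε ∧ E.speed = u ∧
      E.outcomeLaw τ [false] .lesser = ENNReal.ofReal q := by
  set r := (u * τ - 1) / (u * τ + 1) with hr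
  have hr0 : 0 < r := div_pos (by linarith) (by linarith)
  refine ⟨min (1 / 2) (r / (4 * ε)), by positivity, fun q hq0 hq => ?_⟩
  have h1 : q ≤ 1 / 2 := hq.trans (min_le_left _ _)
  have h2 : q ≤ r / (4 * ε) := hq.trans (min_le_right _ _)
  rw [le_div_iff₀ (by linarith)] at h2
  have hm : 2 * ε * q / r * r = 2 * ε * q := by field_simp
  refine ⟨⟨ε, 2 * ε * q / r, u, hε, by positivity, ?_, hu⟩, rfl, rfl, ?_⟩
  · rw [div_lt_one hr0]; linarith
  · rw [outcomeLaw_lesser _ hτ]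
    · simp only [← hr, hm]
      congr 1
      field_simp
    · simp only [← hr, hm]
      nlinarith

section Programs

/-! ### Registers -/

/-- Names of the tapes that the programs use besides those of a simulated machine: the input, five
counters, two odometers, the word to be written, and a tape for the verdict. -/
inductive Ax where
  | inp | n₁ | n₂ | a | b | j | clk | cnt | out | bus
  deriving DecidableEq

instance : Fintype Ax :=
  ⟨{.inp, .n₁, .n₂, .a, .b, .j, .clk, .cnt, .out, .bus}, by rintro (_ | _) <;> simp⟩

/-- A counter: the head position of a tape whose cell `0` carries the end marker. -/
def ctr {S : Type} (n : ℕ) : Tp (S ⊕ Aux) := ⟨Function.update (fun _ => .blank) 0 lend, n⟩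

/-- The contents of the tapes, where the counters are given by their values. -/
structure Regs (X Y : Type) where
  /-- the tapes of a simulated machine -/
  x : X → Tp (Y ⊕ Aux)
  /-- the input tape -/
  inp : Tp (Y ⊕ Aux)
  /-- counter -/
  n₁ : ℕ
  /-- counter -/
  n₂ : ℕ
  /-- counter -/
  a : ℕ
  /-- counter -/
  b : ℕ
  /-- counter -/
  j : ℕ
  /-- the odometer that measures time -/
  clk : Tp (Y ⊕ Aux)
  /-- the odometer that counts successes -/
  cnt : Tp (Y ⊕ Aux)
  /-- the tape for the word to be written -/
  out : Tp (Y ⊕ Aux)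
  /-- the tape for the verdict -/
  bus : Tp (Y ⊕ Aux)

variable {X Y : Type}

/-- The tapes described by `Regs`. -/
def Regs.toStore (r : Regs X Y) : Store (X ⊕ Ax) (Y ⊕ Aux)
  | .inl k => r.x k
  | .inr .inp => r.inp
  | .inr .n₁ => ctr r.n₁
  | .inr .n₂ => ctr r.n₂
  | .inr .a => ctr r.a
  | .inr .b => ctr r.b
  | .inr .j => ctr r.j
  | .inr .clk => r.clk
  | .inr .cnt => r.cnt
  | .inr .out => r.out
  | .inr .bus => r.bus

@[simp] lemma isLend_ctr (n : ℕ) : isLend (ctr n : Tp (Y ⊕ Aux)).read = decide (n = 0) := by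
  rcases n with _ | n
  · simp [ctr, Tp.read, isLend, lend]
  · have : ((n : ℤ) + 1) ≠ 0 := by omega
    simp [ctr, Tp.read, isLend, Function.update_of_ne this]

@[simp] lemma ctr_go_right (n : ℕ) : (ctr n : Tp (Y ⊕ Aux)).go .right = ctr (n + 1) := by
  simp [ctr, Tp.go, Move.shift]

@[simp] lemma ctr_go_left (n : ℕ) : (ctr (n + 1) : Tp (Y ⊕ Aux)).go .left = ctr n := by
  simp [ctr, Tp.go, Move.shift]

/-- A step that acts on the tapes in `Ax` only. -/
def Prog.upd (f : (Ax → Sym (Y ⊕ Aux)) → Bool → Ax → Sym (Y ⊕ Aux) × Move) :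
    Prog (X ⊕ Ax) (Y ⊕ Aux) :=
  Prog.atom fun σ c => Sum.elim (fun k => (σ (.inl k), .stay)) (f (fun k => σ (.inr k)) c)

/-- A step that moves the heads of some tapes. -/
def Prog.mv (m : Ax → Move) : Prog (X ⊕ Ax) (Y ⊕ Aux) := Prog.upd fun σ _ k => (σ k, m k)

/-- Loop until the end marker is scanned on the tape `k`. -/
def Prog.while (k : Ax) (P : Prog (X ⊕ Ax) (Y ⊕ Aux)) : Prog (X ⊕ Ax) (Y ⊕ Aux) :=
  Prog.loop (fun σ => !isLend (σ (.inr k))) P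

lemma upd_act {f : (Ax → Sym (Y ⊕ Aux)) → Bool → Ax → Sym (Y ⊕ Aux) × Move} {r r' : Regs X Y}
    {c : Bool} (hx : r'.x = r.x)
    (h : ∀ k, (r.toStore (.inr k)).act (f (fun k => (r.toStore (.inr k)).read) c k) =
      r'.toStore (.inr k)) :
    r.toStore.act (Sum.elim (fun k => (r.toStore.scan (.inl k), .stay))
      (f (fun k => r.toStore.scan (.inr k)) c)) = r'.toStore := by
  funext k
  rcases k with k | k
  · simp [Store.act, Store.scan, Regs.toStore, hx]
  · exact h k

lemma dtr_upd {f : (Ax → Sym (Y ⊕ Aux)) → Bool → Ax → Sym (Y ⊕ Aux) × Move} {r r' : Regs X Y}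
    (hx : r'.x = r.x)
    (h : ∀ c k, (r.toStore (.inr k)).act (f (fun k => (r.toStore (.inr k)).read) c k) =
      r'.toStore (.inr k)) : DTr (Prog.upd f) r.toStore 1 r'.toStore :=
  DTr.atom fun c => upd_act hx (h c)

lemma dtr_mv {m : Ax → Move} {r r' : Regs X Y} (hx : r'.x = r.x)
    (h : ∀ k, (r.toStore (.inr k)).go (m k) = r'.toStore (.inr k)) :
    DTr (Prog.mv m) r.toStore 1 r'.toStore :=
  dtr_upd hx fun c k => by rw [Tp.act_read, h]

/-- Moves of one head. -/
def one (k : Ax) (m : Move) : Ax → Move := fun i => if i = k then m else .stay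

/-- Moves of two heads. -/
def two (k : Ax) (m : Move) (k' : Ax) (m' : Move) : Ax → Move :=
  fun i => if i = k then m else if i = k' then m' else .stay

lemma dtr_skip {r : Regs X Y} : DTr (Prog.mv fun _ => .stay) r.toStore 1 r.toStore :=
  dtr_mv rfl fun k => by simp

/-- Repeat a program a fixed number of times. -/
def Prog.rep (P : Prog (X ⊕ Ax) (Y ⊕ Aux)) : ℕ → Prog (X ⊕ Ax) (Y ⊕ Aux)
  | 0 => Prog.mv fun _ => .stay
  | n + 1 => P.seq (P.rep n)

lemma dtr_rep {P : Prog (X ⊕ Ax) (Y ⊕ Aux)} {τ : ℕ} :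
    ∀ {n : ℕ} (ρ : ℕ → Regs X Y),
      (∀ i < n, DTr P (ρ i).toStore τ (ρ (i + 1)).toStore) →
      DTr (P.rep n) (ρ 0).toStore (n * τ + 1) (ρ n).toStore
  | 0, ρ, _ => by simpa [Prog.rep] using dtr_skip
  | n + 1, ρ, h => by
    have := dtr_rep (n := n) (fun i => ρ (i + 1)) fun i hi => h _ (by omega)
    exact ((h 0 (by omega)).seq this).mono_time (by ring_nf; omega)

lemma dtr_while {k : Ax} {P : Prog (X ⊕ Ax) (Y ⊕ Aux)} {τ n : ℕ} (ρ : ℕ → Regs X Y)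
    (h1 : ∀ i < n, isLend ((ρ i).toStore (.inr k)).read = false)
    (h2 : ∀ i < n, DTr P (ρ i).toStore τ (ρ (i + 1)).toStore)
    (h3 : isLend ((ρ n).toStore (.inr k)).read = true) :
    DTr (Prog.while k P) (ρ 0).toStore (n * (τ + 1) + 1) (ρ n).toStore :=
  DTr.loop_iterate (fun i => (ρ i).toStore) (fun i hi => by simp [Store.scan, h1 i hi]) h2
    (by simp [Store.scan, h3])

/-! ### Logarithms -/

/-- Add the counter `b` to the counter `a`. -/
def moveBA : Prog (X ⊕ Ax) (Y ⊕ Aux) := Prog.while .b (Prog.mv (two .b .left .a .right))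

lemma dtr_moveBA (r : Regs X Y) : DTr moveBA r.toStore (2 * r.b + 1)
    { r with a := r.a + r.b, b := 0 }.toStore := by
  have := dtr_while (k := .b) (P := Prog.mv (two .b .left .a .right)) (τ := 1) (n := r.b)
    (fun i => { r with a := r.a + i, b := r.b - i })
    (fun i hi => by simp [Regs.toStore]; omega)
    (fun i hi => dtr_mv rfl fun k => by
      obtain ⟨m, hm⟩ : ∃ m, r.b - i = m + 1 := ⟨r.b - i - 1, by omega⟩
      have hm' : r.b - (i + 1) = m := by omega
      cases k <;> simp [Regs.toStore, two, hm, hm', ← add_assoc])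
    (by simp [Regs.toStore])
  simpa [moveBA, mul_comm] using this

/-- Move half of the counter `a` to the counter `b`. -/
def halve : Prog (X ⊕ Ax) (Y ⊕ Aux) :=
  Prog.while .a ((Prog.mv (one .a .left)).seq
    (Prog.upd fun σ _ k => (σ k, if isLend (σ .a) then .stay else two .a .left .b .right k)))

lemma dtr_halve (n : ℕ) : ∀ r : Regs X Y, r.a = n → DTr halve r.toStore (3 * n + 1)
    { r with a := 0, b := r.b + n / 2 }.toStore := by
  induction n using Nat.strong_induction_on with
  | _ n ih =>
    intro r hr
    rcases n with _ | n
    · have h : DTr halve r.toStore 1 r.toStore :=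
        DTr.loop_exit (by simp [Store.scan, Regs.toStore, hr])
      convert! h using 2
      cases r
      simp_all
    have hb : (!isLend (r.toStore.scan (.inr .a))) = true := by
      simp [Store.scan, Regs.toStore, hr]
    have h1 : DTr (Prog.mv (one .a .left)) r.toStore 1 { r with a := n }.toStore :=
      dtr_mv rfl fun k => by cases k <;> simp [Regs.toStore, one, hr]
    rcases n with _ | n
    · have h2 : DTr (Prog.upd fun σ _ k =>
          (σ k, if isLend (σ .a) then .stay else two .a .left .b .right k))
          { r with a := 0 }.toStore 1 { r with a := 0 }.toStore :=
        dtr_upd rfl fun c k => by cases k <;> simp [Regs.toStore]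
      exact (DTr.loop_step hb (h1.seq h2) (ih 0 (by omega) { r with a := 0 } rfl)).mono_time
        (by omega)
    · have h2 : DTr (Prog.upd fun σ _ k =>
          (σ k, if isLend (σ .a) then .stay else two .a .left .b .right k))
          { r with a := n + 1 }.toStore 1 { r with a := n, b := r.b + 1 }.toStore :=
        dtr_upd rfl fun c k => by cases k <;> simp [Regs.toStore, two]
      have h3 := ih n (by omega) { r with a := n, b := r.b + 1 } rfl
      have := (DTr.loop_step hb (h1.seq h2) h3).mono_time (t' := 3 * (n + 1 + 1) + 1) (by omega)
      convert! this using 2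
      simp; omega

/-- Add the binary logarithm of `a + 1` to the counter `j`, and clear the counter `a`. -/
def logProg : Prog (X ⊕ Ax) (Y ⊕ Aux) :=
  Prog.while .a ((Prog.mv (two .a .left .j .right)).seq (halve.seq moveBA))

lemma dtr_logProg (n : ℕ) : ∀ r : Regs X Y, r.a = n → r.b = 0 →
    DTr logProg r.toStore (12 * n + 1)
      { r with a := 0, j := r.j + Nat.log 2 (n + 1) }.toStore := by
  induction n using Nat.strong_induction_on with
  | _ n ih =>
    intro r hr hr'
    rcases n with _ | n
    · have h : DTr logProg r.toStore 1 r.toStore :=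
        DTr.loop_exit (by simp [Store.scan, Regs.toStore, hr])
      convert! h using 2
      cases r
      simp_all
    have hb : (!isLend (r.toStore.scan (.inr .a))) = true := by
      simp [Store.scan, Regs.toStore, hr]
    have h1 : DTr (Prog.mv (two .a .left .j .right)) r.toStore 1
        { r with a := n, b := 0, j := r.j + 1 }.toStore :=
      dtr_mv rfl fun k => by cases k <;> simp [Regs.toStore, two, hr, hr']
    have h2 := dtr_halve n { r with a := n, j := r.j + 1 } rfl
    have h3 := dtr_moveBA { r with a := 0, j := r.j + 1, b := r.b + n / 2 }
    have h4 := ih (n / 2) (by omega) { r with a := n / 2, b := 0, j := r.j + 1 } rfl rfl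
    simp only [hr', zero_add] at h2 h3
    have h6 := DTr.loop_step hb (h1.seq (h2.seq h3)) h4
    have := h6.mono_time (t' := 12 * (n + 1) + 1) (by omega)
    convert! this using 2
    simp only [hr', Regs.mk.injEq, true_and, and_true]
    rw [Nat.log_of_one_lt_of_le (by norm_num) (by omega : 2 ≤ n + 1 + 1),
      show (n + 1 + 1) / 2 = n / 2 + 1 by omega]
    omega

/-! ### Preparation of the tapes -/

/-- An end marker in the cell `0`, followed by `s` cells with the mark `0`. -/
def mcells (s : ℕ) (i : ℤ) : Sym (Y ⊕ Aux) :=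
  if i = 0 then lend else if 0 < i ∧ i ≤ s then dig 0 else .blank

lemma mcells_zero (s : ℕ) : (mcells s 0 : Sym (Y ⊕ Aux)) = lend := rfl

lemma mcells_ne_lend (s : ℕ) {i : ℤ} (hi : 1 ≤ i) : (mcells s i : Sym (Y ⊕ Aux)) ≠ lend := by
  rw [mcells, if_neg (by omega)]
  split_ifs <;> simp [lend, dig]

lemma ready_mcells (s : ℕ) : Ready (mcells s : ℤ → Sym (Y ⊕ Aux)) 1 s := by
  refine ⟨fun i h1 h2 => .inl ?_, ?_⟩
  · rw [mcells, if_neg (by omega), if_pos (by omega)]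
  · rw [mcells, if_neg (by omega), if_neg (by omega)]

lemma reset_mcells (s : ℕ) : reset (mcells s : ℤ → Sym (Y ⊕ Aux)) 1 s = mcells s := by
  funext i
  simp only [reset, mcells]
  split_ifs <;> first | rfl | omega

lemma mcells_act (s : ℕ) : (⟨mcells s, s + 1⟩ : Tp (Y ⊕ Aux)).act (dig 0, .right) =
    ⟨mcells (s + 1), (s + 1 : ℕ) + 1⟩ := by
  ext
  · rename_i i
    simp only [Tp.act, Function.update_apply, mcells]
    push_cast
    split_ifs <;> first | rfl | omega
  · simp [Tp.act, Move.shift]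

/-- The contents of the tapes when the end markers have been put. -/
def startRegs (X : Type) {Y : Type} (w : List Bool) : Regs X Y where
  x := fun _ => Tp.blank
  inp := ⟨tapeOfWord w, 0⟩
  n₁ := 0
  n₂ := 0
  a := 0
  b := 0
  j := 0
  clk := ⟨mcells 0, 1⟩
  cnt := ⟨mcells 0, 1⟩
  out := Tp.blank
  bus := Tp.blank

/-- Put the end markers. -/
def initProg : Prog (X ⊕ Ax) (Y ⊕ Aux) := Prog.upd fun σ _ k => match k with
  | .inp | .out | .bus => (σ k, .stay)
  | .clk | .cnt => (lend, .right)
  | _ => (lend, .stay)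

lemma dtr_initProg [DecidableEq X] (w : List Bool) :
    DTr (initProg : Prog (X ⊕ Ax) (Y ⊕ Aux)) (initStore (.inr .inp) w) 1
      (startRegs X w).toStore := by
  refine DTr.atom fun c => ?_
  have h0 : (⟨Function.update (fun _ => .blank) 0 lend, 1⟩ : Tp (Y ⊕ Aux)) = ⟨mcells 0, 1⟩ := by
    ext
    · rename_i i
      simp only [Function.update_apply, mcells]
      split_ifs <;> first | rfl | omega
    · rfl
  funext k
  rcases k with k | k
  · simp [Store.act, Store.scan, Regs.toStore, startRegs, initStore]
  · cases k <;> simp [Store.act, Store.scan, Regs.toStore, startRegs, initStore, ctr] <;>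
      simp [Tp.act, Tp.blank, Move.shift, h0]

/-- Recognizes the blank. -/
def isBlank {S : Type} : Sym S → Bool
  | .blank => true
  | _ => false

/-- Count the symbols of the input. -/
def copyProg : Prog (X ⊕ Ax) (Y ⊕ Aux) :=
  Prog.loop (fun σ => !isBlank (σ (.inr .inp))) (Prog.mv (two .inp .right .n₁ .right))

lemma dtr_copyProg (r : Regs X Y) (w : List Bool) (hr : r.inp = ⟨tapeOfWord w, 0⟩) :
    DTr copyProg r.toStore (2 * w.length + 1)
      { r with inp := ⟨tapeOfWord w, w.length⟩, n₁ := r.n₁ + w.length }.toStore := by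
  have := DTr.loop_iterate (b := fun σ => !isBlank (σ (.inr .inp)))
    (P := Prog.mv (two .inp .right .n₁ .right)) (τ := 1) (n := w.length)
    (fun i => { r with inp := ⟨tapeOfWord w, i⟩, n₁ := r.n₁ + i : Regs X Y }.toStore)
    (fun i hi => by
      obtain ⟨b, hb⟩ := tapeOfWord_of_lt (S := Y ⊕ Aux) (w := w) (i := i) (by omega) (by omega)
      simp [Store.scan, Regs.toStore, Tp.read, hb, isBlank])
    (fun i hi => dtr_mv rfl fun k => by
      cases k <;> simp [Regs.toStore, two, ← add_assoc]
      simp [Tp.go, Move.shift])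
    (by simp [Store.scan, Regs.toStore, Tp.read, tapeOfWord_of_le, isBlank])
  simpa [copyProg, mul_comm, ← hr] using this

/-- The program `P` computes `g n` in the counter `a` from the value `n` of the counter `n₁`, which
it may change, within `t n` steps. -/
def Computes (P : Prog (X ⊕ Ax) (Y ⊕ Aux)) (g t : ℕ → ℕ) : Prop :=
  ∀ r : Regs X Y, r.n₂ = 0 → r.a = 0 → r.b = 0 → ∃ m,
    DTr P r.toStore (t r.n₁) { r with n₁ := m, a := g r.n₁ }.toStore

/-- Double `n - 1`. -/
def doubleProg : Prog (X ⊕ Ax) (Y ⊕ Aux) :=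
  (Prog.upd fun σ _ k => (σ k, if isLend (σ .n₁) then .stay else one .n₁ .left k)).seq
    (Prog.while .n₁ ((Prog.mv (two .n₁ .left .a .right)).seq (Prog.mv (one .a .right))))

lemma computes_doubleProg : Computes (doubleProg : Prog (X ⊕ Ax) (Y ⊕ Aux))
    (fun n => 2 * (n - 1)) (fun n => 3 * n + 2) := by
  intro r _ hr _
  refine ⟨0, ?_⟩
  have h1 : DTr (Prog.upd fun σ _ k => (σ k, if isLend (σ .n₁) then .stay else one .n₁ .left k))
      r.toStore 1 { r with n₁ := r.n₁ - 1 }.toStore := by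
    refine dtr_upd rfl fun c k => ?_
    rcases h : r.n₁ with _ | n <;> cases k <;> simp [Regs.toStore, one, h]
  have h2 := dtr_while (k := .n₁) (P := (Prog.mv (two .n₁ .left .a .right)).seq
    (Prog.mv (one .a .right))) (τ := 2) (n := r.n₁ - 1)
    (fun i => { r with n₁ := r.n₁ - 1 - i, a := 2 * i : Regs X Y })
    (fun i hi => by simp [Regs.toStore]; omega)
    (fun i hi => by
      obtain ⟨m, hm⟩ : ∃ m, r.n₁ - 1 - i = m + 1 := ⟨r.n₁ - 1 - i - 1, by omega⟩
      have hm' : r.n₁ - 1 - (i + 1) = m := by omega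
      have h3 : DTr (Prog.mv (two .n₁ .left .a .right))
          { r with n₁ := r.n₁ - 1 - i, a := 2 * i : Regs X Y }.toStore 1
          { r with n₁ := m, a := 2 * i + 1 : Regs X Y }.toStore :=
        dtr_mv rfl fun k => by cases k <;> simp [Regs.toStore, two, hm]
      have h4 : DTr (Prog.mv (one .a .right))
          { r with n₁ := m, a := 2 * i + 1 : Regs X Y }.toStore 1
          { r with n₁ := r.n₁ - 1 - (i + 1), a := 2 * (i + 1) : Regs X Y }.toStore :=
        dtr_mv rfl fun k => by cases k <;> simp [Regs.toStore, one, hm', mul_add]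
      exact h3.seq h4)
    (by simp [Regs.toStore])
  have h3 : { r with n₁ := r.n₁ - 1 - 0, a := 2 * 0 : Regs X Y } = { r with n₁ := r.n₁ - 1 } := by
    simp [hr]
  simp only [h3] at h2
  simpa [doubleProg] using (h1.seq h2).mono_time (t' := 3 * r.n₁ + 2) (by omega)

/-- Multiply the counter `a` by the counter `n₁`, using the counters `n₂` and `b`. -/
def mulProg : Prog (X ⊕ Ax) (Y ⊕ Aux) :=
  (Prog.while .a ((Prog.mv (one .a .left)).seq
    ((Prog.while .n₁ ((Prog.mv (two .n₁ .left .n₂ .right)).seq (Prog.mv (one .b .right)))).seq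
      (Prog.while .n₂ (Prog.mv (two .n₂ .left .n₁ .right)))))).seq moveBA

lemma dtr_mulProg (r : Regs X Y) (h2 : r.n₂ = 0) (hb : r.b = 0) : DTr mulProg r.toStore
    (r.a * (7 * r.n₁ + 6) + 2) { r with a := r.a * r.n₁ }.toStore := by
  have hA (q : Regs X Y) (hq : q.n₂ = 0) : DTr (Prog.while .n₁
      ((Prog.mv (two .n₁ .left .n₂ .right)).seq (Prog.mv (one .b .right)))) q.toStore
      (q.n₁ * 3 + 1) { q with n₁ := 0, n₂ := q.n₁, b := q.b + q.n₁ }.toStore := by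
    have := dtr_while (k := .n₁) (P := (Prog.mv (two .n₁ .left .n₂ .right)).seq
      (Prog.mv (one .b .right))) (τ := 2) (n := q.n₁)
      (fun i => { q with n₁ := q.n₁ - i, n₂ := i, b := q.b + i : Regs X Y })
      (fun i hi => by simp [Regs.toStore]; omega)
      (fun i hi => by
        obtain ⟨m, hm⟩ : ∃ m, q.n₁ - i = m + 1 := ⟨q.n₁ - i - 1, by omega⟩
        have hm' : q.n₁ - (i + 1) = m := by omega
        have h3 : DTr (Prog.mv (two .n₁ .left .n₂ .right))
            { q with n₁ := q.n₁ - i, n₂ := i, b := q.b + i : Regs X Y }.toStore 1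
            { q with n₁ := m, n₂ := i + 1, b := q.b + i : Regs X Y }.toStore :=
          dtr_mv rfl fun k => by cases k <;> simp [Regs.toStore, two, hm]
        have h4 : DTr (Prog.mv (one .b .right))
            { q with n₁ := m, n₂ := i + 1, b := q.b + i : Regs X Y }.toStore 1
            { q with n₁ := q.n₁ - (i + 1), n₂ := i + 1, b := q.b + (i + 1) : Regs X Y }.toStore :=
          dtr_mv rfl fun k => by cases k <;> simp [Regs.toStore, one, hm', ← add_assoc]
        exact h3.seq h4)
      (by simp [Regs.toStore])
    have h3 : { q with n₁ := q.n₁ - 0, n₂ := 0, b := q.b + 0 : Regs X Y } = q := by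
      cases q; simp_all
    simpa only [h3, Nat.sub_self] using this
  have hB (q : Regs X Y) (hq : q.n₁ = 0) : DTr (Prog.while .n₂
      (Prog.mv (two .n₂ .left .n₁ .right))) q.toStore
      (q.n₂ * 2 + 1) { q with n₁ := q.n₂, n₂ := 0 }.toStore := by
    have := dtr_while (k := .n₂) (P := Prog.mv (two .n₂ .left .n₁ .right)) (τ := 1) (n := q.n₂)
      (fun i => { q with n₁ := i, n₂ := q.n₂ - i : Regs X Y })
      (fun i hi => by simp [Regs.toStore]; omega)
      (fun i hi => dtr_mv rfl fun k => by
        obtain ⟨m, hm⟩ : ∃ m, q.n₂ - i = m + 1 := ⟨q.n₂ - i - 1, by omega⟩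
        have hm' : q.n₂ - (i + 1) = m := by omega
        cases k <;> simp [Regs.toStore, two, hm, hm'])
      (by simp [Regs.toStore])
    have h3 : { q with n₁ := 0, n₂ := q.n₂ - 0 : Regs X Y } = q := by cases q; simp_all
    simpa only [h3, Nat.sub_self] using this
  have hC := dtr_while (k := .a) (P := (Prog.mv (one .a .left)).seq
    ((Prog.while .n₁ ((Prog.mv (two .n₁ .left .n₂ .right)).seq (Prog.mv (one .b .right)))).seq
      (Prog.while .n₂ (Prog.mv (two .n₂ .left .n₁ .right))))) (τ := 5 * r.n₁ + 3) (n := r.a)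
    (fun i => { r with a := r.a - i, b := i * r.n₁ : Regs X Y })
    (fun i hi => by simp [Regs.toStore]; omega)
    (fun i hi => by
      obtain ⟨m, hm⟩ : ∃ m, r.a - i = m + 1 := ⟨r.a - i - 1, by omega⟩
      have hm' : r.a - (i + 1) = m := by omega
      have h3 : DTr (Prog.mv (one .a .left))
          { r with a := r.a - i, b := i * r.n₁ : Regs X Y }.toStore 1
          { r with a := m, b := i * r.n₁ : Regs X Y }.toStore :=
        dtr_mv rfl fun k => by cases k <;> simp [Regs.toStore, one, hm]
      have h5 := hA { r with a := m, b := i * r.n₁ : Regs X Y } h2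
      have h6 := hB { r with n₁ := 0, n₂ := r.n₁, a := m, b := i * r.n₁ + r.n₁ : Regs X Y } rfl
      have h4 := (h3.seq (h5.seq h6)).mono_time (t' := 5 * r.n₁ + 3) (by dsimp only; omega)
      convert! h4 using 2
      simp [hm', h2, add_mul])
    (by simp [Regs.toStore])
  have hD := dtr_moveBA { r with a := r.a - r.a, b := r.a * r.n₁ : Regs X Y }
  have h3 : { r with a := r.a - 0, b := 0 * r.n₁ : Regs X Y } = r := by cases r; simp_all
  simp only [h3] at hC
  have := (hC.seq hD).mono_time (t' := r.a * (7 * r.n₁ + 6) + 2) (by dsimp only; nlinarith)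
  simpa [mulProg, hb] using this

/-- Compute the power `n ^ e` and subtract one. -/
def powProg (e : ℕ) : Prog (X ⊕ Ax) (Y ⊕ Aux) :=
  (Prog.mv (one .a .right)).seq ((mulProg.rep e).seq
    (Prog.upd fun σ _ k => (σ k, if isLend (σ .a) then .stay else one .a .left k)))

lemma computes_powProg (e : ℕ) : Computes (powProg e : Prog (X ⊕ Ax) (Y ⊕ Aux))
    (fun n => n ^ e - 1) (fun n => e * ((n + 1) ^ e * (7 * n + 6) + 2) + 3) := by
  intro r h2 ha hb
  refine ⟨r.n₁, ?_⟩
  have h3 : DTr (Prog.mv (one .a .right)) r.toStore 1 { r with a := r.n₁ ^ 0 }.toStore :=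
    dtr_mv rfl fun k => by cases k <;> simp [Regs.toStore, one, ha]
  have h4 := dtr_rep (P := mulProg) (τ := (r.n₁ + 1) ^ e * (7 * r.n₁ + 6) + 2) (n := e)
    (fun i => { r with a := r.n₁ ^ i : Regs X Y }) (fun i hi => by
      refine (dtr_mulProg { r with a := r.n₁ ^ i : Regs X Y } h2 hb).mono_time ?_
      have : r.n₁ ^ i ≤ (r.n₁ + 1) ^ e :=
        (Nat.pow_le_pow_left (by omega) i).trans (Nat.pow_le_pow_right (by omega) hi.le)
      dsimp only
      gcongr)
  have h5 : DTr (Prog.upd fun σ _ k => (σ k, if isLend (σ .a) then .stay else one .a .left k))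
      { r with a := r.n₁ ^ e : Regs X Y }.toStore 1
      { r with a := r.n₁ ^ e - 1 : Regs X Y }.toStore := by
    refine dtr_upd rfl fun c k => ?_
    rcases h : r.n₁ ^ e with _ | n <;> cases k <;> simp [Regs.toStore, one]
  exact (h3.seq (h4.seq h5)).mono_time (by dsimp only; omega)

/-- Append a mark to the odometer `clk`, and also to `cnt` if `both`. -/
def markProg (both : Bool) : Prog (X ⊕ Ax) (Y ⊕ Aux) := Prog.upd fun σ _ k => match k with
  | .clk => (dig 0, .right)
  | .cnt => if both then (dig 0, .right) else (σ k, .stay)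
  | k => (σ k, .stay)

lemma dtr_marks_both (r : Regs X Y) (s₁ s₂ m : ℕ) (h₁ : r.clk = ⟨mcells s₁, s₁ + 1⟩)
    (h₂ : r.cnt = ⟨mcells s₂, s₂ + 1⟩) :
    DTr ((markProg true).rep m) r.toStore (m + 1)
      { r with clk := ⟨mcells (s₁ + m), (s₁ + m : ℕ) + 1⟩
               cnt := ⟨mcells (s₂ + m), (s₂ + m : ℕ) + 1⟩ }.toStore := by
  have := dtr_rep (P := markProg true) (τ := 1) (n := m) (fun i =>
    { r with clk := ⟨mcells (s₁ + i), (s₁ + i : ℕ) + 1⟩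
             cnt := ⟨mcells (s₂ + i), (s₂ + i : ℕ) + 1⟩ : Regs X Y })
    (fun i _ => dtr_upd rfl fun c k => by
      cases k <;> simp only [Regs.toStore, Tp.act_read, Tp.go_stay, if_true, mcells_act] <;> rfl)
  simpa [← h₁, ← h₂] using this

lemma dtr_marks_clk (r : Regs X Y) (s₁ m : ℕ) (h₁ : r.clk = ⟨mcells s₁, s₁ + 1⟩) :
    DTr ((markProg false).rep m) r.toStore (m + 1)
      { r with clk := ⟨mcells (s₁ + m), (s₁ + m : ℕ) + 1⟩ }.toStore := by
  have := dtr_rep (P := markProg false) (τ := 1) (n := m) (fun i =>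
    { r with clk := ⟨mcells (s₁ + i), (s₁ + i : ℕ) + 1⟩ : Regs X Y })
    (fun i _ => dtr_upd rfl fun c k => by
      cases k <;> simp only [Regs.toStore, Tp.act_read, Tp.go_stay, mcells_act] <;>
        first | rfl | simp)
  simpa [← h₁] using this

/-- Move the head of the tape `k` to the end marker. -/
def rewindProg (k : Ax) : Prog (X ⊕ Ax) (Y ⊕ Aux) := Prog.while k (Prog.mv (one k .left))

lemma dtr_rewind_clk (r : Regs X Y) {c : ℤ → Sym (Y ⊕ Aux)} {q : ℕ} (hr : r.clk = ⟨c, q⟩)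
    (h0 : c 0 = lend) (h1 : ∀ i, 1 ≤ i → c i ≠ lend) :
    DTr (rewindProg .clk) r.toStore (2 * q + 1) { r with clk := ⟨c, 0⟩ }.toStore := by
  have := dtr_while (k := .clk) (P := Prog.mv (one .clk .left)) (τ := 1) (n := q)
    (fun i => { r with clk := ⟨c, q - i⟩ : Regs X Y })
    (fun i hi => by
      simpa [Regs.toStore, Tp.read, ← isLend_iff] using h1 (q - i) (by omega))
    (fun i hi => dtr_mv rfl fun k => by
      cases k <;> simp [Regs.toStore, one]
      simp [Tp.go, Move.shift]; ring)
    (by simp [Regs.toStore, Tp.read, isLend_iff, h0])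
  simpa [← hr, rewindProg, mul_comm] using this

lemma dtr_rewind_cnt (r : Regs X Y) {c : ℤ → Sym (Y ⊕ Aux)} {q : ℕ} (hr : r.cnt = ⟨c, q⟩)
    (h0 : c 0 = lend) (h1 : ∀ i, 1 ≤ i → c i ≠ lend) :
    DTr (rewindProg .cnt) r.toStore (2 * q + 1) { r with cnt := ⟨c, 0⟩ }.toStore := by
  have := dtr_while (k := .cnt) (P := Prog.mv (one .cnt .left)) (τ := 1) (n := q)
    (fun i => { r with cnt := ⟨c, q - i⟩ : Regs X Y })
    (fun i hi => by
      simpa [Regs.toStore, Tp.read, ← isLend_iff] using h1 (q - i) (by omega))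
    (fun i hi => dtr_mv rfl fun k => by
      cases k <;> simp [Regs.toStore, one]
      simp [Tp.go, Move.shift]; ring)
    (by simp [Regs.toStore, Tp.read, isLend_iff, h0])
  simpa [← hr, rewindProg, mul_comm] using this

/-- Lay out the odometers: `c₁ j + c₀` cells for `cnt` and `h` more for `clk`, when the counter `j`
has the value `j`. The counter is incremented in the end. -/
def layProg (c₁ c₀ h : ℕ) : Prog (X ⊕ Ax) (Y ⊕ Aux) :=
  (Prog.while .j ((Prog.mv (two .j .left .b .right)).seq ((markProg true).rep c₁))).seq
  ((Prog.while .b (Prog.mv (two .b .left .j .right))).seq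
  (((markProg true).rep c₀).seq
  (((markProg false).rep h).seq
  ((rewindProg .clk).seq
  ((rewindProg .cnt).seq
  ((Prog.mv (two .clk .right .cnt .right)).seq
  (Prog.mv (one .j .right))))))))

lemma dtr_layProg (r : Regs X Y) (c₁ c₀ h : ℕ) (hb : r.b = 0) (h₁ : r.clk = ⟨mcells 0, 1⟩)
    (h₂ : r.cnt = ⟨mcells 0, 1⟩) :
    DTr (layProg c₁ c₀ h) r.toStore (20 * (c₁ * r.j + c₀ + h + r.j + 1))
      { r with clk := ⟨mcells (c₁ * r.j + c₀ + h), 1⟩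
               cnt := ⟨mcells (c₁ * r.j + c₀), 1⟩
               j := r.j + 1 }.toStore := by
  have e1 := dtr_while (k := .j) (P := (Prog.mv (two .j .left .b .right)).seq
    ((markProg true).rep c₁)) (τ := c₁ + 2) (n := r.j)
    (fun i => { r with
      j := r.j - i
      b := i
      clk := ⟨mcells (i * c₁), (i * c₁ : ℕ) + 1⟩
      cnt := ⟨mcells (i * c₁), (i * c₁ : ℕ) + 1⟩ : Regs X Y })
    (fun i hi => by simp [Regs.toStore]; omega)
    (fun i hi => by
      obtain ⟨m, hm⟩ : ∃ m, r.j - i = m + 1 := ⟨r.j - i - 1, by omega⟩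
      have hm' : r.j - (i + 1) = m := by omega
      have h3 : DTr (Prog.mv (two .j .left .b .right))
          { r with
            j := r.j - i
            b := i
            clk := ⟨mcells (i * c₁), (i * c₁ : ℕ) + 1⟩
            cnt := ⟨mcells (i * c₁), (i * c₁ : ℕ) + 1⟩ : Regs X Y }.toStore 1
          { r with
            j := r.j - (i + 1)
            b := i + 1
            clk := ⟨mcells (i * c₁), (i * c₁ : ℕ) + 1⟩
            cnt := ⟨mcells (i * c₁), (i * c₁ : ℕ) + 1⟩ : Regs X Y }.toStore :=
        dtr_mv rfl fun k => by cases k <;> simp [Regs.toStore, two, hm, hm']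
      have h4 := dtr_marks_both { r with
            j := r.j - (i + 1)
            b := i + 1
            clk := ⟨mcells (i * c₁), (i * c₁ : ℕ) + 1⟩
            cnt := ⟨mcells (i * c₁), (i * c₁ : ℕ) + 1⟩ : Regs X Y } (i * c₁) (i * c₁) c₁ rfl rfl
      rw [← add_one_mul] at h4
      exact (h3.seq h4).mono_time (by omega))
    (by simp [Regs.toStore])
  have z1 : { r with
      j := r.j - 0
      b := 0
      clk := ⟨mcells (0 * c₁), (0 * c₁ : ℕ) + 1⟩
      cnt := ⟨mcells (0 * c₁), (0 * c₁ : ℕ) + 1⟩ : Regs X Y } = r := by cases r; simp_all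
  simp only [z1] at e1
  have e2 := dtr_while (k := .b) (P := Prog.mv (two .b .left .j .right)) (τ := 1) (n := r.j)
    (fun i => { r with
      j := r.j - r.j + i
      b := r.j - i
      clk := ⟨mcells (r.j * c₁), (r.j * c₁ : ℕ) + 1⟩
      cnt := ⟨mcells (r.j * c₁), (r.j * c₁ : ℕ) + 1⟩ : Regs X Y })
    (fun i hi => by simp [Regs.toStore]; omega)
    (fun i hi => dtr_mv rfl fun k => by
      obtain ⟨m, hm⟩ : ∃ m, r.j - i = m + 1 := ⟨r.j - i - 1, by omega⟩
      have hm' : r.j - (i + 1) = m := by omega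
      cases k <;> simp [Regs.toStore, two, hm, hm'])
    (by simp [Regs.toStore])
  have e3 := dtr_marks_both { r with
      clk := ⟨mcells (r.j * c₁), (r.j * c₁ : ℕ) + 1⟩
      cnt := ⟨mcells (r.j * c₁), (r.j * c₁ : ℕ) + 1⟩ : Regs X Y } (r.j * c₁) (r.j * c₁) c₀ rfl rfl
  have e4 := dtr_marks_clk { r with
      clk := ⟨mcells (r.j * c₁ + c₀), (r.j * c₁ + c₀ : ℕ) + 1⟩
      cnt := ⟨mcells (r.j * c₁ + c₀), (r.j * c₁ + c₀ : ℕ) + 1⟩ : Regs X Y } (r.j * c₁ + c₀) h rfl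
  have e5 := dtr_rewind_clk { r with
      clk := ⟨mcells (r.j * c₁ + c₀ + h), (r.j * c₁ + c₀ + h : ℕ) + 1⟩
      cnt := ⟨mcells (r.j * c₁ + c₀), (r.j * c₁ + c₀ : ℕ) + 1⟩ : Regs X Y }
    (c := mcells (r.j * c₁ + c₀ + h)) (q := r.j * c₁ + c₀ + h + 1) (by simp) (mcells_zero _)
    (fun i hi => mcells_ne_lend _ hi)
  have e6 := dtr_rewind_cnt { r with
      clk := ⟨mcells (r.j * c₁ + c₀ + h), 0⟩
      cnt := ⟨mcells (r.j * c₁ + c₀), (r.j * c₁ + c₀ : ℕ) + 1⟩ : Regs X Y }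
    (c := mcells (r.j * c₁ + c₀)) (q := r.j * c₁ + c₀ + 1) (by simp) (mcells_zero _)
    (fun i hi => mcells_ne_lend _ hi)
  have e7 : DTr (Prog.mv (two .clk .right .cnt .right)) { r with
      clk := ⟨mcells (r.j * c₁ + c₀ + h), 0⟩
      cnt := ⟨mcells (r.j * c₁ + c₀), 0⟩ : Regs X Y }.toStore 1 { r with
      clk := ⟨mcells (r.j * c₁ + c₀ + h), 1⟩
      cnt := ⟨mcells (r.j * c₁ + c₀), 1⟩ : Regs X Y }.toStore :=
    dtr_mv rfl fun k => by cases k <;> simp [Regs.toStore, two] <;> rfl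
  have e8 : DTr (Prog.mv (one .j .right)) { r with
      clk := ⟨mcells (r.j * c₁ + c₀ + h), 1⟩
      cnt := ⟨mcells (r.j * c₁ + c₀), 1⟩ : Regs X Y }.toStore 1 { r with
      clk := ⟨mcells (r.j * c₁ + c₀ + h), 1⟩
      cnt := ⟨mcells (r.j * c₁ + c₀), 1⟩
      j := r.j + 1 : Regs X Y }.toStore :=
    dtr_mv rfl fun k => by cases k <;> simp [Regs.toStore, one]
  simp only [Nat.sub_self, zero_add, Nat.sub_zero] at e1 e2
  simp only [hb] at e1 e2 e3 e4 e5 e6 e7 e8 ⊢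
  rw [mul_comm c₁]
  refine (e1.seq (e2.seq (e3.seq (e4.seq (e5.seq (e6.seq (e7.seq e8))))))).mono_time ?_
  have : r.j * (c₁ + 2 + 1) = r.j * c₁ + 3 * r.j := by ring
  omega

/-! ### Sampling -/

/-- Toss the coin until the odometer `clk` has completed its traversal, and count the successes
with the odometer `cnt`. -/
def sampleProg : Prog (X ⊕ Ax) (Y ⊕ Aux) :=
  Prog.while .clk (Prog.upd fun σ c k => match k with
    | .clk => tick (σ .clk)
    | .cnt => if c then tick (σ .cnt) else (σ .cnt, .stay)
    | k => (σ k, .stay))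

/-- The number of successes is within `d` of its expectation, except with the probability that
Chebyshev's inequality gives. The induction is on the number of tosses still to be made; the value
of the quadratic potential is the conditional expectation of the squared deviation. -/
lemma tr_sampleProg {r : Regs X Y} {s : ℕ} {t : Tp (Y ⊕ Aux)} (h₁ : r.clk = ⟨mcells s, 1⟩)
    (h₂ : r.cnt = t) {p d : ℝ} (hd : 0 < d) {Φ : Store (X ⊕ Ax) (Y ⊕ Aux) → ℝ → Prop}
    (hΦ : ∀ (x : ℕ) (δ : ℝ), (|x - p * odo s| < d ∧ 0 ≤ δ) ∨ 1 ≤ δ →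
      Φ { r with clk := ⟨mcells s, 0⟩, cnt := Tp.tick^[x] t }.toStore δ) :
    Tr sampleProg p Φ r.toStore (2 * odo s + 1) (odo s * (p * (1 - p)) / d ^ 2) := by
  have key : ∀ (m x : ℕ), m ≤ odo s → Tr sampleProg p Φ
      { r with clk := Tp.tick^[odo s - m] ⟨mcells s, 1⟩, cnt := Tp.tick^[x] t : Regs X Y }.toStore
      (2 * m + 1) (((x + m * p - p * odo s) ^ 2 + m * (p * (1 - p))) / d ^ 2) := by
    intro m
    induction m with
    | zero =>
      intro x _
      have hf := tick_full s _ _ (ready_mcells (Y := Y) s)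
      rw [reset_mcells, sub_self] at hf
      rw [Nat.sub_zero, hf]
      refine Tr.loop_exit ?_ (hΦ _ _ ?_)
      · simp [Store.scan, Regs.toStore, Tp.read, mcells_zero, isLend, lend]
      · simp only [Nat.cast_zero, zero_mul, add_zero]
        rcases lt_or_ge |(x : ℝ) - p * odo s| d with h | h
        · exact .inl ⟨h, by positivity⟩
        · refine .inr ?_
          rw [le_div_iff₀ (by positivity), one_mul]
          exact ((sq_le_sq₀ hd.le (abs_nonneg _)).2 h |>.trans (sq_abs _).le)
    | succ m ih =>
      intro x hm
      have hb : isLend (Tp.tick^[odo s - (m + 1)] (⟨mcells s, 1⟩ : Tp (Y ⊕ Aux))).read = false := by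
        rw [← Bool.not_eq_true, isLend_iff]
        exact read_tick_ne_lend (ready_mcells s) (fun i hi => mcells_ne_lend s hi) (by omega)
      have hstep (c : Bool) := upd_act (c := c)
        (f := fun σ c k => match k with
          | .clk => tick (σ .clk)
          | .cnt => if c then tick (σ .cnt) else (σ .cnt, .stay)
          | k => (σ k, .stay))
        (r := { r with
          clk := Tp.tick^[odo s - (m + 1)] ⟨mcells s, 1⟩, cnt := Tp.tick^[x] t : Regs X Y })
        (r' := { r with
          clk := Tp.tick^[odo s - m] ⟨mcells s, 1⟩
          cnt := Tp.tick^[if c then x + 1 else x] t : Regs X Y }) rfl fun k => by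
        have : odo s - m = (odo s - (m + 1)) + 1 := by omega
        cases k <;> simp only [Regs.toStore, Tp.act_read, Tp.go_stay]
        · rw [this, Function.iterate_succ_apply']; rfl
        · cases c
          · simp
          · simp only [if_true]
            rw [Function.iterate_succ_apply']; rfl
      rw [show 2 * (m + 1) + 1 = 1 + (2 * m + 1) + 1 by ring]
      refine Tr.loop_step (Φ := fun σ δ => ∃ y : ℕ, σ = { r with
          clk := Tp.tick^[odo s - m] ⟨mcells s, 1⟩, cnt := Tp.tick^[y] t : Regs X Y }.toStore ∧
          δ = ((y + m * p - p * odo s) ^ 2 + m * (p * (1 - p))) / d ^ 2)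
        (by simp [Store.scan, Regs.toStore, hb]) (Tr.atom (fun c =>
          (((if c then x + 1 else x : ℕ) + m * p - p * odo s) ^ 2 + m * (p * (1 - p))) / d ^ 2)
          (fun c => ⟨if c then x + 1 else x, hstep c, rfl⟩) (le_of_eq ?_)) ?_
      · simp only [if_true, Bool.false_eq_true, if_false]
        push_cast
        field_simp
        ring
      · rintro _ _ ⟨y, rfl, rfl⟩
        exact ih y (by omega)
  have := key (odo s) 0 le_rfl
  simp only [Nat.sub_self, Function.iterate_zero, id_eq] at this
  convert! this using 2
  · rw [← h₁, ← h₂]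
  · push_cast
    ring

/-! ### Decoding -/

/-- The index of a mark; `0` for other symbols. -/
def markVal : Sym (Y ⊕ Aux) → ℕ
  | .extra (.inr (.dig i)) => i
  | _ => 0

/-- Decode at most `m` cells, from the cell `i` on: the marks `2` and `3` stand for the bits, and
the mark `4` ends a block. Stop after `j` blocks, or at any other symbol. -/
def decode (c : ℤ → Sym (Y ⊕ Aux)) : ℕ → ℤ → ℕ → List Bool
  | 0, _, _ => []
  | m + 1, i, j => if j = 0 then [] else match markVal (c i) with
    | 2 => false :: decode c m (i + 1) j
    | 3 => true :: decode c m (i + 1) j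
    | 4 => decode c m (i + 1) (j - 1)
    | _ => []

lemma length_decode (c : ℤ → Sym (Y ⊕ Aux)) : ∀ (m : ℕ) (i : ℤ) (j : ℕ),
    (decode c m i j).length ≤ m
  | 0, _, _ => by simp [decode]
  | m + 1, i, j => by
    have h1 := length_decode c m (i + 1) j
    have h2 := length_decode c m (i + 1) (j - 1)
    rw [decode]
    split_ifs
    · simp
    · split <;> simp <;> omega

/-- Decode the mark that is scanned on `cnt`. -/
def decodeStep (σ : Ax → Sym (Y ⊕ Aux)) (_ : Bool) (k : Ax) : Sym (Y ⊕ Aux) × Move := match k with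
  | .out => match markVal (σ .cnt) with
    | 2 => (.bit false, .right)
    | 3 => (.bit true, .right)
    | _ => (σ .out, .stay)
  | .cnt => (σ .cnt, .right)
  | .j => (σ .j, if markVal (σ .cnt) = 4 then .left else .stay)
  | k => (σ k, .stay)

/-- Decode the odometer `cnt`, and write the result on the tape `out`. -/
def decodeProg : Prog (X ⊕ Ax) (Y ⊕ Aux) :=
  Prog.loop (fun σ => !isLend (σ (.inr .j)) && decide (2 ≤ markVal (σ (.inr .cnt))) &&
      decide (markVal (σ (.inr .cnt)) ≤ 4)) (Prog.upd decodeStep)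

/-- A tape with the word `y`, the head behind it. -/
def wtape {S : Type} (y : List Bool) : Tp S := ⟨tapeOfWord y, y.length⟩

lemma wtape_act {S : Type} (y : List Bool) (b : Bool) :
    (wtape y : Tp S).act (.bit b, .right) = wtape (y ++ [b]) := by
  ext
  · rename_i i
    simp only [wtape, Tp.act, Function.update_apply]
    rcases lt_trichotomy i y.length with h | rfl | h
    · rw [if_neg h.ne]
      unfold tapeOfWord
      split_ifs with h0
      · rw [List.getElem?_append_left (by omega)]
      · rfl
    · simp [tapeOfWord]
    · rw [if_neg h.ne', tapeOfWord_of_le h.le, tapeOfWord_of_le]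
      simp; omega
  · simp [wtape, Tp.act, Move.shift]

lemma dtr_decodeProg (c : ℤ → Sym (Y ⊕ Aux)) : ∀ (m : ℕ) (i : ℤ) (r : Regs X Y) (y : List Bool),
    r.cnt = ⟨c, i⟩ → r.out = wtape y → markVal (c (i + m)) = 0 → ∃ j' t',
    DTr decodeProg r.toStore (2 * m + 1)
      { r with cnt := t', j := j', out := wtape (y ++ decode c m i r.j) }.toStore := by
  intro m
  have hexit (r : Regs X Y) (m : ℕ) (i : ℤ) (y : List Bool) (hc : r.cnt = ⟨c, i⟩)
      (ho : r.out = wtape y) (hexit : r.j = 0 ∨ ¬ (2 ≤ markVal (c i) ∧ markVal (c i) ≤ 4)) :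
      ∃ j' t', DTr decodeProg r.toStore (2 * m + 1)
      { r with cnt := t', j := j', out := wtape (y ++ []) }.toStore := by
    refine ⟨r.j, r.cnt, ?_⟩
    have h : { r with cnt := r.cnt, j := r.j, out := wtape (y ++ []) : Regs X Y } = r := by
      cases r; simp_all
    rw [h]
    refine DTr.mono_time (t := 1) (DTr.loop_exit ?_) (by omega)
    have hcr : r.cnt.read = c i := by rw [hc]; rfl
    simp only [Store.scan, Regs.toStore, isLend_ctr, hcr]
    rcases hexit with h | h
    · simp [h]
    · rw [Bool.eq_false_iff]
      simp only [ne_eq, Bool.and_eq_true, decide_eq_true_eq]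
      tauto
  induction m with
  | zero =>
    intro i r y hc ho h0
    refine hexit r 0 i y hc ho (.inr ?_)
    simp only [Nat.cast_zero, add_zero] at h0
    omega
  | succ m ih =>
    intro i r y hc ho h0
    by_cases hj : r.j = 0
    · rw [decode, if_pos hj]
      exact hexit r _ i y hc ho (.inl hj)
    by_cases hv : 2 ≤ markVal (c i) ∧ markVal (c i) ≤ 4
    · have hb : (!isLend (r.toStore.scan (.inr .j)) &&
          decide (2 ≤ markVal (r.toStore.scan (.inr .cnt))) &&
          decide (markVal (r.toStore.scan (.inr .cnt)) ≤ 4)) = true := by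
        have hcr : r.cnt.read = c i := by rw [hc]; rfl
        simp [Store.scan, Regs.toStore, hcr, hv, hj]
      have h0' : markVal (c (i + 1 + m)) = 0 := by
        rw [← h0]; congr 2; push_cast; ring
      have hgo : (⟨c, i⟩ : Tp (Y ⊕ Aux)).go .right = ⟨c, i + 1⟩ := rfl
      have hcr : r.cnt.read = c i := by rw [hc]; rfl
      obtain ⟨n, hn⟩ : ∃ n, r.j = n + 1 := ⟨r.j - 1, by omega⟩
      have hd : decode c (m + 1) i r.j = match markVal (c i) with
          | 2 => false :: decode c m (i + 1) r.j
          | 3 => true :: decode c m (i + 1) r.j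
          | 4 => decode c m (i + 1) (r.j - 1)
          | _ => [] := by
        rw [decode, if_neg hj]
      rw [hd]
      obtain h | h | h : markVal (c i) = 2 ∨ markVal (c i) = 3 ∨ markVal (c i) = 4 := by omega
      · obtain ⟨j', t', hi⟩ := ih (i + 1) { r with cnt := ⟨c, i + 1⟩, out := wtape (y ++ [false]) }
          (y ++ [false]) rfl rfl h0'
        refine ⟨j', t', ?_⟩
        rw [h]
        simp only [List.append_assoc, List.singleton_append] at hi
        have h1 : DTr (Prog.upd decodeStep) r.toStore 1
            { r with cnt := ⟨c, i + 1⟩, out := wtape (y ++ [false]) : Regs X Y }.toStore :=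
          dtr_upd rfl fun _ k => by
            cases k <;> simp only [Regs.toStore, decodeStep, Tp.act_read, hcr, h, Tp.go_stay]
            · simp
            · rw [← hcr, Tp.act_read, hc, hgo]
            · rw [ho, wtape_act]
        exact (DTr.loop_step hb h1 hi).mono_time (by omega)
      · obtain ⟨j', t', hi⟩ := ih (i + 1) { r with cnt := ⟨c, i + 1⟩, out := wtape (y ++ [true]) }
          (y ++ [true]) rfl rfl h0'
        refine ⟨j', t', ?_⟩
        rw [h]
        simp only [List.append_assoc, List.singleton_append] at hi
        have h1 : DTr (Prog.upd decodeStep) r.toStore 1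
            { r with cnt := ⟨c, i + 1⟩, out := wtape (y ++ [true]) : Regs X Y }.toStore :=
          dtr_upd rfl fun _ k => by
            cases k <;> simp only [Regs.toStore, decodeStep, Tp.act_read, hcr, h, Tp.go_stay]
            · simp
            · rw [← hcr, Tp.act_read, hc, hgo]
            · rw [ho, wtape_act]
        exact (DTr.loop_step hb h1 hi).mono_time (by omega)
      · obtain ⟨j', t', hi⟩ := ih (i + 1) { r with cnt := ⟨c, i + 1⟩, j := r.j - 1 }
          y rfl ho h0'
        refine ⟨j', t', ?_⟩
        rw [h]
        have h1 : DTr (Prog.upd decodeStep) r.toStore 1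
            { r with cnt := ⟨c, i + 1⟩, j := r.j - 1 : Regs X Y }.toStore :=
          dtr_upd rfl fun _ k => by
            cases k <;> simp only [Regs.toStore, decodeStep, Tp.act_read, hcr, h, Tp.go_stay]
            · simp [hn]
            · rw [← hcr, Tp.act_read, hc, hgo]
        exact (DTr.loop_step hb h1 hi).mono_time (by omega)
    · have : decode c (m + 1) i r.j = [] := by
        rw [decode, if_neg hj]
        split <;> first | rfl | omega
      rw [this]
      exact hexit r _ i y hc ho (.inr hv)

/-! ### Reading advice from the coin -/

/-- However often an odometer is advanced, its head stays on the marks and their two ends, and the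
ends remain. -/
lemma mcells_tick (s x : ℕ) :
    (∃ q : ℕ, (Tp.tick^[x] (⟨mcells s, 1⟩ : Tp (Y ⊕ Aux))).head = q ∧ q ≤ s + 1) ∧
    (Tp.tick^[x] (⟨mcells s, 1⟩ : Tp (Y ⊕ Aux))).cells 0 = lend ∧
    (Tp.tick^[x] (⟨mcells s, 1⟩ : Tp (Y ⊕ Aux))).cells (1 + s) = .blank ∧
    ∀ i : ℕ, 1 ≤ i → i ≤ s →
      ∃ m, (Tp.tick^[x] (⟨mcells s, 1⟩ : Tp (Y ⊕ Aux))).cells i = dig m := by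
  induction x with
  | zero =>
    refine ⟨⟨1, rfl, by omega⟩, rfl, ?_, fun i h1 h2 => ⟨0, ?_⟩⟩
    · exact (ready_mcells s).2
    · simp only [Function.iterate_zero, id, mcells]
      rw [if_neg (by omega), if_pos (by omega)]
  | succ x ih =>
    rw [Function.iterate_succ_apply']
    obtain ⟨⟨q, hq, hqs⟩, h0, h1, h2⟩ := ih
    generalize Tp.tick^[x] (⟨mcells s, 1⟩ : Tp (Y ⊕ Aux)) = t at *
    obtain ⟨c, p⟩ := t
    dsimp only at *
    subst hq
    -- On the end marker the head rests, on a mark it turns to either side, and on the blank behind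
    -- the marks it turns back.
    have cases : q = 0 ∨ (1 ≤ q ∧ q ≤ s) ∨ q = s + 1 := by omega
    rcases cases with rfl | ⟨hq1, hq2⟩ | rfl
    · have : Tp.tick (⟨c, (0 : ℕ)⟩ : Tp (Y ⊕ Aux)) = ⟨c, (0 : ℕ)⟩ := by
        have h0' : c ((0 : ℕ) : ℤ) = lend := h0
        simp only [Tp.tick, Tp.act, Tp.read, h0', tick, lend, Move.shift, add_zero]
        congr 1
        rw [Function.update_eq_self_iff]
        exact h0'.symm
      rw [this]
      exact ⟨⟨0, rfl, by omega⟩, h0, h1, h2⟩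
    · obtain ⟨m, hm⟩ := h2 q hq1 hq2
      have key : ∃ m' : Fin 6, ∃ q' : ℕ, q' ≤ s + 1 ∧
          Tp.tick (⟨c, q⟩ : Tp (Y ⊕ Aux)) = ⟨Function.update c q (dig m'), q'⟩ := by
        by_cases h5 : m = 5
        · subst h5
          refine ⟨0, q - 1, by omega, ?_⟩
          rw [tick_last hm]
          congr 1
          omega
        · exact ⟨m + 1, q + 1, by omega, by rw [tick_mark m hm h5]; rfl⟩
      obtain ⟨m', q', hq', he⟩ := key
      rw [he]
      refine ⟨⟨q', rfl, hq'⟩, ?_, ?_, fun i hi1 hi2 => ?_⟩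
      · rw [← h0]; exact Function.update_of_ne (by omega) _ _
      · rw [← h1]; exact Function.update_of_ne (by omega) _ _
      · rcases eq_or_ne i q with rfl | hne
        · exact ⟨m', Function.update_self _ _ _⟩
        · obtain ⟨m'', hm''⟩ := h2 i hi1 hi2
          refine ⟨m'', ?_⟩
          rw [← hm'']; exact Function.update_of_ne (by omega) _ _
    · have hb : c ((s + 1 : ℕ) : ℤ) = .blank := by rw [← h1]; congr 1; push_cast; ring
      have : Tp.tick (⟨c, (s + 1 : ℕ)⟩ : Tp (Y ⊕ Aux)) = ⟨c, s⟩ := by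
        simp only [Tp.tick, Tp.act, Tp.read, hb, tick, Move.shift]
        congr 1
        · rw [Function.update_eq_self_iff]
          exact hb.symm
        · push_cast; ring
      rw [this]
      exact ⟨⟨s, rfl, by omega⟩, h0, h1, h2⟩

/-- Count the length of the input, compute from it the number `j` of the block that is wanted, toss
the coin for one traversal of an odometer whose depth is `c₁ j + c₀ + h`, and decode the first
blocks of the number of successes. -/
def advProg (pre : Prog (X ⊕ Ax) (Y ⊕ Aux)) (c₁ c₀ h : ℕ) : Prog (X ⊕ Ax) (Y ⊕ Aux) :=
  initProg.seq (copyProg.seq (pre.seq (logProg.seq ((layProg c₁ c₀ h).seq (sampleProg.seq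
    ((rewindProg .cnt).seq ((Prog.mv (one .cnt .right)).seq decodeProg)))))))

/-- The tapes after the execution of `advProg`. -/
structure AfterAdv (r : Regs X Y) (w y : List Bool) (s : ℕ) : Prop where
  x_eq : r.x = fun _ => Tp.blank
  inp_eq : r.inp = ⟨tapeOfWord w, w.length⟩
  clk_eq : r.clk = ⟨mcells s, 0⟩
  out_eq : r.out = wtape y
  bus_eq : r.bus = Tp.blank

/-- The time that `advProg` takes, if the preparation takes `t` steps, the argument of the logarithm
is `a + 1`, its value is `j`, and the odometers have depth `s` and at most `s`. -/
def advTime (n t a j s : ℕ) : ℕ := 2 * n + t + 12 * a + 20 * j + 24 * s + 2 * odo s + 30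

/-- The result of `advProg` is `v`, up to the error in Chebyshev's inequality, if all numbers of
successes at distance less than `d` from the expectation are decoded as `v`. -/
lemma tr_advProg [DecidableEq X] {pre : Prog (X ⊕ Ax) (Y ⊕ Aux)} {g t : ℕ → ℕ}
    (hpre : Computes pre g t) {c₁ c₀ h : ℕ} {w : List Bool} {J s : ℕ}
    (hJ : J = Nat.log 2 (g w.length + 1)) (hs : s = c₁ * J + c₀) {q d : ℝ} (hd : 0 < d)
    {v : List Bool} (hv : ∀ x : ℕ, |x - q * odo (s + h)| < d →
      decode (Tp.tick^[x] (⟨mcells s, 1⟩ : Tp (Y ⊕ Aux))).cells s 1 (J + 1) = v)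
    {Φ : Store (X ⊕ Ax) (Y ⊕ Aux) → ℝ → Prop}
    (hΦ : ∀ (r : Regs X Y) (y : List Bool) (δ : ℝ), AfterAdv r w y (s + h) → y.length ≤ s →
      (y = v ∧ 0 ≤ δ) ∨ 1 ≤ δ → Φ r.toStore δ) :
    Tr (advProg pre c₁ c₀ h) q Φ (initStore (.inr .inp) w)
      (advTime w.length (t w.length) (g w.length) J (s + h))
      (odo (s + h) * (q * (1 - q)) / d ^ 2) := by
  have e1 := dtr_initProg (X := X) (Y := Y) w
  have e2 := dtr_copyProg (startRegs X (Y := Y) w) w rfl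
  obtain ⟨m, e3⟩ := hpre { startRegs X (Y := Y) w with
    inp := ⟨tapeOfWord w, w.length⟩, n₁ := (startRegs X (Y := Y) w).n₁ + w.length } rfl rfl rfl
  have hn : (startRegs X (Y := Y) w).n₁ + w.length = w.length := Nat.zero_add _
  simp only [hn] at e2 e3
  have e4 := dtr_logProg (g w.length) { startRegs X (Y := Y) w with
    inp := ⟨tapeOfWord w, w.length⟩, n₁ := m, a := g w.length } rfl rfl
  have hj : (startRegs X (Y := Y) w).j + Nat.log 2 (g w.length + 1) = J := by
    rw [hJ]; exact Nat.zero_add _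
  simp only [hj] at e4
  have e5 := dtr_layProg { startRegs X (Y := Y) w with
    inp := ⟨tapeOfWord w, w.length⟩, n₁ := m, a := 0, j := J } c₁ c₀ h rfl rfl rfl
  simp only [← hs] at e5
  have e6 := tr_sampleProg (r := { startRegs X (Y := Y) w with
    inp := ⟨tapeOfWord w, w.length⟩, n₁ := m, a := 0, j := J + 1, clk := ⟨mcells (s + h), 1⟩,
    cnt := ⟨mcells s, 1⟩ }) (s := s + h) (t := ⟨mcells s, 1⟩) rfl rfl (p := q) hd
    (Φ := fun σ δ => ∃ x : ℕ, ((|x - q * odo (s + h)| < d ∧ 0 ≤ δ) ∨ 1 ≤ δ) ∧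
      σ = { startRegs X (Y := Y) w with
        inp := ⟨tapeOfWord w, w.length⟩, n₁ := m, a := 0, j := J + 1, clk := ⟨mcells (s + h), 0⟩,
        cnt := Tp.tick^[x] ⟨mcells s, 1⟩ }.toStore)
    (fun x δ hx => ⟨x, hx, rfl⟩)
  refine Ev.mono_time (e1.seqTr (e2.seqTr (e3.seqTr (e4.seqTr (e5.seqTr (Tr.seq e6
    (t' := 2 * (s + 1) + 1 + (1 + (2 * s + 1))) ?_)))))) ?_
  swap
  · rw [advTime]
    have : 20 * (c₁ * J + c₀ + h + J + 1) = 20 * s + 20 * h + 20 * J + 20 := by rw [hs]; ring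
    omega
  rintro _ δ ⟨x, hx, rfl⟩
  obtain ⟨⟨p, hp, hps⟩, h0, h1, h2⟩ := mcells_tick (Y := Y) s x
  have hc : ∀ i : ℤ, 1 ≤ i → (Tp.tick^[x] (⟨mcells s, 1⟩ : Tp (Y ⊕ Aux))).cells i ≠ lend :=
    fun i hi hl => mcells_ne_lend s hi (lend_of_cells_tick hl)
  have hvx := hv x
  generalize Tp.tick^[x] (⟨mcells s, 1⟩ : Tp (Y ⊕ Aux)) = u at *
  obtain ⟨c, p'⟩ := u
  dsimp only at *
  subst hp
  have e7 := dtr_rewind_cnt { startRegs X (Y := Y) w with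
        inp := ⟨tapeOfWord w, w.length⟩, n₁ := m, a := 0, j := J + 1, clk := ⟨mcells (s + h), 0⟩,
        cnt := ⟨c, p⟩ } rfl h0 hc
  have e8 : DTr (Prog.mv (one .cnt .right)) { startRegs X (Y := Y) w with
        inp := ⟨tapeOfWord w, w.length⟩, n₁ := m, a := 0, j := J + 1, clk := ⟨mcells (s + h), 0⟩,
        cnt := ⟨c, 0⟩ }.toStore 1 { startRegs X (Y := Y) w with
        inp := ⟨tapeOfWord w, w.length⟩, n₁ := m, a := 0, j := J + 1, clk := ⟨mcells (s + h), 0⟩,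
        cnt := ⟨c, 1⟩ }.toStore :=
    dtr_mv rfl fun k => by cases k <;> simp [Regs.toStore, one]; simp [Tp.go, Move.shift]
  obtain ⟨j', t', e9⟩ := dtr_decodeProg c s 1 { startRegs X (Y := Y) w with
        inp := ⟨tapeOfWord w, w.length⟩, n₁ := m, a := 0, j := J + 1, clk := ⟨mcells (s + h), 0⟩,
        cnt := ⟨c, 1⟩ } [] rfl (by
          ext <;> simp [startRegs, Tp.blank, wtape, tapeOfWord]) (by rw [h1]; rfl)
  refine Ev.mono_time ((e7.seq (e8.seq e9)) q Φ δ ?_) (by omega)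
  refine hΦ _ (decode c s 1 (J + 1)) δ ⟨rfl, rfl, rfl, by simp, rfl⟩ (length_decode _ _ _ _) ?_
  rcases hx with hx | hx
  · exact .inl ⟨hvx hx.1, hx.2⟩
  · exact .inr hx

/-! ### Advice as a real number -/

/-- The digits that code a word: `1` and `2` for the bits, `3` for the end. -/
def code (u : List Bool) : List (Fin 5) := u.map (fun b => if b then 2 else 1) ++ [3]

@[simp] lemma length_code (u : List Bool) : (code u).length = u.length + 1 := by simp [code]

lemma mem_code {u : List Bool} {d : Fin 5} (h : d ∈ code u) : 1 ≤ d.val ∧ d.val ≤ 3 := by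
  simp only [code, List.mem_append, List.mem_map, List.mem_singleton] at h
  obtain ⟨b, -, rfl⟩ | rfl := h
  · cases b <;> simp
  · simp

lemma decode_code (c : ℤ → Sym (Y ⊕ Aux)) (m j : ℕ) : ∀ (u : List Bool) (p : ℤ),
    (∀ i (hi : i < (code u).length), markVal (c (p + i)) = ((code u)[i]).val + 1) →
    decode c ((code u).length + m) p (j + 1) = u ++ decode c m (p + (code u).length) j
  | [], p, h => by
    have h0 := h 0 (by simp)
    simp only [code, List.map_nil, List.nil_append, List.getElem_cons_zero, Nat.cast_zero,
      add_zero] at h0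
    have h0' : markVal (c p) = 4 := h0
    simp only [code, List.map_nil, List.nil_append, List.length_singleton, Nat.cast_one]
    rw [add_comm, decode, if_neg (by omega), h0']
    simp
  | b :: u, p, h => by
    have h0 := h 0 (by simp)
    have ih := decode_code c m j u (p + 1) fun i hi => by
      have := h (i + 1) (by simpa using hi)
      rw [show p + 1 + (i : ℤ) = p + ((i + 1 : ℕ) : ℤ) by push_cast; ring, this]
      rfl
    have hl : (code (b :: u)).length + m = ((code u).length + m) + 1 := by
      simp only [length_code, List.length_cons]; ring
    have hp : p + ((code (b :: u)).length : ℤ) = p + 1 + ((code u).length : ℤ) := by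
      simp only [length_code, List.length_cons]; push_cast; ring
    have h0' : markVal (c p) = if b then 3 else 2 := by
      rw [Nat.cast_zero, add_zero] at h0
      rw [h0]; cases b <;> rfl
    rw [hl, decode, if_neg (by omega), h0', hp, List.cons_append, ← ih]
    cases b <;> rfl

lemma decode_flatMap (c : ℤ → Sym (Y ⊕ Aux)) (m : ℕ) : ∀ (us : List (List Bool)) (p : ℤ),
    (∀ i (hi : i < (us.flatMap code).length),
      markVal (c (p + i)) = ((us.flatMap code)[i]).val + 1) →
    decode c ((us.flatMap code).length + m) p us.length = us.flatten
  | [], p, _ => by cases m <;> simp [decode]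
  | u :: us, p, h => by
    have ih := decode_flatMap c m us (p + (code u).length) fun i hi => by
      have := h ((code u).length + i) (by
        rw [List.flatMap_cons, List.length_append]; omega)
      rw [add_assoc, ← Nat.cast_add, this]
      simp [List.getElem_append_right]
    rw [List.flatMap_cons, List.length_append, add_assoc, List.length_cons, decode_code, ih,
      List.flatten_cons]
    intro i hi
    rw [h i (by rw [List.flatMap_cons, List.length_append]; omega)]
    simp [List.getElem_append_left hi]

/-- The beginning of the digit sequence: the codes of the words `u 0, …, u j`. -/
def digitList (u : ℕ → List Bool) (j : ℕ) : List (Fin 5) :=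
  ((List.range (j + 1)).map u).flatMap code

lemma digitList_succ (u : ℕ → List Bool) (j : ℕ) :
    digitList u (j + 1) = digitList u j ++ code (u (j + 1)) := by
  simp [digitList, List.range_succ (n := j + 1)]

lemma lt_length_digitList (u : ℕ → List Bool) (j : ℕ) : j < (digitList u j).length := by
  induction j with
  | zero => simp [digitList]
  | succ j ih => rw [digitList_succ, List.length_append, length_code]; omega

lemma digitList_prefix (u : ℕ → List Bool) {i j : ℕ} (h : i ≤ j) :
    digitList u i <+: digitList u j := by
  induction j, h using Nat.le_induction with
  | base => exact List.prefix_rfl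
  | succ j _ ih => rw [digitList_succ]; exact ih.trans (List.prefix_append _ _)

/-- The digit sequence that codes all the words. -/
def digit (u : ℕ → List Bool) (i : ℕ) : Fin 5 := (digitList u i)[i]'(lt_length_digitList u i)

lemma getElem_digitList (u : ℕ → List Bool) (j i : ℕ) (hi : i < (digitList u j).length) :
    (digitList u j)[i] = digit u i := by
  rcases le_total i j with h | h
  · exact ((digitList_prefix u h).getElem (lt_length_digitList u i)).symm
  · exact (digitList_prefix u h).getElem hi

lemma digit_bounds (u : ℕ → List Bool) (i : ℕ) : 1 ≤ (digit u i).val ∧ (digit u i).val ≤ 3 := by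
  have : digit u i ∈ digitList u i := List.getElem_mem _
  rw [digitList, List.mem_flatMap] at this
  obtain ⟨v, -, hv⟩ := this
  exact mem_code hv

/-- A number with base `5` digits between `1` and `3` is not close to an end of the interval of the
numbers with the same first digits. -/
lemma ofDigits_bounds (D : ℕ → Fin 5) (hD : ∀ i, 1 ≤ (D i).val ∧ (D i).val ≤ 3) :
    1 / 4 ≤ Real.ofDigits D ∧ Real.ofDigits D ≤ 3 / 4 := by
  have hg : HasSum (fun i : ℕ => ((5 : ℝ) ^ (i + 1))⁻¹) (1 / 4) := by
    have := (hasSum_geometric_of_lt_one (r := (5 : ℝ)⁻¹) (by norm_num) (by norm_num)).mul_left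
      (5 : ℝ)⁻¹
    convert! this using 1
    · funext i; rw [pow_succ', mul_inv, inv_pow]
    · norm_num
  have hs := (Real.summable_ofDigitsTerm (digits := D)).hasSum
  constructor
  · refine hasSum_le (fun i => ?_) hg hs
    have h1 : (1 : ℝ) ≤ (D i).val := by exact_mod_cast (hD i).1
    have h2 : (0 : ℝ) ≤ ((5 : ℝ) ^ (i + 1))⁻¹ := by positivity
    simp only [Real.ofDigitsTerm]
    push_cast
    nlinarith
  · rw [show (3 : ℝ) / 4 = 3 * (1 / 4) by norm_num]
    refine hasSum_le (fun i => ?_) hs (hg.mul_left 3)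
    have h1 : ((D i).val : ℝ) ≤ 3 := by exact_mod_cast (hD i).2
    have h2 : (0 : ℝ) ≤ ((5 : ℝ) ^ (i + 1))⁻¹ := by positivity
    simp only [Real.ofDigitsTerm]
    push_cast
    nlinarith

lemma digitsVal_add_ofDigits (L : ℕ) : ∀ D : ℕ → Fin 5,
    Real.ofDigits D * 5 ^ L = digitsVal (fun i => D i) L + Real.ofDigits fun i => D (i + L) := by
  induction L with
  | zero => intro D; simp [digitsVal]
  | succ L ih =>
    intro D
    have h1 := Real.ofDigits_eq_sum_add_ofDigits D 1
    have h2 := ih fun i => D (i + 1)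
    simp only [Finset.sum_range_one, Real.ofDigitsTerm] at h1
    rw [digitsVal, h1]
    push_cast at h2 ⊢
    have h3 : (fun i => D (i + (L + 1))) = fun i => D (i + L + 1) := rfl
    rw [h3]
    rw [pow_succ]
    linear_combination h2

/-- If the number of successes is near its expectation, then the marks of the odometer spell the
digits of the bias of the coin. -/
lemma decode_of_abs_lt (u : ℕ → List Bool) {j s h L x : ℕ} (hL : L = (digitList u j).length)
    (hs : 2 * L + 1 ≤ s)
    (hx : |(x : ℝ) - Real.ofDigits (digit u) / 5 ^ h * odo (s + h)| < 5 ^ (s + 1 - L) / 16) :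
    decode (Tp.tick^[x] (⟨mcells s, 1⟩ : Tp (Y ⊕ Aux))).cells s 1 (j + 1) =
      (List.range (j + 1)).flatMap u := by
  -- The tolerance of `digits_tick` and the rounding errors are small in comparison with the margin
  -- that the absence of the digits `0` and `4` leaves.
  have hU : 16 * L + 24 ≤ 5 ^ (s + 1 - L) := by
    have h1 : (5 : ℕ) ^ (L + 2) ≤ 5 ^ (s + 1 - L) := Nat.pow_le_pow_right (by norm_num) (by omega)
    have h2 : L < 5 ^ L := Nat.lt_pow_self (by norm_num)
    rw [pow_add] at h1
    omega
  obtain ⟨b1, b2⟩ := ofDigits_bounds (fun i => digit u (i + L)) fun i => digit_bounds u _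
  obtain ⟨b3, b4⟩ := ofDigits_bounds (digit u) fun i => digit_bounds u _
  have hV := digitsVal_add_ofDigits L (digit u)
  have hodo : (2 * odo (s + h) + 3 : ℝ) = 5 ^ (s + 1) * 5 ^ h := by
    rw [← pow_add, show s + 1 + h = s + h + 1 by ring]
    exact_mod_cast two_mul_odo (s + h)
  have hpow : (5 : ℝ) ^ (s + 1) = 5 ^ L * 5 ^ (s + 1 - L) := by
    rw [← pow_add]; congr 1; omega
  set θ := Real.ofDigits (digit u)
  set τ := Real.ofDigits fun i => digit u (i + L)
  set V := digitsVal (fun i => (digit u i : ℕ)) L with hVdef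
  set U : ℕ := 5 ^ (s + 1 - L) with hUdef
  have hUr : (5 : ℝ) ^ (s + 1 - L) = U := by rw [hUdef]; push_cast; rfl
  rw [hUr] at hpow hx
  have hU' : (16 * L + 24 : ℝ) ≤ U := by exact_mod_cast hU
  have h5 : (1 : ℝ) ≤ 5 ^ h := one_le_pow₀ (by norm_num)
  have he : 2 * (θ / 5 ^ h * odo (s + h)) = (V + τ) * U - 3 * (θ / 5 ^ h) := by
    have : (V + τ) * U = θ * 5 ^ (s + 1) := by rw [hpow, ← mul_assoc, hV]
    rw [this]
    have h6 : (odo (s + h) : ℝ) = (5 ^ (s + 1) * 5 ^ h - 3) / 2 := by linarith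
    rw [h6]
    field_simp
  have hq : θ / 5 ^ h ≤ 1 := by rw [div_le_one (by positivity)]; linarith
  have hq0 : 0 ≤ θ / 5 ^ h := by positivity
  have hU0 : (0 : ℝ) ≤ U := Nat.cast_nonneg _
  rw [abs_lt] at hx
  have d1 := digits_tick L s (mcells s : ℤ → Sym (Y ⊕ Aux)) 1 (fun i => digit u i)
    (fun i => (digit u i).isLt) x (ready_mcells s) (by omega) (by
      have : (V * U + 2 * L : ℝ) ≤ 2 * x := by nlinarith
      exact_mod_cast this) (by
      have : (2 * x + 2 * L + 3 : ℝ) ≤ (V + 1) * U := by nlinarith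
      exact_mod_cast this)
  have d2 := decode_flatMap (Tp.tick^[x] (⟨mcells s, 1⟩ : Tp (Y ⊕ Aux))).cells (s - L)
    ((List.range (j + 1)).map u) 1 (fun i hi => by
      change i < (digitList u j).length at hi
      rw [d1 i (by omega)]
      change _ = ((digitList u j)[i]).val + 1
      rw [getElem_digitList]
      rfl)
  have hl : (((List.range (j + 1)).map u).flatMap code).length = L := hL.symm
  rw [hl, Nat.add_sub_cancel' (by omega), List.length_map, List.length_range] at d2
  rw [d2, List.flatMap_def]

lemma Tr.mono_err {K S : Type} {P : Prog K S} {p : ℝ} {Φ : Store K S → ℝ → Prop} {s : Store K S}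
    {t : ℕ} {δ δ' : ℝ} (h : Tr P p Φ s t δ) (hδ : δ ≤ δ') : Tr P p Φ s t δ' := by
  cases h with
  | step d h hd => exact .step d h (hd.trans hδ)

/-- Every chain of words arises by concatenation. -/
lemma exists_flatMap_eq {F : ℕ → List Bool} (hF : IsPrefixFunction F) :
    ∃ u : ℕ → List Bool, ∀ j, (List.range (j + 1)).flatMap u = F j := by
  refine ⟨fun j => (F j).drop (if j = 0 then 0 else (F (j - 1)).length), fun j => ?_⟩
  induction j with
  | zero => simp
  | succ j ih =>
    rw [List.range_succ, List.flatMap_append, ih, List.flatMap_singleton, if_neg (by omega)]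
    obtain ⟨v, hv⟩ := hF j
    simp [← hv]

lemma length_digitList (u : ℕ → List Bool) (j : ℕ) :
    (digitList u j).length = ((List.range (j + 1)).flatMap u).length + (j + 1) := by
  induction j with
  | zero => simp [digitList]
  | succ j ih =>
    rw [digitList_succ, List.length_append, ih, List.range_succ (n := j + 1), length_code,
      List.flatMap_append, List.length_append, List.flatMap_singleton]
    omega

/-- An error that is admitted in any case can be added to the errors at the end. -/
lemma Ev.shift {K S : Type} {P : Prog K S} {p : ℝ} {Φ : Store K S → ℝ → Prop} {o : Option P.Q}
    {s : Store K S} {t : ℕ} {δ : ℝ} (e : ℝ) (h : Ev P p Φ o s t δ) :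
    Ev P p (fun σ d => Φ σ (d - e)) o s t (δ + e) := by
  induction h with
  | done h => exact .done (by rwa [add_sub_cancel_right])
  | step d _ hd ih => exact .step (fun c => d c + e) ih (by linarith)

/-- A chain of words of linearly growing length can be coded as a real number from which the word
`F j` is obtained with a small error, if the number is the bias of a coin. -/
theorem exists_advice {F : ℕ → List Bool} (hF : IsPrefixFunction F) {a b : ℕ}
    (hab : ∀ j, (F j).length ≤ a * j + b) {δ : ℝ} (hδ : 0 < δ) :
    ∃ θ : ℝ, 0 < θ ∧ θ < 1 ∧ ∃ k : ℕ, ∀ {X Y : Type} [DecidableEq X]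
      {pre : Prog (X ⊕ Ax) (Y ⊕ Aux)} {g t : ℕ → ℕ}, Computes pre g t →
      ∀ {c₁ c₀ : ℕ} (h : ℕ) {w : List Bool} {J s : ℕ}, 2 * (a + 1) ≤ c₁ → k ≤ c₀ →
      J = Nat.log 2 (g w.length + 1) → s = c₁ * J + c₀ →
      ∀ {Φ : Store (X ⊕ Ax) (Y ⊕ Aux) → ℝ → Prop},
      (∀ (r : Regs X Y) (y : List Bool) (δ : ℝ), AfterAdv r w y (s + h) → y.length ≤ s →
        (y = F J ∧ 0 ≤ δ) ∨ 1 ≤ δ → Φ r.toStore δ) →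
      Tr (advProg pre c₁ c₀ h) (θ / 5 ^ h) Φ (initStore (.inr .inp) w)
        (advTime w.length (t w.length) (g w.length) J (s + h)) δ := by
  obtain ⟨u, hu⟩ := exists_flatMap_eq hF
  obtain ⟨b1, b2⟩ := ofDigits_bounds (digit u) fun i => digit_bounds u _
  obtain ⟨k₀, hk₀⟩ := pow_unbounded_of_one_lt (128 / δ) (show (1 : ℝ) < 5 by norm_num)
  refine ⟨Real.ofDigits (digit u), by linarith, by linarith, 2 * (b + 1) + k₀ + 1, ?_⟩
  intro X Y _ pre g t hpre c₁ c₀ h w J s hc₁ hc₀ hJ hs Φ hΦ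
  set θ := Real.ofDigits (digit u)
  obtain ⟨L, hL⟩ : ∃ L, L = (digitList u J).length := ⟨_, rfl⟩
  -- `c₁` and `c₀` have been chosen so that the odometer has at least twice as many cells as there
  -- are digits to be read.
  have hLs : 2 * L + k₀ + 1 ≤ s := by
    have h1 := hab J
    have h2 : L = (F J).length + (J + 1) := by rw [hL, length_digitList, hu]
    have h3 : 2 * (a + 1) * J ≤ c₁ * J := Nat.mul_le_mul_right _ hc₁
    have h4 : 2 * (a + 1) * J = 2 * (a * J) + 2 * J := by ring
    omega
  refine Tr.mono_err (tr_advProg hpre hJ hs (d := 5 ^ (s + 1 - L) / 16) (v := F J) (by positivity)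
    (fun x hx => ?_) hΦ) ?_
  · rw [← hu]
    exact decode_of_abs_lt u hL (by omega) hx
  -- The variance `odo (s + h) * (q * (1 - q))` is at most `5 ^ (s + 1) / 2`.
  · have hodo : (2 * odo (s + h) + 3 : ℝ) = 5 ^ (s + 1) * 5 ^ h := by
      rw [← pow_add, show s + 1 + h = s + h + 1 by ring]
      exact_mod_cast two_mul_odo (s + h)
    have h5 : (0 : ℝ) < 5 ^ h := by positivity
    have h1 : θ / 5 ^ h * (1 - θ / 5 ^ h) ≤ 1 / 5 ^ h := by
      have h2 : 0 ≤ θ / 5 ^ h := by positivity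
      have h3 : θ / 5 ^ h ≤ 1 / 5 ^ h := by gcongr; linarith
      nlinarith
    have h2 : (odo (s + h) : ℝ) * (θ / 5 ^ h * (1 - θ / 5 ^ h)) ≤ 5 ^ (s + 1) / 2 := by
      calc (odo (s + h) : ℝ) * (θ / 5 ^ h * (1 - θ / 5 ^ h))
          ≤ 5 ^ (s + 1) * 5 ^ h / 2 * (1 / 5 ^ h) := by
            refine mul_le_mul (by linarith) h1 ?_ (by positivity)
            have h3 : θ / 5 ^ h ≤ 1 := by
              rw [div_le_one h5]
              exact (by linarith : θ ≤ 1).trans (one_le_pow₀ (by norm_num))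
            have h4 : 0 ≤ θ / 5 ^ h := by positivity
            nlinarith
        _ = 5 ^ (s + 1) / 2 := by field_simp
    rw [div_lt_iff₀ hδ] at hk₀
    rw [div_le_iff₀ (by positivity)]
    refine h2.trans ?_
    have h6 : (5 : ℝ) ^ (s + 1) * 5 ^ k₀ ≤ (5 ^ (s + 1 - L)) ^ 2 := by
      rw [← pow_add, ← pow_mul]
      exact pow_le_pow_right₀ (by norm_num) (by omega)
    rw [div_pow]
    have h7 : (0 : ℝ) < 5 ^ (s + 1) := by positivity
    nlinarith

/-! ### Polynomial bounds -/

/-- The function is bounded by a polynomial. -/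
def PolyBdd (g : ℕ → ℕ) : Prop := ∃ p : Polynomial ℕ, ∀ n, g n ≤ p.eval n

namespace PolyBdd

variable {f g : ℕ → ℕ}

lemma eval_mono (p : Polynomial ℕ) {m n : ℕ} (h : m ≤ n) : p.eval m ≤ p.eval n := by
  simp only [Polynomial.eval_eq_sum_range]
  gcongr

lemma of_le (h : PolyBdd g) (hfg : ∀ n, f n ≤ g n) : PolyBdd f := by
  obtain ⟨p, hp⟩ := h
  exact ⟨p, fun n => (hfg n).trans (hp n)⟩

lemma const (c : ℕ) : PolyBdd fun _ => c := ⟨.C c, fun n => by simp⟩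

lemma id : PolyBdd fun n => n := ⟨.X, fun n => by simp⟩

lemma add (hf : PolyBdd f) (hg : PolyBdd g) : PolyBdd fun n => f n + g n := by
  obtain ⟨p, hp⟩ := hf
  obtain ⟨q, hq⟩ := hg
  exact ⟨p + q, fun n => by rw [Polynomial.eval_add]; exact Nat.add_le_add (hp n) (hq n)⟩

lemma mul (hf : PolyBdd f) (hg : PolyBdd g) : PolyBdd fun n => f n * g n := by
  obtain ⟨p, hp⟩ := hf
  obtain ⟨q, hq⟩ := hg
  exact ⟨p * q, fun n => by rw [Polynomial.eval_mul]; exact Nat.mul_le_mul (hp n) (hq n)⟩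

lemma pow (hf : PolyBdd f) (e : ℕ) : PolyBdd fun n => f n ^ e := by
  obtain ⟨p, hp⟩ := hf
  exact ⟨p ^ e, fun n => by rw [Polynomial.eval_pow]; exact Nat.pow_le_pow_left (hp n) e⟩

lemma eval (p : Polynomial ℕ) (hf : PolyBdd f) : PolyBdd fun n => p.eval (f n) := by
  obtain ⟨q, hq⟩ := hf
  refine ⟨p.comp q, fun n => ?_⟩
  rw [Polynomial.eval_comp]
  exact eval_mono p (hq n)

lemma exists_monomial (hf : PolyBdd f) : ∃ c e : ℕ, ∀ n, 1 ≤ n → f n ≤ c * n ^ e := by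
  obtain ⟨p, hp⟩ := hf
  refine ⟨p.eval 1, p.natDegree, fun n hn => (hp n).trans ?_⟩
  simp only [Polynomial.eval_eq_sum_range, Finset.sum_mul, one_pow, mul_one]
  refine Finset.sum_le_sum fun i hi => Nat.mul_le_mul_left _ ?_
  exact Nat.pow_le_pow_right hn (Nat.lt_succ_iff.1 (Finset.mem_range.1 hi))

end PolyBdd

lemma odo_le (k : ℕ) : odo k ≤ 5 ^ (k + 1) := by
  have := two_mul_odo k
  omega

/-- An odometer of logarithmic depth runs for polynomial time. -/
lemma odo_log_le (m c₁ c₀ : ℕ) :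
    odo (c₁ * Nat.log 2 (m + 1) + c₀) ≤ 5 ^ (c₀ + 1) * (m + 1) ^ (3 * c₁) := by
  have h1 : 5 ^ Nat.log 2 (m + 1) ≤ (m + 1) ^ 3 :=
    calc 5 ^ Nat.log 2 (m + 1) ≤ 8 ^ Nat.log 2 (m + 1) := Nat.pow_le_pow_left (by norm_num) _
      _ = (2 ^ Nat.log 2 (m + 1)) ^ 3 := by
        rw [← pow_mul, mul_comm, pow_mul]
        norm_num
      _ ≤ (m + 1) ^ 3 := Nat.pow_le_pow_left (Nat.pow_log_le_self 2 (by omega)) _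
  calc odo (c₁ * Nat.log 2 (m + 1) + c₀)
      ≤ 5 ^ (c₁ * Nat.log 2 (m + 1) + c₀ + 1) := odo_le _
    _ = 5 ^ (c₀ + 1) * (5 ^ Nat.log 2 (m + 1)) ^ c₁ := by rw [← pow_mul]; ring
    _ ≤ 5 ^ (c₀ + 1) * ((m + 1) ^ 3) ^ c₁ := by gcongr
    _ = 5 ^ (c₀ + 1) * (m + 1) ^ (3 * c₁) := by rw [← pow_mul]

lemma polyBdd_odo {g : ℕ → ℕ} (hg : PolyBdd g) (c₁ c₀ : ℕ) :
    PolyBdd fun n => odo (c₁ * Nat.log 2 (g n + 1) + c₀) :=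
  ((PolyBdd.const _).mul ((hg.add (.const 1)).pow (3 * c₁))).of_le
    fun n => odo_log_le (g n) c₁ c₀

lemma polyBdd_advTime {g t : ℕ → ℕ} (hg : PolyBdd g) (ht : PolyBdd t) (c₁ c₀ h : ℕ) :
    PolyBdd fun n => advTime n (t n) (g n) (Nat.log 2 (g n + 1))
      (c₁ * Nat.log 2 (g n + 1) + c₀ + h) := by
  have h1 := polyBdd_odo hg c₁ (c₀ + h)
  have h2 : PolyBdd fun n => Nat.log 2 (g n + 1) :=
    (hg.add (.const 1)).of_le fun n => Nat.log_le_self _ _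
  have h3 : PolyBdd fun n => c₁ * Nat.log 2 (g n + 1) + c₀ + h :=
    (((PolyBdd.const c₁).mul h2).add (.const c₀)).add (.const h)
  simp only [advTime, add_assoc] at h1 h3 ⊢
  exact ((PolyBdd.const 2).mul .id).add (ht.add (((PolyBdd.const 12).mul hg).add
    (((PolyBdd.const 20).mul h2).add (((PolyBdd.const 24).mul h3).add
      (((PolyBdd.const 2).mul h1).add (.const 30))))))

/-! ### Obtaining advice -/

/-- With a suitable schedule, the collider is a coin with an arbitrary bias, up to a scale. -/
lemma exists_coin {ε u : ℝ} (hε : 0 < ε) (hu : 0 < u) :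
    ∃ (T : ℕ → ℕ) (h : ℕ), TimeConstructible T ∧ IsExponential T ∧ ∀ θ : ℝ, 0 < θ → θ ≤ 1 →
      ∃ E : Apparatus, E.precision = ε ∧ E.speed = u ∧
        E.outcomeLaw (T 1) [false] .lesser = ENNReal.ofReal (θ / 5 ^ h) := by
  -- With time limit above `1 / u`, a particle of small mass is seen in time.
  obtain ⟨K, hK⟩ := exists_nat_gt (1 / u)
  have hτ : 1 < u * (sched K 1 : ℕ) := by
    rw [div_lt_iff₀ hu] at hK
    have : (K : ℝ) ≤ (sched K 1 : ℕ) := by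
      exact_mod_cast (show K ≤ sched K 1 by rw [sched]; omega)
    nlinarith
  obtain ⟨η, hη, hE⟩ := exists_apparatus hε hu hτ
  obtain ⟨h, hh⟩ := pow_unbounded_of_one_lt (1 / η) (show (1 : ℝ) < 5 by norm_num)
  refine ⟨sched K, h, timeConstructible_sched K, isExponential_sched K, fun θ h0 h1 => ?_⟩
  refine hE _ (by positivity) ?_
  rw [div_lt_iff₀ hη] at hh
  rw [div_le_iff₀ (by positivity)]
  linarith

lemma outputWord_of_out {P : Prog (X ⊕ Ax) (Y ⊕ Aux)} [Finite X] [Finite Y] {r : Regs X Y}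
    {y : List Bool} (h : r.out = wtape y) {kin v : X ⊕ Ax} {st : MState}
    {a b : Sym ((Y ⊕ Aux) ⊕ P.Q)} :
    (toMachine P kin (.inr .out) v).outputWord (mcfg P kin (.inr .out) v st a b r.toStore) = y := by
  have hc (i : ℤ) : (mcfg P kin (.inr .out) v st a b r.toStore).cells (.inl (.inr .out)) i =
      tapeOfWord y i := by
    change (((r.toStore (.inr .out)).cells i).up : Sym ((Y ⊕ Aux) ⊕ P.Q)) = _
    simp only [Regs.toStore, h, wtape, up_tapeOfWord]
    rfl
  refine wordOfTape_eq (fun i hi => ?_) ?_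
  · refine (hc i).trans ?_
    simp [tapeOfWord, hi]
  · refine (congrArg Sym.toBit (hc y.length)).trans ?_
    rw [tapeOfWord_of_le le_rfl]
    rfl

/-- The words of a chain of linearly growing length can be obtained at logarithms. -/
theorem exists_obtains {ε u : ℝ} (hε : 0 < ε) (hu : 0 < u) {F : ℕ → List Bool}
    (hF : IsPrefixFunction F) {a b : ℕ} (hab : ∀ j, (F j).length ≤ a * j + b) {δ : ℝ}
    (hδ : 0 < δ) {pre : Prog (Empty ⊕ Ax) (Empty ⊕ Aux)} {g t : ℕ → ℕ} (hpre : Computes pre g t)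
    (hg : PolyBdd g) (ht : PolyBdd t) :
    ∃ (E : Apparatus) (T : ℕ → ℕ) (M : Machine), E.precision = ε ∧ E.speed = u ∧
      TimeConstructible T ∧ IsExponential T ∧
      M.ObtainsInPolyTime E T (fun n => F (Nat.log 2 (g n + 1))) δ := by
  obtain ⟨T, h, hT, hT', hE⟩ := exists_coin hε hu
  obtain ⟨θ, hθ, hθ', k, hk⟩ := exists_advice hF hab hδ
  obtain ⟨E, hE1, hE2, hE3⟩ := hE θ hθ hθ'.le
  obtain ⟨p, hp⟩ := ((PolyBdd.const (T 1 + 2)).mul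
    (polyBdd_advTime hg ht (2 * (a + 1)) k h)).add (.const 2)
  refine ⟨E, T, toMachine (advProg pre (2 * (a + 1)) k h) (.inr .inp) (.inr .out) (.inr .out),
    hE1, hE2, hT, hT', p, fun w => ?_⟩
  have h1 := hk hpre h (w := w) le_rfl le_rfl rfl rfl (Φ := fun σ d =>
    ((∃ r : Regs Empty Empty, r.out = wtape (F (Nat.log 2 (g w.length + 1))) ∧ σ = r.toStore) ∧
      0 ≤ d) ∨ 1 ≤ d) (fun r y d hr _ hy => by
        rcases hy with ⟨rfl, hd⟩ | hd
        · exact .inl ⟨⟨r, hr.out_eq, rfl⟩, hd⟩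
        · exact .inr hd)
  obtain ⟨h2, h3⟩ := toMachine_spec (kout := .inr .out) (v := .inr .out) (T := T)
    (R := fun c => Machine.outputWord _ c = F (Nat.log 2 (g w.length + 1))) hE3 (by positivity) (by
      rw [div_le_one (by positivity)]
      exact hθ'.le.trans (one_le_pow₀ (by norm_num))) (by
      rintro _ x y ⟨r, hr, rfl⟩
      exact outputWord_of_out hr) h1
  refine ⟨fun o => ?_, h3⟩
  obtain ⟨n, hn, hB⟩ := h2 o
  exact ⟨n, hn, hB.trans (hp _)⟩

lemma log_two_mul_pred (n : ℕ) : Nat.log 2 (2 * (n - 1) + 1) = Nat.clog 2 n := by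
  rcases le_or_gt n 1 with h | h
  · rw [Nat.clog_of_right_le_one h, show n - 1 = 0 by omega]
    rfl
  · have h1 := Nat.le_pow_clog (b := 2) one_lt_two n
    have h2 := Nat.pow_pred_clog_lt_self (b := 2) one_lt_two h
    have h3 := Nat.clog_pos (b := 2) one_lt_two h
    obtain ⟨c, hc⟩ : ∃ c, Nat.clog 2 n = c + 1 := ⟨Nat.clog 2 n - 1, by omega⟩
    rw [hc] at h1 h2 ⊢
    rw [Nat.log_eq_iff (.inl (by omega))]
    simp only [Nat.pred_eq_sub_one, Nat.add_sub_cancel] at h2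
    rw [pow_succ] at h1
    rw [pow_succ, pow_succ]
    omega

lemma IsPrefixFunction.prefix_of_le {f : ℕ → List Bool} (hf : IsPrefixFunction f) {m n : ℕ}
    (h : m ≤ n) : f m <+: f n := by
  induction n, h using Nat.le_induction with
  | base => exact List.prefix_rfl
  | succ n _ ih => exact ih.trans (hf n)

lemma IsPrefixFunction.eq_of_length_eq {f : ℕ → List Bool} (hf : IsPrefixFunction f) {m n : ℕ}
    {v w : List Bool} (hv : v <+: f m) (hw : w <+: f n) (h : v.length = w.length) : v = w := by
  have h1 := hv.trans (hf.prefix_of_le (le_max_left m n))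
  have h2 := hw.trans (hf.prefix_of_le (le_max_right m n))
  exact (List.prefix_of_prefix_length_le h1 h2 h.le).eq_of_length h

/-- Advice of logarithmic size, sampled at the powers of two, has linear size. -/
lemma IsLogAdvice.two_pow {f : ℕ → List Bool} (hf : IsLogAdvice f) :
    ∃ a b : ℕ, ∀ j, (f (2 ^ j)).length ≤ a * j + b := by
  obtain ⟨a, b, h⟩ := hf
  refine ⟨a, b, fun j => ?_⟩
  have := h (2 ^ j)
  rwa [Nat.log_pow one_lt_two] at this

lemma IsPrefixFunction.two_pow {f : ℕ → List Bool} (hf : IsPrefixFunction f) :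
    IsPrefixFunction fun j => f (2 ^ j) :=
  fun j => hf.prefix_of_le (Nat.pow_le_pow_right two_pos j.le_succ)

lemma polyBdd_double : PolyBdd fun n => 2 * (n - 1) :=
  ((PolyBdd.const 2).mul .id).of_le fun _ => Nat.mul_le_mul_left _ (Nat.sub_le _ _)

lemma polyBdd_double_time : PolyBdd fun n => 3 * n + 2 :=
  ((PolyBdd.const 3).mul .id).add (.const 2)

theorem exists_obtains_clog {ε u : ℝ} (hε : 0 < ε) (hu : 0 < u) {f : ℕ → List Bool}
    (hf : IsPrefixFunction f) (hf' : IsLogAdvice f) {δ : ℝ} (hδ : 0 < δ) :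
    ∃ (E : Apparatus) (T : ℕ → ℕ) (M : Machine), E.precision = ε ∧ E.speed = u ∧
      TimeConstructible T ∧ IsExponential T ∧
      M.ObtainsInPolyTime E T (fun n => f (2 ^ Nat.clog 2 n)) δ := by
  obtain ⟨a, b, hab⟩ := hf'.two_pow
  have := exists_obtains hε hu hf.two_pow hab hδ computes_doubleProg polyBdd_double
    polyBdd_double_time
  simpa only [log_two_mul_pred] using this

/-- If the length of the advice is known, then it is found by truncation: `f n` consists of the
first `J + b` letters of `f (2 ^ J)`, where `J` is the logarithm of `n ^ a`. -/
theorem exists_obtains_exact {ε u : ℝ} (hε : 0 < ε) (hu : 0 < u) {f : ℕ → List Bool}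
    (hf : IsPrefixFunction f) (hf' : HasExactLogLength f) {δ : ℝ} (hδ : 0 < δ) :
    ∃ (E : Apparatus) (T : ℕ → ℕ) (M : Machine), E.precision = ε ∧ E.speed = u ∧
      TimeConstructible T ∧ IsExponential T ∧ M.ObtainsInPolyTime E T f δ := by
  obtain ⟨a, b, h⟩ := hf'
  have hF : IsPrefixFunction fun j => (f (2 ^ j)).take (j + b) := fun j => by
    rw [List.prefix_take_iff]
    exact ⟨(List.take_prefix _ _).trans (hf.two_pow j), by simp⟩
  have hFf (n : ℕ) : (f (2 ^ Nat.log 2 (n ^ a - 1 + 1))).take (Nat.log 2 (n ^ a - 1 + 1) + b) =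
      f n := by
    have hJ : Nat.log 2 (n ^ a - 1 + 1) = Nat.log 2 (n ^ a) := by
      rcases Nat.eq_zero_or_pos (n ^ a) with h0 | h0
      · simp [h0]
      · rw [Nat.sub_add_cancel h0]
    rw [hJ]
    refine hf.eq_of_length_eq (List.take_prefix _ _) List.prefix_rfl ?_
    rw [List.length_take, h, h, ← pow_mul, Nat.log_pow one_lt_two]
    rcases a with _ | a
    · simp
    · have := Nat.le_mul_of_pos_right (Nat.log 2 (n ^ (a + 1))) (Nat.succ_pos a)
      simp only [Nat.succ_eq_add_one] at this
      omega
  have := exists_obtains hε hu hF (a := 1) (b := b) (fun j => by simp) hδ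
    (computes_powProg a) (((PolyBdd.id).pow a).of_le fun n => Nat.sub_le _ _)
    (((PolyBdd.const a).mul (((((PolyBdd.id).add (.const 1)).pow a).mul
      (((PolyBdd.const 7).mul .id).add (.const 6))).add (.const 2))).add (.const 3))
  simpa only [hFf] using this

/-! ### Writing a pair of words -/

section Words

variable {K S : Type} [DecidableEq K]

/-- Move the head of the tape `k`. -/
def mvAt (k : K) (m : Move) : Prog K S := Prog.atom fun σ _ i => (σ i, if i = k then m else .stay)

/-- Write a bit on the tape `k`. -/
def putAt (k : K) (b : Bool) : Prog K S :=
  Prog.atom fun σ _ i => if i = k then (.bit b, .right) else (σ i, .stay)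

/-- Write the symbol scanned on the tape `k` on the tape `l`. -/
def copyAt (k l : K) : Prog K S :=
  Prog.atom fun σ _ i => if i = l then (σ k, .right) else (σ i, .stay)

lemma dtr_mvAt (s : Store K S) (k : K) (m : Move) :
    DTr (mvAt k m) s 1 (Function.update s k ((s k).go m)) := DTr.atom fun c => by
  funext i
  simp only [Store.act, Store.scan, Tp.act_read, Function.update_apply]
  split_ifs with h
  · rw [h]
  · rw [Tp.go_stay]

lemma dtr_putAt {s : Store K S} {k : K} {z : List Bool} (h : s k = wtape z) (b : Bool) :
    DTr (putAt k b) s 1 (Function.update s k (wtape (z ++ [b]))) := DTr.atom fun c => by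
  funext i
  simp only [Store.act, Store.scan, Function.update_apply]
  split_ifs with hi
  · rw [hi, h, wtape_act]
  · rw [Tp.act_read, Tp.go_stay]

lemma dtr_copyAt {s : Store K S} {k l : K} {z : List Bool} {b : Bool} (h : s l = wtape z)
    (hk : (s k).read = .bit b) :
    DTr (copyAt k l) s 1 (Function.update s l (wtape (z ++ [b]))) := DTr.atom fun c => by
  funext i
  simp only [Store.act, Store.scan, Function.update_apply]
  split_ifs with hi
  · rw [hi, hk, h, wtape_act]
  · rw [Tp.act_read, Tp.go_stay]

/-- Move the head from the end of a word to its beginning. -/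
def backProg (k : K) : Prog K S :=
  (mvAt k .left).seq ((Prog.loop (fun σ => !isBlank (σ k)) (mvAt k .left)).seq (mvAt k .right))

lemma dtr_backProg {s : Store K S} {k : K} {z : List Bool} (h : s k = wtape z) :
    DTr (backProg k) s (2 * z.length + 3) (Function.update s k ⟨tapeOfWord z, 0⟩) := by
  have h1 := dtr_mvAt s k .left
  have h2 := DTr.loop_iterate (b := fun σ => !isBlank (σ k)) (P := mvAt k .left) (τ := 1)
    (n := z.length) (fun i => Function.update s k ⟨tapeOfWord z, z.length - 1 - i⟩)
    (fun i hi => by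
      obtain ⟨b, hb⟩ := tapeOfWord_of_lt (S := S) (w := z) (i := z.length - 1 - i) (by omega)
        (by omega)
      simp [Store.scan, Tp.read, hb, isBlank])
    (fun i hi => by
      have := dtr_mvAt (Function.update s k ⟨tapeOfWord z, z.length - 1 - i⟩) k .left
      rw [Function.update_idem, Function.update_self] at this
      convert! this using 2
      simp [Tp.go, Move.shift]
      ring)
    (by
      have : (tapeOfWord z (z.length - 1 - z.length) : Sym S) = .blank :=
        tapeOfWord_of_neg (by omega)
      simp [Store.scan, Tp.read, isBlank]
      rw [show (z.length - 1 - z.length : ℤ) = -1 by ring] at this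
      rw [this])
  have h3 := dtr_mvAt (Function.update s k ⟨tapeOfWord z, z.length - 1 - z.length⟩) k .right
  have e1 : (s k).go .left = ⟨tapeOfWord z, z.length - 1 - (0 : ℕ)⟩ := by
    rw [h]; simp [Tp.go, wtape, Move.shift, sub_eq_add_neg]
  have e2 : (⟨tapeOfWord z, z.length - 1 - z.length⟩ : Tp S).go .right = ⟨tapeOfWord z, 0⟩ := by
    simp [Tp.go, Move.shift]
  rw [e1] at h1
  rw [Function.update_idem, Function.update_self, e2] at h3
  exact (h1.seq (h2.seq h3)).mono_time (by omega)

/-- Append the word on the tape `k`, with its bits duplicated, to the word on the tape `l`. -/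
def dupProg (k l : K) : Prog K S := Prog.loop (fun σ => !isBlank (σ k))
  ((copyAt k l).seq ((copyAt k l).seq (mvAt k .right)))

lemma dtr_dupProg {s : Store K S} {k l : K} (hkl : k ≠ l) {w z : List Bool}
    (hk : s k = ⟨tapeOfWord w, 0⟩) (hl : s l = wtape z) :
    DTr (dupProg k l) s (4 * w.length + 1) (Function.update
      (Function.update s k ⟨tapeOfWord w, w.length⟩) l
      (wtape (z ++ w.flatMap fun b => [b, b]))) := by
  have h1 := DTr.loop_iterate (b := fun σ => !isBlank (σ k))
    (P := (copyAt k l).seq ((copyAt k l).seq (mvAt k .right))) (τ := 3) (n := w.length)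
    (fun i => Function.update (Function.update s k ⟨tapeOfWord w, i⟩) l
      (wtape (z ++ (w.take i).flatMap fun b => [b, b])))
    (fun i hi => by
      obtain ⟨b, hb⟩ := tapeOfWord_of_lt (S := S) (w := w) (i := i) (by omega) (by omega)
      simp [Store.scan, Tp.read, hb, isBlank, Function.update_of_ne hkl])
    (fun i hi => by
      have hb : (tapeOfWord w i : Sym S) = .bit w[i] := by simp [tapeOfWord, hi]
      have d1 := dtr_copyAt (s := Function.update (Function.update s k ⟨tapeOfWord w, i⟩) l
        (wtape (z ++ (w.take i).flatMap fun b => [b, b]))) (k := k) (l := l) (b := w[i])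
        (Function.update_self _ _ _)
        (by rw [Function.update_of_ne hkl, Function.update_self]; exact hb)
      rw [Function.update_idem] at d1
      have d2 := dtr_copyAt (s := Function.update (Function.update s k ⟨tapeOfWord w, i⟩) l
        (wtape (z ++ ((w.take i).flatMap fun b => [b, b]) ++ [w[i]]))) (k := k) (l := l) (b := w[i])
        (Function.update_self _ _ _)
        (by rw [Function.update_of_ne hkl, Function.update_self]; exact hb)
      rw [Function.update_idem] at d2
      have d3 := dtr_mvAt (Function.update (Function.update s k ⟨tapeOfWord w, i⟩) l
        (wtape (z ++ ((w.take i).flatMap fun b => [b, b]) ++ [w[i]] ++ [w[i]]))) k .right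
      convert! d1.seq (d2.seq d3) using 1
      rw [Function.update_of_ne hkl, Function.update_self, Function.update_comm hkl.symm,
        Function.update_idem]
      have ht : ((w.take (i + 1)).flatMap fun b => [b, b]) =
          ((w.take i).flatMap fun b => [b, b]) ++ [w[i], w[i]] := by
        rw [List.take_succ_eq_append_getElem hi, List.flatMap_append, List.flatMap_singleton]
      rw [ht]
      simp [Tp.go, Move.shift])
    (by simp [Store.scan, Tp.read, isBlank, Function.update_of_ne hkl, tapeOfWord_of_le])
  have e1 : Function.update (Function.update s k ⟨tapeOfWord w, (0 : ℕ)⟩) l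
      (wtape (z ++ (w.take 0).flatMap fun b => [b, b])) = s := by
    rw [Function.update_eq_self_iff.2, Function.update_eq_self_iff.2]
    · exact hk.symm
    · rw [Function.update_of_ne hkl.symm, hl]; simp
  rw [e1, List.take_length] at h1
  exact h1.mono_time (by omega)

end Words

/-- Write the pair of the input and the advice on the tape `x`, and start the clock. -/
def pairProg [DecidableEq X] (x : X) : Prog (X ⊕ Ax) (Y ⊕ Aux) :=
  (backProg (.inr .inp)).seq ((backProg (.inr .out)).seq ((dupProg (.inr .inp) (.inl x)).seq
  ((putAt (.inl x) false).seq ((putAt (.inl x) true).seq ((dupProg (.inr .out) (.inl x)).seq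
  ((backProg (.inl x)).seq (mvAt (.inr .clk) .right)))))))

lemma dtr_pairProg [DecidableEq X] (x : X) {r : Regs X Y} {w y : List Bool} {s : ℕ}
    (h : AfterAdv r w y s) : ∃ σ : Store (X ⊕ Ax) (Y ⊕ Aux),
      DTr (pairProg x) r.toStore (10 * (w.length + y.length) + 20) σ ∧
      (∀ k, σ (.inl k) = if k = x then ⟨tapeOfWord (pair w y), 0⟩ else Tp.blank) ∧
      σ (.inr .clk) = ⟨mcells s, 1⟩ ∧ σ (.inr .bus) = Tp.blank := by
  have h0 : (Tp.blank : Tp (Y ⊕ Aux)) = wtape [] := by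
    ext <;> simp [Tp.blank, wtape, tapeOfWord]
  have e1 := dtr_backProg (s := r.toStore) (k := .inr .inp) (z := w) h.inp_eq
  have e2 := dtr_backProg (k := .inr .out) (z := y)
    (s := Function.update r.toStore (.inr .inp) ⟨tapeOfWord w, 0⟩)
    (by simp [Regs.toStore, h.out_eq])
  set s2 := Function.update (Function.update r.toStore (.inr .inp) ⟨tapeOfWord w, 0⟩) (.inr .out)
    ⟨tapeOfWord y, 0⟩ with hs2
  have e3 := dtr_dupProg (s := s2) (k := .inr .inp) (l := .inl x) (by simp) (w := w) (z := [])
    (by simp [hs2]) (by simp [hs2, Regs.toStore, h.x_eq, h0])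
  set s3 := Function.update (Function.update s2 (.inr .inp) ⟨tapeOfWord w, w.length⟩) (.inl x)
    (wtape ([] ++ w.flatMap fun b => [b, b])) with hs3
  have e4 := dtr_putAt (s := s3) (k := .inl x) (Function.update_self _ _ _) false
  set s4 := Function.update s3 (.inl x)
    (wtape ([] ++ (w.flatMap fun b => [b, b]) ++ [false])) with hs4
  have e5 := dtr_putAt (s := s4) (k := .inl x) (Function.update_self _ _ _) true
  set s5 := Function.update s4 (.inl x)
    (wtape ([] ++ (w.flatMap fun b => [b, b]) ++ [false] ++ [true])) with hs5
  have e6 := dtr_dupProg (s := s5) (k := .inr .out) (l := .inl x) (by simp) (w := y)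
    (by simp [hs5, hs4, hs3, hs2]) (Function.update_self _ _ _)
  have hp : [] ++ (w.flatMap fun b => [b, b]) ++ [false] ++ [true] ++ (y.flatMap fun b => [b, b]) =
      pair w y := by simp [pair]
  rw [hp] at e6
  set s6 := Function.update (Function.update s5 (.inr .out) ⟨tapeOfWord y, y.length⟩) (.inl x)
    (wtape (pair w y)) with hs6
  have e7 := dtr_backProg (s := s6) (k := .inl x) (Function.update_self _ _ _)
  set s7 := Function.update s6 (.inl x) ⟨tapeOfWord (pair w y), 0⟩ with hs7
  have e8 := dtr_mvAt s7 (.inr .clk) .right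
  refine ⟨_, (e1.seq (e2.seq (e3.seq (e4.seq (e5.seq (e6.seq (e7.seq e8))))))).mono_time ?_,
    fun k => ?_, ?_, ?_⟩
  · have : (pair w y).length = 2 * w.length + 2 + 2 * y.length := by
      simp [pair, List.length_flatMap]; ring
    omega
  · split_ifs with hk
    · subst hk
      simp [hs7]
    · have hk' : (Sum.inl k : X ⊕ Ax) ≠ .inl x := by simpa using hk
      simp [hs7, hs6, hs5, hs4, hs3, hs2, Function.update_of_ne hk', Regs.toStore, h.x_eq]
  · simp [hs7, hs6, hs5, hs4, hs3, hs2, Regs.toStore, h.clk_eq]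
    simp [Tp.go, Move.shift]
  · simp [hs7, hs6, hs5, hs4, hs3, hs2, Regs.toStore, h.bus_eq]

end Programs

/-! ### Simulating a probabilistic machine -/

section Simulate

variable (M : TM Bool)

/-- Simulate `M`. Each step takes a fair bit, which is extracted from a pair of tosses of the biased
coin: if the two tosses differ, the first one is fair; otherwise the pair is discarded. The first
toss of a pair is kept in the control state. The simulation ends when the odometer `clk` reaches the
end marker, and the verdict is then written on the tape `bus`. -/
def simProg : Prog (M.Tape ⊕ Ax) (M.Extra ⊕ Aux) where
  Q := M.State × Option Bool
  finite_state := by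
    have := M.finite_state
    infer_instance
  entry := (M.start, none)
  trans := fun q σ c =>
    if isLend (σ (.inr .clk)) then
      (none, Sum.elim (fun k => (σ (.inl k), .stay)) (fun k =>
        if k = .bus then (.bit (M.halt q.1 == some true), .stay) else (σ (.inr k), .stay)))
    else
      let idle : M.Tape ⊕ Ax → Sym (M.Extra ⊕ Aux) × Move :=
        Sum.elim (fun k => (σ (.inl k), .stay))
          (fun k => if k = .clk then tick (σ (.inr .clk)) else (σ (.inr k), .stay))
      match q.2 with
      | none => (some (q.1, some c), idle)
      | some c' =>
        if c = c' ∨ (M.halt q.1).isSome then (some (q.1, none), idle)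
        else
          let r := M.trans q.1 (fun k => (σ (.inl k)).down) c'
          (some (r.1, none), Sum.elim (fun k => ((r.2 k).1.up, (r.2 k).2)) (fun k => idle (.inr k)))

/-- The store in which the tapes of `M` are as in the configuration `c`. -/
def simStore (c : M.Cfg) (clk : Tp (M.Extra ⊕ Aux)) (r : Ax → Tp (M.Extra ⊕ Aux)) :
    Store (M.Tape ⊕ Ax) (M.Extra ⊕ Aux) :=
  Sum.elim (fun k => ⟨fun i => (c.cells k i).up, c.head k⟩) (Function.update r .clk clk)

variable {M}

lemma simStore_idle (c : M.Cfg) (clk : Tp (M.Extra ⊕ Aux)) (r : Ax → Tp (M.Extra ⊕ Aux)) :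
    (simStore M c clk r).act (Sum.elim (fun k => ((simStore M c clk r).scan (.inl k), .stay))
      (fun k => if k = .clk then tick ((simStore M c clk r).scan (.inr .clk))
        else ((simStore M c clk r).scan (.inr k), .stay))) = simStore M c clk.tick r := by
  funext k
  rcases k with k | k
  · simp [Store.act, Store.scan, simStore]
  · by_cases hk : k = .clk
    · subst hk; simp [Store.act, Store.scan, simStore, Tp.tick]
    · simp [Store.act, Store.scan, simStore, hk]

lemma simStore_down (c : M.Cfg) (clk : Tp (M.Extra ⊕ Aux)) (r : Ax → Tp (M.Extra ⊕ Aux)) :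
    (fun k => ((simStore M c clk r).scan (.inl k)).down) = fun k => c.cells k (c.head k) := by
  funext k
  simp [Store.scan, simStore, Tp.read]

lemma simStore_move (c : M.Cfg) (clk : Tp (M.Extra ⊕ Aux)) (r : Ax → Tp (M.Extra ⊕ Aux))
    (a : Bool) : (simStore M c clk r).act (Sum.elim
      (fun k =>
        (((M.trans c.state (fun k => ((simStore M c clk r).scan (.inl k)).down) a).2 k).1.up,
        ((M.trans c.state (fun k => ((simStore M c clk r).scan (.inl k)).down) a).2 k).2))
      (fun k => if k = .clk then tick ((simStore M c clk r).scan (.inr .clk))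
        else ((simStore M c clk r).scan (.inr k), .stay))) =
      simStore M (M.move c a) clk.tick r := by
  rw [simStore_down]
  funext k
  rcases k with k | k
  · ext i
    · simp only [Store.act, simStore, Sum.elim_inl, Tp.act, TM.move, Function.update_apply]
      split_ifs <;> rfl
    · rfl
  · by_cases hk : k = .clk
    · subst hk; simp [Store.act, Store.scan, simStore, Tp.tick]
    · simp [Store.act, Store.scan, simStore, hk]

/-- The probability that the verdict is not `b` when `m` tosses are still to be made in the
simulation; `ρ` is the probability of each of the results `true, false` and `false, true` of two
tosses. -/
noncomputable def simErr (M : TM Bool) (ρ : ℝ) (b : Bool) : ℕ → M.Cfg → ℝ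
  | 0, c | 1, c => if (M.halt c.state == some true) = b then 0 else 1
  | m + 2, c => (1 - 2 * ρ) * simErr M ρ b m c +
      ρ * (simErr M ρ b m (M.next c true) + simErr M ρ b m (M.next c false))

lemma simErr_bounds {ρ : ℝ} (h0 : 0 ≤ ρ) (h1 : 2 * ρ ≤ 1) (b : Bool) :
    ∀ (m : ℕ) (c : M.Cfg), 0 ≤ simErr M ρ b m c ∧ simErr M ρ b m c ≤ 1
  | 0, c | 1, c => by simp only [simErr]; split_ifs <;> simp
  | m + 2, c => by
    obtain ⟨a1, a2⟩ := simErr_bounds h0 h1 b m c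
    obtain ⟨b1, b2⟩ := simErr_bounds h0 h1 b m (M.next c true)
    obtain ⟨c1, c2⟩ := simErr_bounds h0 h1 b m (M.next c false)
    rw [simErr]
    have h2 : 0 ≤ 1 - 2 * ρ := by linarith
    constructor
    · positivity
    · nlinarith

/-- The simulation of `M` on the input `z` gives the verdict `b` except with the probability
`simErr`. -/
lemma tr_simProg {s : ℕ} {r : Ax → Tp (M.Extra ⊕ Aux)} {p : ℝ} (b : Bool) {z : List Bool} :
    Tr (simProg M) p (fun σ d => (σ.scan (.inr .bus) = .bit b ∧ 0 ≤ d) ∨ 1 ≤ d)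
      (simStore M (M.init z) ⟨mcells s, 1⟩ r) (odo s + 1)
      (simErr M (p * (1 - p)) b (odo s) (M.init z)) := by
  set Φ : Store (M.Tape ⊕ Ax) (M.Extra ⊕ Aux) → ℝ → Prop :=
    fun σ d => (σ.scan (.inr .bus) = .bit b ∧ 0 ≤ d) ∨ 1 ≤ d with hΦ
  -- The odometer is at rest, and the verdict is written.
  have hend (q : M.State × Option Bool) (c : M.Cfg) (d : ℝ)
      (hd : d = if (M.halt q.1 == some true) = b then 0 else 1) :
      Ev (simProg M) p Φ (some q) (simStore M c (Tp.tick^[odo s] ⟨mcells s, 1⟩) r) 1 d := by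
    have hf := tick_full s _ _ (ready_mcells (Y := M.Extra) s)
    rw [reset_mcells, sub_self] at hf
    rw [hf]
    have hl : isLend ((simStore M c ⟨mcells s, 0⟩ r).scan (.inr .clk)) = true := by
      simp [Store.scan, simStore, Tp.read, mcells_zero, isLend_iff]
    refine .step (fun _ => d) (fun a => ?_) (by linarith)
    simp only [simProg, if_pos hl]
    refine .done ?_
    rw [hd]
    split_ifs with h
    · refine .inl ⟨?_, le_rfl⟩
      simp [Store.scan, Store.act, Tp.act, Tp.read, Move.shift, h]
    · exact .inr le_rfl
  have hrun (m : ℕ) (hm : m < odo s) (c : M.Cfg) :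
      isLend ((simStore M c (Tp.tick^[m] ⟨mcells s, 1⟩) r).scan (.inr .clk)) = false := by
    rw [← Bool.not_eq_true, isLend_iff]
    simpa [Store.scan, simStore] using
      read_tick_ne_lend (ready_mcells s) (fun i hi => mcells_ne_lend s hi) hm
  have hidle (m : ℕ) (c : M.Cfg) := simStore_idle c (Tp.tick^[m] ⟨mcells s, 1⟩) r
  have hmove (m : ℕ) (c : M.Cfg) := simStore_move c (Tp.tick^[m] ⟨mcells s, 1⟩) r
  simp only [← Function.iterate_succ_apply' Tp.tick] at hidle hmove
  have key : ∀ (m : ℕ), m ≤ odo s → ∀ c : M.Cfg, Ev (simProg M) p Φ (some (c.state, none))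
      (simStore M c (Tp.tick^[odo s - m] ⟨mcells s, 1⟩) r) (m + 1)
      (simErr M (p * (1 - p)) b m c) := by
    intro m
    induction m using Nat.twoStepInduction with
    | zero => exact fun _ c => hend _ c _ rfl
    | one =>
      intro hm c
      refine .step (fun _ => simErr M (p * (1 - p)) b 1 c) (fun a => ?_) (by linarith)
      simp only [simProg, hrun (odo s - 1) (by omega) c, Bool.false_eq_true, if_false]
      rw [hidle, show (odo s - 1).succ = odo s by omega]
      exact hend _ c _ rfl
    | more m ih _ =>
      intro hm c
      have ih := ih (by omega)
      -- The mean of the error after the first toss `a` of the pair.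
      refine .step (fun a => if a
        then p * simErr M (p * (1 - p)) b m c +
          (1 - p) * simErr M (p * (1 - p)) b m (M.next c true)
        else p * simErr M (p * (1 - p)) b m (M.next c false) +
          (1 - p) * simErr M (p * (1 - p)) b m c)
        (fun a => ?_) (le_of_eq ?_)
      · simp only [simProg, hrun (odo s - (m + 2)) (by omega) c, Bool.false_eq_true, if_false]
        rw [hidle, show (odo s - (m + 2)).succ = odo s - (m + 1) by omega]
        refine .step (fun a' => if a' = a then simErr M (p * (1 - p)) b m c
          else simErr M (p * (1 - p)) b m (M.next c a)) (fun a' => ?_) (by cases a <;> simp)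
        simp only [hrun (odo s - (m + 1)) (by omega) c, Bool.false_eq_true, if_false]
        have hsucc : (odo s - (m + 1)).succ = odo s - m := by omega
        by_cases ha : a' = a
        · simp only [ha, true_or, if_true]
          rw [hidle, hsucc]
          exact ih c
        · by_cases hc : (M.halt c.state).isSome
          · simp only [ha, hc, or_true, if_true, if_false]
            have hn : M.next c a = c := by rw [TM.next, if_pos (show M.Halted c from hc)]
            rw [hidle, hsucc, hn]
            exact ih c
          · have hn : M.next c a = M.move c a := by rw [TM.next, if_neg (show ¬ M.Halted c from hc)]
            simp only [ha, hc, Bool.false_eq_true, or_self, if_false, Sum.elim_inr]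
            rw [hmove, simStore_down, hsucc, hn]
            exact ih (M.move c a)
      · rw [simErr]
        simp only [if_true, Bool.false_eq_true, if_false]
        ring
  have := key (odo s) le_rfl (M.init z)
  rwa [Nat.sub_self] at this

/-- All computations from `c` have halted after `j` steps. -/
def HaltsBy (M : TM Bool) : ℕ → M.Cfg → Prop
  | 0, c => M.Halted c
  | j + 1, c => ∀ a, HaltsBy M j (M.next c a)

open Classical in
/-- The probability of the verdict `b` after `j` steps with fair coins. -/
noncomputable def fairProb (M : TM Bool) (b : Bool) : ℕ → M.Cfg → ℝ
  | 0, c => if M.halt c.state = some b then 1 else 0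
  | j + 1, c => (fairProb M b j (M.next c true) + fairProb M b j (M.next c false)) / 2

lemma fairProb_nonneg (b : Bool) : ∀ (j : ℕ) (c : M.Cfg), 0 ≤ fairProb M b j c
  | 0, c => by rw [fairProb]; split_ifs <;> simp
  | j + 1, c => by
    have h1 := fairProb_nonneg b j (M.next c true)
    have h2 := fairProb_nonneg b j (M.next c false)
    rw [fairProb]; positivity

/-- The simulation of `j` fair steps fails to be complete after `t` pairs of tosses with
exponentially small probability. The bound `2 ^ j * (1 - ρ) ^ t` is preserved by the recursion,
since `(1 - 2 ρ) 2 ^ (j + 1) + 2 ρ 2 ^ j = (1 - ρ) 2 ^ (j + 1)`. -/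
lemma simErr_le {ρ : ℝ} (h0 : 0 ≤ ρ) (h1 : 2 * ρ ≤ 1) (b : Bool) : ∀ (t j : ℕ) (c : M.Cfg),
    HaltsBy M j c → ∀ e < 2,
      simErr M ρ b (2 * t + e) c ≤ fairProb M (!b) j c + 2 ^ j * (1 - ρ) ^ t
  | t, 0, c, h, e, he => by
    have hh : ∀ m, simErr M ρ b m c = if (M.halt c.state == some true) = b then 0 else 1 := by
      intro m
      induction m using Nat.twoStepInduction with
      | zero => rw [simErr]
      | one => rw [simErr]
      | more m ih _ =>
        have h' : M.Halted c := h
        rw [simErr, TM.next, TM.next, if_pos h', if_pos h', ih]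
        ring
    have h2 : 0 ≤ 1 - ρ := by linarith
    have h3 : 0 ≤ (1 - ρ) ^ t := by positivity
    obtain ⟨v, hv⟩ := Option.isSome_iff_exists.1 h
    rw [hh, fairProb, hv]
    cases v <;> cases b <;> simp <;> linarith
  | 0, j + 1, c, h, e, he => by
    have h3 := (simErr_bounds h0 h1 b (2 * 0 + e) c).2
    have h4 := fairProb_nonneg (!b) (j + 1) c
    have h5 : (1 : ℝ) ≤ 2 ^ (j + 1) := one_le_pow₀ (by norm_num)
    simp only [pow_zero, mul_one]
    linarith
  | t + 1, j + 1, c, h, e, he => by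
    have i1 := simErr_le h0 h1 b t (j + 1) c h e he
    have i2 := simErr_le h0 h1 b t j (M.next c true) (h true) e he
    have i3 := simErr_le h0 h1 b t j (M.next c false) (h false) e he
    rw [show 2 * (t + 1) + e = 2 * t + e + 2 by ring, simErr]
    have h2 : 0 ≤ 1 - 2 * ρ := by linarith
    calc _ ≤ (1 - 2 * ρ) * (fairProb M (!b) (j + 1) c + 2 ^ (j + 1) * (1 - ρ) ^ t) +
          ρ * ((fairProb M (!b) j (M.next c true) + 2 ^ j * (1 - ρ) ^ t) +
            (fairProb M (!b) j (M.next c false) + 2 ^ j * (1 - ρ) ^ t)) := by gcongr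
      _ = _ := by rw [fairProb, pow_succ (1 - ρ), pow_succ (2 : ℝ)]; ring

lemma run_congr {x : List Bool} {r r' : ℕ → Bool} : ∀ {i : ℕ}, (∀ k < i, r k = r' k) →
    M.run x r i = M.run x r' i
  | 0, _ => rfl
  | i + 1, h => by
    rw [TM.run, TM.run, run_congr (i := i) fun k hk => h k (by omega), h i (by omega)]

/-- A bound for the halting times on all coin sequences can be turned into an inductive statement,
since the part of the sequence that has not been read is arbitrary. -/
lemma haltsBy_run {x : List Bool} : ∀ (j i : ℕ), (∀ r, M.Halted (M.run x r (i + j))) →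
    ∀ r, HaltsBy M j (M.run x r i)
  | 0, _, h, r => h r
  | j + 1, i, h, r => fun a => by
    have h1 : M.run x (Function.update r i a) i = M.run x r i :=
      run_congr fun k hk => Function.update_of_ne (by omega) _ _
    have h2 := haltsBy_run j (i + 1) (fun r => by rw [add_assoc, add_comm 1]; exact h r)
      (Function.update r i a)
    rwa [TM.run, h1, Function.update_self] at h2

lemma halted_run_mono {x : List Bool} {r : ℕ → Bool} {i j : ℕ} (hij : i ≤ j)
    (h : M.Halted (M.run x r i)) : M.Halted (M.run x r j) := by
  induction j, hij using Nat.le_induction with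
  | base => exact h
  | succ j _ ih => rw [TM.run, TM.next, if_pos ih]; exact ih

lemma Clocked.haltsBy {p : Polynomial ℕ} (h : Clocked M p) (x : List Bool) :
    HaltsBy M (p.eval x.length) (M.init x) :=
  haltsBy_run _ 0 (fun r => by
    obtain ⟨t, ht, h'⟩ := h x r
    exact halted_run_mono (by omega) h') fun _ => true

lemma ofReal_fairProb (b : Bool) : ∀ (j : ℕ) (c : M.Cfg), ENNReal.ofReal (fairProb M b j c) =
    (evolve (fun c => (PMF.uniformOfFintype Bool).map (M.next c)) c j).toOuterMeasure
      {c | M.halt c.state = some b}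
  | 0, c => by
    classical
    rw [fairProb, evolve, PMF.toOuterMeasure_pure_apply]
    simp only [Set.mem_ofPred_eq]
    split_ifs <;> simp
  | j + 1, c => by
    have h1 := fairProb_nonneg b j (M.next c true)
    have h2 := fairProb_nonneg b j (M.next c false)
    rw [fairProb, evolve_succ, PMF.bind_map, PMF.toOuterMeasure_bind_apply, tsum_fintype,
      Fintype.sum_bool]
    simp only [PMF.uniformOfFintype_apply, Fintype.card_bool, Function.comp]
    rw [← ofReal_fairProb b j, ← ofReal_fairProb b j, ← mul_add, ← ENNReal.ofReal_add h1 h2,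
      div_eq_inv_mul, ENNReal.ofReal_mul (by norm_num), ENNReal.ofReal_inv_of_pos (by norm_num)]
    norm_num

lemma fairProb_le {x : List Bool} {b : Bool} {γ : ℝ} (hγ : 0 ≤ γ)
    (h : verdictProb M x b ≤ ENNReal.ofReal γ) (j : ℕ) : fairProb M b j (M.init x) ≤ γ := by
  rw [← ENNReal.ofReal_le_ofReal_iff hγ, ofReal_fairProb]
  exact (le_iSup (fun t => (evolve (fun c => (PMF.uniformOfFintype Bool).map (M.next c))
    (M.init x) t).toOuterMeasure {c | M.halt c.state = some b}) j).trans h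

end Simulate

/-! ### Deciding with advice -/

open Classical in
/-- The final phase, for an arbitrary word `y` in place of the advice. -/
lemma tr_pair_sim {M : TM Bool} {r : Regs M.Tape M.Extra} {w y : List Bool} {s m : ℕ}
    (h : AfterAdv r w y s) (hy : y.length ≤ m) (b : Bool) (p : ℝ) :
    Tr ((pairProg M.input).seq (simProg M)) p
      (fun σ d => (σ.scan (.inr .bus) = .bit b ∧ 0 ≤ d) ∨ 1 ≤ d) r.toStore
      (10 * (w.length + m) + 20 + (odo s + 1))
      (simErr M (p * (1 - p)) b (odo s) (M.init (pair w y))) := by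
  obtain ⟨σ, h1, h2, h3, -⟩ := dtr_pairProg M.input h
  have hσ : σ = simStore M (M.init (pair w y)) ⟨mcells s, 1⟩ fun k => σ (.inr k) := by
    funext k
    rcases k with k | k
    · rw [h2 k]
      simp only [simStore, Sum.elim_inl, TM.init]
      split_ifs with hk
      · simp only [up_tapeOfWord]
      · rfl
    · simp only [simStore, Sum.elim_inr, ← h3, Function.update_apply]
      split_ifs with hk
      · rw [hk]
      · rfl
  rw [hσ] at h1
  exact (h1.seqTr (tr_simProg b)).mono_time (by omega)

/-- If the number of tosses suffices, then the simulation is nearly as good as the machine. -/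
lemma simErr_le_add {M : TM Bool} {ρ γ κ : ℝ} (h0 : 0 ≤ ρ) (h1 : 2 * ρ ≤ 1) {N k : ℕ}
    (hN : (1 - ρ) ^ N ≤ 1 / 2) (hk : (1 / 2) ^ k ≤ κ) {b : Bool} {p : Polynomial ℕ} {x : List Bool}
    (hp : Clocked M p) (hγ : 0 ≤ γ) (hv : verdictProb M x (!b) ≤ ENNReal.ofReal γ) {m : ℕ}
    (hm : 2 * (N * (p.eval x.length + k)) ≤ m) : simErr M ρ b m (M.init x) ≤ γ + κ := by
  have h2 := simErr_le h0 h1 b (m / 2) _ _ (hp.haltsBy x) (m % 2) (Nat.mod_lt _ two_pos)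
  rw [Nat.div_add_mod] at h2
  have h3 := fairProb_le hγ hv (p.eval x.length)
  set j := p.eval x.length
  have h4 : (1 - ρ) ^ (m / 2) ≤ (1 / 2) ^ (j + k) :=
    calc (1 - ρ) ^ (m / 2) ≤ (1 - ρ) ^ (N * (j + k)) :=
          pow_le_pow_of_le_one (by linarith) (by linarith) (by omega)
      _ = ((1 - ρ) ^ N) ^ (j + k) := pow_mul _ _ _
      _ ≤ (1 / 2) ^ (j + k) := pow_le_pow_left₀ (pow_nonneg (by linarith) _) hN _
  have h5 : (2 : ℝ) ^ j * (1 - ρ) ^ (m / 2) ≤ κ :=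
    calc (2 : ℝ) ^ j * (1 - ρ) ^ (m / 2) ≤ 2 ^ j * (1 / 2) ^ (j + k) := by gcongr
      _ = (1 / 2) ^ k := by rw [pow_add, ← mul_assoc, ← mul_pow]; norm_num
      _ ≤ κ := hk
  linarith

lemma pow_le_odo (k : ℕ) : 5 ^ k ≤ odo k := by
  have h1 := two_mul_odo k
  have h2 : 1 ≤ 5 ^ k := Nat.one_le_pow _ _ (by norm_num)
  rw [pow_succ] at h1
  omega

/-- Sets in `BPP//log*` are decided in polynomial time: the advice for the lengths up to `2 ^ J` is
obtained from the coin, and then the probabilistic machine is simulated. -/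
theorem exists_decides {ε u : ℝ} (hε : 0 < ε) (hu : 0 < u) {A : Language Bool}
    (hA : A ∈ BPPLogStar) : ∃ (E : Apparatus) (T : ℕ → ℕ) (M : Machine), E.precision = ε ∧
      E.speed = u ∧ TimeConstructible T ∧ IsExponential T ∧ M.DecidesInPolyTime E T A := by
  classical
  obtain ⟨M, p, f, γ, hp, hf, hf', hγ0, hγ, hA⟩ := hA
  obtain ⟨T, h, hT, hT', hE⟩ := exists_coin hε hu
  -- The advice and the simulation may each add `κ` to the error `γ` of the machine.
  obtain ⟨κ, hκ⟩ : ∃ κ, κ = (1 / 2 - γ) / 8 := ⟨_, rfl⟩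
  obtain ⟨a, b, hab⟩ := hf'.two_pow
  obtain ⟨θ, hθ, hθ', k, hk⟩ := exists_advice hf.two_pow hab (δ := κ) (by linarith)
  obtain ⟨E, hE1, hE2, hE3⟩ := hE θ hθ hθ'.le
  obtain ⟨q, hq⟩ : ∃ q, q = θ / 5 ^ h := ⟨_, rfl⟩
  have hq0 : 0 < q := by rw [hq]; positivity
  have hq1 : q < 1 := by
    rw [hq, div_lt_one (by positivity)]
    exact hθ'.trans_le (one_le_pow₀ (by norm_num))
  have hρ0 : 0 < q * (1 - q) := mul_pos hq0 (by linarith)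
  have hρ1 : 2 * (q * (1 - q)) ≤ 1 := by nlinarith [sq_nonneg (2 * q - 1)]
  rw [← hq] at hE3
  obtain ⟨N, hN⟩ := exists_pow_lt_of_lt_one (show (0 : ℝ) < 1 / 2 by norm_num)
    (show 1 - q * (1 - q) < 1 by linarith)
  obtain ⟨k', hk'⟩ := exists_pow_lt_of_lt_one (show 0 < κ by linarith)
    (show (1 / 2 : ℝ) < 1 by norm_num)
  -- The number of tosses that the simulation needs is polynomial in `2 ^ J`.
  obtain ⟨c, e, hce⟩ : ∃ c e : ℕ, ∀ m, 1 ≤ m →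
      2 * (N * (p.eval (2 * m + (2 + 2 * (a * m + b))) + k')) ≤ c * m ^ e :=
    PolyBdd.exists_monomial ((PolyBdd.const 2).mul ((PolyBdd.const N).mul ((PolyBdd.eval p
      (((PolyBdd.const 2).mul .id).add ((PolyBdd.const 2).add ((PolyBdd.const 2).mul
        (((PolyBdd.const a).mul .id).add (.const b)))))).add (.const k'))))
  obtain ⟨c₁, hc₁⟩ : ∃ c₁, c₁ = 2 * (a + 1) + e := ⟨_, rfl⟩
  obtain ⟨c₀, hc₀⟩ : ∃ c₀, c₀ = k + c := ⟨_, rfl⟩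
  have hodo (J : ℕ) : 2 * (N * (p.eval (2 * 2 ^ J + (2 + 2 * (a * 2 ^ J + b))) + k')) ≤
      odo (c₁ * J + c₀ + h) :=
    calc _ ≤ c * (2 ^ J) ^ e := hce _ (Nat.one_le_two_pow)
      _ ≤ 5 ^ c * (5 ^ J) ^ e := Nat.mul_le_mul (Nat.lt_pow_self (by norm_num)).le
        (Nat.pow_le_pow_left (Nat.pow_le_pow_left (by norm_num) _) _)
      _ = 5 ^ (c + J * e) := by rw [← pow_mul, ← pow_add]
      _ ≤ 5 ^ (c₁ * J + c₀ + h) := by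
        refine Nat.pow_le_pow_right (by norm_num) ?_
        rw [hc₁, hc₀, add_mul, mul_comm e]
        omega
      _ ≤ _ := pow_le_odo _
  have hlog (n : ℕ) : Nat.log 2 (2 * (n - 1) + 1) ≤ n := by
    rw [log_two_mul_pred]
    exact Nat.clog_le_of_le_pow (Nat.lt_two_pow_self).le
  obtain ⟨P, hP⟩ := ((PolyBdd.const (T 1 + 2)).mul
    ((polyBdd_advTime polyBdd_double polyBdd_double_time c₁ c₀ h).add
      ((((PolyBdd.const 10).mul (PolyBdd.id.add (((PolyBdd.const c₁).mul .id).add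
        (.const c₀)))).add (.const 20)).add
        ((polyBdd_odo polyBdd_double c₁ (c₀ + h)).add (.const 1))))).add (.const 2)
  have := M.finite_tape
  have := M.finite_extra
  obtain ⟨Q, hQ⟩ : ∃ Q, Q = (advProg doubleProg c₁ c₀ h).seq
    ((pairProg M.input).seq (simProg M)) := ⟨_, rfl⟩
  refine ⟨E, T, toMachine Q (.inr .inp) (.inr .out) (.inr .bus),
    hE1, hE2, hT, hT', γ + 3 * κ, P, by linarith, fun w => ?_⟩
  obtain ⟨J, hJ⟩ : ∃ J, J = Nat.log 2 (2 * (w.length - 1) + 1) := ⟨_, rfl⟩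
  obtain ⟨s, hs⟩ : ∃ s, s = c₁ * J + c₀ := ⟨_, rfl⟩
  have hw : w.length ≤ 2 ^ J := by
    rw [hJ, log_two_mul_pred]
    exact Nat.le_pow_clog one_lt_two _
  have h1 := hk computes_doubleProg h (w := w) (c₁ := c₁) (c₀ := c₀) (by omega) (by omega) hJ hs
    (Φ := fun σ d => ∃ (r : Regs M.Tape M.Extra) (y : List Bool), AfterAdv r w y (s + h) ∧
      y.length ≤ s ∧ ((y = f (2 ^ J) ∧ 0 ≤ d) ∨ 1 ≤ d) ∧ σ = r.toStore)
    (fun r y d h1 h2 h3 => ⟨r, y, h1, h2, h3, rfl⟩)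
  rw [← hq] at h1
  have h2 := Tr.seq (Ev.shift (γ + κ) h1) (R := (pairProg M.input).seq (simProg M))
    (Ψ := fun σ d => (σ.scan (.inr .bus) = .bit (decide (w ∈ A)) ∧ 0 ≤ d) ∨ 1 ≤ d)
    (t' := 10 * (w.length + s) + 20 + (odo (s + h) + 1)) (by
      rintro _ d ⟨r, y, hr, hy, hd, rfl⟩
      refine (tr_pair_sim hr hy (decide (w ∈ A)) q).mono_err ?_
      rcases hd with ⟨rfl, hd⟩ | hd
      · refine (simErr_le_add hρ0.le hρ1 hN.le hk'.le hp hγ0.le ?_ ?_).trans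
          (show γ + κ ≤ d by linarith)
        · by_cases hwA : w ∈ A
          · simpa [hwA] using (hA (2 ^ J) w hw).1 hwA
          · simpa [hwA] using (hA (2 ^ J) w hw).2 hwA
        · rw [hs]
          refine le_trans ?_ (hodo J)
          have h3 : (pair w (f (2 ^ J))).length = 2 * w.length + (2 + 2 * (f (2 ^ J)).length) := by
            simp [pair, List.length_flatMap]; ring
          have h4 : a * J ≤ a * 2 ^ J := Nat.mul_le_mul_left _ (Nat.lt_two_pow_self).le
          have h5 := hab J
          have h6 : p.eval (pair w (f (2 ^ J))).length ≤
              p.eval (2 * 2 ^ J + (2 + 2 * (a * 2 ^ J + b))) := PolyBdd.eval_mono p (by omega)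
          gcongr
      -- If the advice may be wrong, then the error is bounded by `1` only.
      · have := (simErr_bounds hρ0.le hρ1 (decide (w ∈ A)) (odo (s + h))
          (M.init (pair w y))).2
        linarith)
  rw [← hQ] at h2
  obtain ⟨h3, h4⟩ := toMachine_spec (kout := .inr .out) (v := .inr .bus) (T := T)
    (R := fun c =>
      (w ∈ A ∧ (toMachine Q (.inr .inp) (.inr .out) (.inr .bus)).halt c.state = some true) ∨
      (w ∉ A ∧ (toMachine Q (.inr .inp) (.inr .out) (.inr .bus)).halt c.state = some false))
    hE3 hq0.le hq1.le (by
      intro σ x y hσ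
      change (w ∈ A ∧ some _ = some true) ∨ (w ∉ A ∧ some _ = some false)
      rw [hσ]
      by_cases hwA : w ∈ A <;> simp [hwA]) h2
  refine ⟨fun o => ?_, h4.trans_lt ?_⟩
  · obtain ⟨n, hn, hB⟩ := h3 o
    refine ⟨n, hn, hB.trans (le_trans ?_ (hP _))⟩
    have h5 : c₁ * J ≤ c₁ * w.length := Nat.mul_le_mul_left _ (hJ ▸ hlog _)
    dsimp only
    rw [← hJ, ← add_assoc (c₁ * J) c₀ h, ← hs]
    gcongr
    omega
  · rw [ENNReal.ofReal_lt_ofReal_iff (by linarith)]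
    linarith

end Collider

theorem mainTheorem3 (ε u : ℝ) (hε : 0 < ε) (hu : 0 < u) :
    (∀ A ∈ Collider.BPPLogStar,
      ∃ (E : Collider.Apparatus) (T : ℕ → ℕ) (M : Collider.Machine),
        E.precision = ε ∧ E.speed = u ∧
        Collider.TimeConstructible T ∧ Collider.IsExponential T ∧
        M.DecidesInPolyTime E T A) ∧
    (∀ (δ : ℝ) (f : ℕ → List Bool), 0 < δ → δ < 1 / 2 →
      Collider.IsPrefixFunction f → Collider.IsLogAdvice f →
      (∃ (E : Collider.Apparatus) (T : ℕ → ℕ) (M : Collider.Machine),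
        E.precision = ε ∧ E.speed = u ∧
        Collider.TimeConstructible T ∧ Collider.IsExponential T ∧
        M.ObtainsInPolyTime E T (fun n => f (2 ^ Nat.clog 2 n)) δ) ∧
      (Collider.HasExactLogLength f →
        ∃ (E : Collider.Apparatus) (T : ℕ → ℕ) (M : Collider.Machine),
          E.precision = ε ∧ E.speed = u ∧
          Collider.TimeConstructible T ∧ Collider.IsExponential T ∧
          M.ObtainsInPolyTime E T f δ)) :=
  ⟨fun _ hA => Collider.exists_decides hε hu hA, fun _ _ hδ _ hf hf' =>
    ⟨Collider.exists_obtains_clog hε hu hf hf' hδ,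
      fun h => Collider.exists_obtains_exact hε hu hf h hδ⟩⟩
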